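/- **Setting.** For $d\ge 1$ let $\mathcal G^d$ be the class of Gaussians $\mathcal N(\mu,\Sigma)$ on $\mathbb R^d$ with $\Sigma$ diagonal and $\Sigma_{ii}>0$. For a distribution $f$ and $\gamma\in(0,1)$ let $\mathcal H_\gamma(f)=\{(1-\gamma)f+\gamma h: h \text{ a probability distribution}\}$. $d_{\mathrm{TV}}$ is total variation distance, and $d_{\mathrm{TV}}(f,\mathcal F)=\inf_{q\in\mathcal F}d_{\mathrm{TV}}(f,q)$ (infinite if $\mathcal F=\emptyset$). A randomized algorithm $T$ on datasets of size $n$ is $(\varepsilon,\delta)$-DP if $\Pr[T(D)\in S]\le e^{\varepsilon}\Pr[T(D')\in S]+\delta$ for every set $S$ of outputs and all $D,D'$ of size $n$ that differ in at most one data point. Throughout, $\alpha,\beta,\gamma,\varepsilon\in(0,1)$ and $\delta\in(0,1/n)$, where $n\ge1$ is the number of samples. **Algorithm.** *Stable-Histogram*$(\varepsilon,\delta,D,(B_i))$: for a dataset $D$ of $n$ points and disjoint bins $(B_i)_{i\in\mathbb Z}$ let $p_i$ be the fraction of points in $B_i$. If $p_i=0$ put $\widetilde p_i=0$. Otherwise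 put $\widetilde p_i=p_i+\mathrm{Lap}(2/(\varepsilon n))$ with fresh Laplace noise, replaced by $0$ if it is less than $\frac{2\log(2/\delta)}{\varepsilon n}+\frac1n$. *Variance decoder*$(\gamma,\varepsilon,\delta,x)$: run Stable-Histogram$(\varepsilon,\delta)$ on the $\lfloor n/2\rfloor$ values $|x_{2i-1}-x_{2i}|/\sqrt2$ with bins $(2^k,2^{k+1}]$. Return $\{2^{k+1}:\widetilde p_k\ge(1-\gamma)^2/8\}$ if this set has at most $12/(1-\gamma)^2$ elements, and $\emptyset$ otherwise. *Mean decoder*$(\gamma,\varepsilon,\delta,s,x)$: run Stable-Histogram$(\varepsilon,\delta)$ on $x$ with bins $((i-\frac12)s,(i+\frac12)s]$. Return $\{is:\widetilde p_i\ge(1-\gamma)/8\}$ if this set has at most $12/(1-\gamma)$ elements, and $\emptyset$ otherwise. *Univariate-Gaussian-Decoder*$(\alpha,\beta,\gamma,\varepsilon,\delta,x)$: let $\widetilde V$ be the output of the variance decoder with parameters $(\gamma,\varepsilon/2,\delta/2)$. Let $T=12/(1-\gamma)^2$. For each $s\in\widetilde V$ let $\widetilde M_s$ be the output of the mean decoder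 with parameters $\gamma$, $\frac{\varepsilon/2}{\sqrt{6T\log(4/\delta)}}$, $\frac{\delta}{4T}$ and $s$. Return $$\widehat M=\{v+j\alpha s: s\in\widetilde V,\ v\in\widetilde M_s,\ j\in\mathbb Z,\ |j|\le\lceil1/\alpha\rceil\},\qquad \widehat V=\{s(1+\alpha)^{-j}: s\in\widetilde V,\ 0\le j<\lceil\log_{1+\alpha}2\rceil\}.$$ *Multivariate-Gaussian-Decoder*$(\alpha,\beta,\gamma,\varepsilon,\delta,D)$: for each $i\in[d]$ run Univariate-Gaussian-Decoder$(\alpha/d,\beta/d,\gamma,\varepsilon/d,\delta/d)$ on the $i$-th coordinates of $D$ with fresh randomness, to get $\widehat M_i,\widehat V_i$. Return $\widehat{\mathcal F}=\{\mathcal N(\widehat\mu,\operatorname{diag}(\widehat\sigma_1^2,\dots,\widehat\sigma_d^2)):\widehat\mu_i\in\widehat M_i,\ \widehat\sigma_i\in\widehat V_i \text{ for all } i\}$. **Lemma.** There are absolute constants $C,C'>0$ such that for all $d\ge1$, $\varepsilon\in(0,1)$ and $\delta\in(0,1)$ the following holds, with $$L=\Big(\frac{C\,d^2}{(1-\gamma)^5\alpha^2}\Big)^d,\qquad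 m=\max\Big\{2,\ C\Big(\frac{d\log(d/\beta\delta)}{(1-\gamma)^2\varepsilon}+\frac{d\log\big(d/((1-\gamma)\beta\delta)\big)\sqrt{\log\big(d/((1-\gamma)\delta)\big)}}{(1-\gamma)^2\varepsilon}\Big)\Big\}.$$ 1. For all $\alpha,\beta,\gamma\in(0,1)$ and all $n\ge1$ with $\delta<1/n$, Multivariate-Gaussian-Decoder on datasets of size $n$ is $(\varepsilon,\delta)$-DP. 2. It is an $L$-list-decodable learner for $\mathcal G^d$ that uses $m$ samples: for all $\alpha,\beta,\gamma\in(0,1)$, all $n\ge m$ with $\delta<1/n$, all $f\in\mathcal G^d$ and all $g\in\mathcal H_\gamma(f)$, the algorithm always outputs a set $\widehat{\mathcal F}$ of at most $L$ probability distributions, and if its input is $n$ i.i.d. samples from $g$, then $d_{\mathrm{TV}}(f,\widehat{\mathcal F})\le\alpha$ with probability at least $1-\beta$. 3. If $\delta<1/2$, then for all $\beta,\gamma\in(0,1)$ $$m\le C'\Big(1+\log\frac{d}{1-\gamma}\Big)^{3/2}\cdot\frac{d\log^{3/2}(1/\beta\delta)}{(1-\gamma)^2\varepsilon},\qquad\text{that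 is,}\quad m=\widetilde O\Big(\frac{d\log^{3/2}(1/\beta\delta)}{(1-\gamma)^2\varepsilon}\Big).$$ -/

import Mathlib

open MeasureTheory ProbabilityTheory
open scoped ENNReal

/-! ### Distributions -/

/-- Total variation distance `sup_S |p(S) - q(S)|`, the supremum over measurable sets. -/
noncomputable def tvDist {X : Type*} [MeasurableSpace X] (p q : Measure X) : ℝ≥0∞ :=
  ⨆ (S : Set X) (_ : MeasurableSet S), ENNReal.ofReal |p.real S - q.real S|

/-- Distance `inf_{q ∈ F} d_TV(p, q)` from a distribution to a set of distributions
(it is `∞` when the set is empty). -/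
noncomputable def tvDistSet {X : Type*} [MeasurableSpace X] (p : Measure X)
    (F : Set (Measure X)) : ℝ≥0∞ :=
  ⨅ q ∈ F, tvDist p q

/-- The set of all `γ`-corrupted distributions `(1 - γ) f + γ h` of `f`,
where `h` is an arbitrary probability distribution. -/
def corrupted {X : Type*} [MeasurableSpace X] (γ : ℝ) (f : Measure X) : Set (Measure X) :=
  {g | ∃ h : Measure X, IsProbabilityMeasure h ∧
    g = ENNReal.ofReal (1 - γ) • f + ENNReal.ofReal γ • h}

/-- The class of axis-aligned Gaussians on `ℝ^d`. -/
def axisAlignedGaussians (d : ℕ) : Set (Measure (EuclideanSpace ℝ (Fin d))) :=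
  {f | ∃ (μ : EuclideanSpace ℝ (Fin d)) (S : Matrix (Fin d) (Fin d) ℝ),
    (∀ i j, i ≠ j → S i j = 0) ∧ (∀ i, 0 < S i i) ∧ f = multivariateGaussian μ S}

/-- The Laplace distribution of scale `1`, with density `exp (-|x|) / 2`. -/
noncomputable def stdLaplace : Measure ℝ :=
  volume.withDensity fun x => ENNReal.ofReal (Real.exp (-|x|) / 2)

instance isProbabilityMeasure_stdLaplace : IsProbabilityMeasure stdLaplace := by
  have h0 : ∫ x : ℝ, Real.exp (-|x|) = 2 := by
    rw [integral_comp_abs (f := fun x => Real.exp (-x)), integral_exp_neg_Ioi_zero, mul_one]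
  have hi : Integrable (fun x : ℝ => Real.exp (-|x|)) :=
    Integrable.of_integral_ne_zero (by rw [h0]; norm_num)
  refine ⟨?_⟩
  rw [stdLaplace, withDensity_apply _ MeasurableSet.univ, Measure.restrict_univ,
    ← ofReal_integral_eq_lintegral_ofReal (hi.div_const 2)
      (Filter.Eventually.of_forall fun x => by positivity), integral_div, h0]
  norm_num

/-! ### Randomized algorithms, privacy, and list-decodable learning

A randomized algorithm with inputs in `I` and outputs in `Y` is a function `I → Ω → Y` of its input
and of a random tape `ω : Ω`, which is drawn from a fixed probability measure `P`, independently of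
the input. -/

/-- Two datasets of size `n` are neighbours if they differ in at most one data point. -/
def Neighbours {X : Type*} {n : ℕ} (D D' : Fin n → X) : Prop :=
  ∃ t : Fin n, ∀ s : Fin n, s ≠ t → D s = D' s

/-- `(ε, δ)`-differential privacy on datasets of size `n`. The inequality is required for every set
`S` of outputs, so for every choice of a sigma-algebra on the outputs. -/
def IsDP {X Y Ω : Type*} [MeasurableSpace Ω] (P : Measure Ω) {n : ℕ}
    (T : (Fin n → X) → Ω → Y) (ε δ : ℝ) : Prop :=
  ∀ D D' : Fin n → X, Neighbours D D' → ∀ S : Set Y,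
    P {ω | T D ω ∈ S} ≤ ENNReal.ofReal (Real.exp ε) * P {ω | T D' ω ∈ S} + ENNReal.ofReal δ

/-- `A α β γ n` is run on `n` samples, where `n` is an admissible sample size (`n ∈ N`). It is an
`L`-list-decodable learner for the class `F` using `m` samples. -/
def IsListDecodableLearner {X Ω : Type*} [MeasurableSpace X] [MeasurableSpace Ω] (P : Measure Ω)
    (A : ℝ → ℝ → ℝ → (n : ℕ) → (Fin n → X) → Ω → Set (Measure X)) (N : Set ℕ)
    (F : Set (Measure X)) (L m : ℝ → ℝ → ℝ → ℝ) : Prop :=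
  ∀ α ∈ Set.Ioo (0 : ℝ) 1, ∀ β ∈ Set.Ioo (0 : ℝ) 1, ∀ γ ∈ Set.Ioo (0 : ℝ) 1,
  ∀ n ∈ N, m α β γ ≤ (n : ℝ) →
  ∀ f ∈ F, ∀ g ∈ corrupted γ f,
    (∀ (D : Fin n → X) (ω : Ω), (∀ q ∈ A α β γ n D ω, IsProbabilityMeasure q) ∧
      (A α β γ n D ω).Finite ∧ ((A α β γ n D ω).ncard : ℝ) ≤ L α β γ) ∧
    ENNReal.ofReal (1 - β) ≤ ((Measure.pi fun _ : Fin n => g).prod P)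
      {z | tvDistSet f (A α β γ n z.1 z.2) ≤ ENNReal.ofReal α}

/-- `(ε, δ)`-DP `L`-list-decodable learner: a list-decodable learner that is `(ε, δ)`-differentially
private for all values of its parameters and all admissible dataset sizes. -/
def IsDPListDecodableLearner {X Ω : Type*} [MeasurableSpace X] [MeasurableSpace Ω] (P : Measure Ω)
    (A : ℝ → ℝ → ℝ → (n : ℕ) → (Fin n → X) → Ω → Set (Measure X)) (N : Set ℕ)
    (F : Set (Measure X)) (L m : ℝ → ℝ → ℝ → ℝ) (ε δ : ℝ) : Prop :=
  IsListDecodableLearner P A N F L m ∧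
  ∀ α ∈ Set.Ioo (0 : ℝ) 1, ∀ β ∈ Set.Ioo (0 : ℝ) 1, ∀ γ ∈ Set.Ioo (0 : ℝ) 1,
  ∀ n ∈ N, IsDP P (A α β γ n) ε δ

/-! ### The univariate decoder -/

/-- The fraction of the data points that lie in the bin `B`. -/
noncomputable def binFreq {X : Type*} {n : ℕ} (D : Fin n → X) (B : Set X) : ℝ :=
  ({t : Fin n | D t ∈ B}.ncard : ℝ) / n

open Classical in
/-- The stability-based `(ε, δ)`-DP histogram: the frequency of every non-empty bin is perturbed by
Laplace noise of scale `2 / (ε n)` (`ξ` is the tape of standard Laplace variables) and set to `0`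
if the result is below the threshold `2 log (2 / δ) / (ε n) + 1 / n`. Empty bins get `0`. -/
noncomputable def stableHistogram {X : Type*} {n : ℕ} (ε δ : ℝ) (D : Fin n → X) (B : ℤ → Set X)
    (ξ : ℤ → ℝ) (i : ℤ) : ℝ :=
  if binFreq D (B i) = 0 then 0
  else if binFreq D (B i) + 2 / (ε * n) * ξ i < 2 * Real.log (2 / δ) / (ε * n) + 1 / n then 0
  else binFreq D (B i) + 2 / (ε * n) * ξ i

open Classical in
/-- The bins of estimated frequency at least `τ`, or none at all if there are more than `T`. -/
noncomputable def heavyBins (τ T : ℝ) (p : ℤ → ℝ) : Set ℤ :=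
  if {i | τ ≤ p i}.encard ≤ (⌊T⌋₊ : ℕ∞) then {i | τ ≤ p i} else ∅

/-- The values `|x₁ - x₂| / √2` of the consecutive disjoint pairs of the dataset. -/
noncomputable def pairDiff {n : ℕ} (x : Fin n → ℝ) (t : Fin (n / 2)) : ℝ :=
  |x ⟨2 * t.1, by omega⟩ - x ⟨2 * t.1 + 1, by omega⟩| / Real.sqrt 2

/-- Univariate variance decoder, with bins `(2^k, 2^(k+1)]`. It returns a set of indices `k`, which
stand for the candidates `2^(k+1)` for the standard deviation. -/
noncomputable def varianceDecoder {n : ℕ} (γ ε δ : ℝ) (x : Fin n → ℝ) (ξ : ℤ → ℝ) : Set ℤ :=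
  heavyBins ((1 - γ) ^ 2 / 8) (12 / (1 - γ) ^ 2)
    (stableHistogram ε δ (pairDiff x) (fun k => Set.Ioc ((2 : ℝ) ^ k) ((2 : ℝ) ^ (k + 1))) ξ)

/-- Univariate mean decoder for a given approximate standard deviation `s`, with bins
`((i - 1/2) s, (i + 1/2) s]`. It returns the centres of the heavy bins. -/
noncomputable def meanDecoder {n : ℕ} (γ ε δ s : ℝ) (x : Fin n → ℝ) (ξ : ℤ → ℝ) : Set ℝ :=
  (fun i : ℤ => (i : ℝ) * s) '' heavyBins ((1 - γ) / 8) (12 / (1 - γ))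
    (stableHistogram ε δ x
      (fun i => Set.Ioc (((i : ℝ) - 1 / 2) * s) (((i : ℝ) + 1 / 2) * s)) ξ)

/-- Indices of the noise of one run of the univariate decoder: `(none, k)` is bin `k` of the
histogram for the variance, `(some k, i)` is bin `i` of the histogram for the mean that
is run with the candidate `2^(k+1)`. -/
abbrev UniIndex := Option ℤ × ℤ

/-- The candidates for the standard deviation found by the univariate decoder (indices `k`, standing
for `2^(k+1)`), with half of the privacy budget. -/
noncomputable def coarseVariances {n : ℕ} (γ ε δ : ℝ) (x : Fin n → ℝ) (ω : UniIndex → ℝ) : Set ℤ :=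
  varianceDecoder γ (ε / 2) (δ / 2) x fun k => ω (none, k)

/-- The candidate means found by the univariate decoder for the candidate `2^(k+1)`. The other half
of the privacy budget is divided among at most `T = 12 / (1 - γ)^2` runs of the mean decoder
according to advanced composition: each run gets
`ε₀ = (ε / 2) / √(6 T log (4 / δ))` and `δ₀ = δ / (4 T)`. -/
noncomputable def coarseMeans {n : ℕ} (γ ε δ : ℝ) (x : Fin n → ℝ) (ω : UniIndex → ℝ) (k : ℤ) :
    Set ℝ :=
  meanDecoder γ ((ε / 2) / Real.sqrt (6 * (12 / (1 - γ) ^ 2) * Real.log (4 / δ)))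
    (δ / (4 * (12 / (1 - γ) ^ 2))) ((2 : ℝ) ^ (k + 1)) x fun i => ω (some k, i)

/-- Univariate Gaussian decoder. It returns the list of means and the list of standard
deviations. The confidence parameter `β` only matters for the number of samples. -/
noncomputable def univariateDecoder {n : ℕ} (α _β γ ε δ : ℝ) (x : Fin n → ℝ)
    (ω : UniIndex → ℝ) : Set ℝ × Set ℝ :=
  ({u | ∃ k ∈ coarseVariances γ ε δ x ω, ∃ v ∈ coarseMeans γ ε δ x ω k,
      ∃ j : ℤ, |j| ≤ ⌈1 / α⌉ ∧ u = v + j * α * (2 : ℝ) ^ (k + 1)},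
   {s | ∃ k ∈ coarseVariances γ ε δ x ω,
      ∃ j : ℕ, j < ⌈Real.logb (1 + α) 2⌉₊ ∧ s = (2 : ℝ) ^ (k + 1) / (1 + α) ^ j})

/-! ### The multivariate decoder -/

/-- Law of the random tape of the multivariate decoder: independent standard Laplace variables. -/
noncomputable def noiseLaw (d : ℕ) : Measure (Fin d × UniIndex → ℝ) :=
  Measure.infinitePi fun _ => stdLaplace

/-- Run the univariate decoder on coordinate `i` of the dataset, with fresh noise and with
parameters `α/d, β/d, γ, ε/d, δ/d`. -/
noncomputable def coordinateDecoder (d : ℕ) (α β γ ε δ : ℝ) {n : ℕ}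
    (D : Fin n → EuclideanSpace ℝ (Fin d)) (ω : Fin d × UniIndex → ℝ) (i : Fin d) :
    Set ℝ × Set ℝ :=
  univariateDecoder (α / d) (β / d) γ (ε / d) (δ / d) (fun t => D t i) fun a => ω (i, a)

/-- Multivariate Gaussian decoder. -/
noncomputable def multivariateDecoder (d : ℕ) (ε δ α β γ : ℝ) (n : ℕ)
    (D : Fin n → EuclideanSpace ℝ (Fin d)) (ω : Fin d × UniIndex → ℝ) :
    Set (Measure (EuclideanSpace ℝ (Fin d))) :=
  {q | ∃ (μ : EuclideanSpace ℝ (Fin d)) (σ : Fin d → ℝ),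
    (∀ i, μ i ∈ (coordinateDecoder d α β γ ε δ D ω i).1) ∧
    (∀ i, σ i ∈ (coordinateDecoder d α β γ ε δ D ω i).2) ∧
    q = multivariateGaussian μ (Matrix.diagonal fun i => σ i ^ 2)}

/-- `d log(d/(βδ)) / ((1-γ)² ε) + d log(d/((1-γ)βδ)) √(log(d/((1-γ)δ))) / ((1-γ)² ε)` -/
noncomputable def sampleRate (d : ℕ) (ε δ β γ : ℝ) : ℝ :=
  d * Real.log (d / (β * δ)) / ((1 - γ) ^ 2 * ε) +
    d * Real.log (d / ((1 - γ) * β * δ)) * Real.sqrt (Real.log (d / ((1 - γ) * δ))) /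
      ((1 - γ) ^ 2 * ε)

/-!
The constants do not depend on the dimension because every step acts on one coordinate at a time,
and the privacy, the list size, the failure probability and the distance in total variation all
compose over the `d` coordinates.

*Privacy.* Changing one data point changes the counts of at most two bins, each by one. This has
the same effect as a shift of at most two Laplace variables by `ε / 2`, unless a bin that holds only
the changed point passes the threshold, which has probability at most `δ / 2`
(`exists_shift_stableHistogram`). A shift of the tape has an explicit density, so a mechanism is
private as soon as its privacy loss `∑ (|ξ i + c i| - |ξ i|)` rarely exceeds `ε`
(`Indist.of_shift`). For the mean decoders, which are run for up to `T = 12 / (1 - γ) ^ 2`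
candidates, the loss is a sum of at most `2 T` independent bounded variables whose means are
quadratic in the shift, and Hoeffding's inequality bounds it by `ε / 2` (`laplaceTape_loss_tail`,
`indist_meanCode`). The decoders only have countably many possible outputs up to a deterministic
function, so measurability of the sets of outputs is no issue: finite sets of bins serve as codes of
the outputs. `Indist.adaptive` composes the variance decoder with the mean decoders, and `Indist.pi`
the coordinates (`isDP_multivariateDecoder`).

*Accuracy.* A bin of probability at least `8/5 τ` receives a fraction `6/5 τ` of the data by a
Chernoff bound, and if the noise is below `τ / 5` in all of the at most `n` non-empty bins, then it
is listed, and the list is not too long (`measure_notMem_heavyBins_le`). The difference of two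
samples of a Gaussian, divided by `√2`, is a centred Gaussian with the same standard deviation `σ`,
and lies with probability at least `1 / 5` in the dyadic shell of `σ`; a corrupted pair does so with
probability at least `(1 - γ) ^ 2 / 5`. Given a candidate `s` with `σ ≤ s < 2 σ`, the bin of length
`s` around the mean has probability at least `(1 - γ) / 5`. Refining both candidates by grids yields
a relative error `α / d` (`exists_mem_univariateDecoder`). Gaussians with such parameters are
`α / d`-close: their densities cross in at most two points, and the excess mass between them is a
change of the distribution function over short intervals (`indist_gaussianReal_of_close`). Product
measures are then `α`-close.

*Sizes.* A coordinate has at most `12 / (1 - γ) ^ 2 * 12 / (1 - γ) * 5 d / α` means and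
`12 / (1 - γ) ^ 2 * 2 d / α` standard deviations, and `12 ^ 3 * 10 = 17280`. The constant `20000`
exceeds this number, and is also what the two histograms ask of the sample size
(`variance_sampleSize`, `mean_sampleSize`).
-/

open scoped NNReal

/-! ### Indistinguishable measures -/

/-- `(ε, δ)`-indistinguishability of two measures, in its functional form: the test objects are
`[0, 1]`-valued measurable functions instead of measurable sets. This form composes well, because
the conditional probability of an event, given a part of the output, is again a test function.
For `ε = 0` it bounds the total variation distance by `δ`. -/
def Indist {Y : Type*} [MeasurableSpace Y] (ε δ : ℝ) (μ ν : Measure Y) : Prop :=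
  ∀ g : Y → ℝ≥0∞, Measurable g → (∀ y, g y ≤ 1) →
    ∫⁻ y, g y ∂μ ≤ ENNReal.ofReal (Real.exp ε) * ∫⁻ y, g y ∂ν + ENNReal.ofReal δ

section Indist

variable {Y Z : Type*} [MeasurableSpace Y] [MeasurableSpace Z]

theorem Indist.measure_le {ε δ : ℝ} {μ ν : Measure Y} (h : Indist ε δ μ ν) {S : Set Y}
    (hS : MeasurableSet S) :
    μ S ≤ ENNReal.ofReal (Real.exp ε) * ν S + ENNReal.ofReal δ := by
  have := h (S.indicator 1) (measurable_one.indicator hS)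
    (fun y => by by_cases hy : y ∈ S <;> simp [hy])
  simpa [lintegral_indicator_one hS] using this

theorem Indist.mono {ε ε' δ δ' : ℝ} {μ ν : Measure Y} (h : Indist ε δ μ ν) (hε : ε ≤ ε')
    (hδ : δ ≤ δ') : Indist ε' δ' μ ν := fun g hg hg1 =>
  (h g hg hg1).trans (by gcongr)

theorem Indist.map {ε δ : ℝ} {μ ν : Measure Y} (h : Indist ε δ μ ν) {f : Y → Z}
    (hf : Measurable f) : Indist ε δ (μ.map f) (ν.map f) := fun g hg hg1 => by
  rw [lintegral_map hg hf, lintegral_map hg hf]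
  exact h _ (hg.comp hf) fun y => hg1 _

/-- A triangle inequality. -/
theorem Indist.trans_zero {δ δ' : ℝ} (hδ : 0 ≤ δ) (hδ' : 0 ≤ δ') {μ ν ρ : Measure Y}
    (h : Indist 0 δ μ ν) (h' : Indist 0 δ' ν ρ) : Indist 0 (δ + δ') μ ρ := fun g hg hg1 => by
  have h1 := h g hg hg1
  have h2 := h' g hg hg1
  simp only [Real.exp_zero, ENNReal.ofReal_one, one_mul] at h1 h2 ⊢
  rw [add_comm δ, ENNReal.ofReal_add hδ' hδ, ← add_assoc]
  exact h1.trans (by gcongr)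

/-- One step of composition: `a` and `a'` are the conditional expectations, given the first output,
of a test function of two outputs. -/
theorem Indist.lintegral_le {ε₁ ε₂ δ₁ δ₂ : ℝ} (hδ₁ : 0 ≤ δ₁) (hδ₂ : 0 ≤ δ₂) {μ ν : Measure Y}
    [IsProbabilityMeasure μ] (h : Indist ε₁ δ₁ μ ν) {a a' : Y → ℝ≥0∞} (ha' : Measurable a')
    (ha : ∀ᵐ y ∂μ, a y ≤ 1 ∧
      a y ≤ ENNReal.ofReal (Real.exp ε₂) * a' y + ENNReal.ofReal δ₂) :
    ∫⁻ y, a y ∂μ ≤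
      ENNReal.ofReal (Real.exp (ε₁ + ε₂)) * ∫⁻ y, a' y ∂ν + ENNReal.ofReal (δ₁ + δ₂) := by
  -- the bound on `a`, truncated at `1` to be an admissible test function
  set k : Y → ℝ≥0∞ := fun y => min 1 (ENNReal.ofReal (Real.exp ε₂) * a' y) with hk
  have hkm : Measurable k := measurable_const.min (ha'.const_mul _)
  have key : ∀ᵐ y ∂μ, a y ≤ k y + ENNReal.ofReal δ₂ := by
    filter_upwards [ha] with y hy
    simp only [hk, min_def]
    split_ifs
    · exact hy.1.trans le_self_add
    · exact hy.2
  calc ∫⁻ y, a y ∂μ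
      ≤ ∫⁻ y, (k y + ENNReal.ofReal δ₂) ∂μ := lintegral_mono_ae key
    _ = ∫⁻ y, k y ∂μ + ENNReal.ofReal δ₂ := by
        rw [lintegral_add_right _ measurable_const]; simp
    _ ≤ (ENNReal.ofReal (Real.exp ε₁) * ∫⁻ y, k y ∂ν + ENNReal.ofReal δ₁)
          + ENNReal.ofReal δ₂ := by
        have := h k hkm (fun v => min_le_left _ _)
        gcongr
    _ ≤ (ENNReal.ofReal (Real.exp ε₁) * ∫⁻ y, ENNReal.ofReal (Real.exp ε₂) * a' y ∂ν
          + ENNReal.ofReal δ₁) + ENNReal.ofReal δ₂ := by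
        gcongr
        exact min_le_right _ _
    _ = _ := by
        rw [lintegral_const_mul _ ha', ← mul_assoc, ← ENNReal.ofReal_mul (by positivity),
          ← Real.exp_add, add_assoc, ENNReal.ofReal_add hδ₁ hδ₂]

theorem Indist.prod {ε₁ ε₂ δ₁ δ₂ : ℝ} (hδ₁ : 0 ≤ δ₁) (hδ₂ : 0 ≤ δ₂) {μ₁ ν₁ : Measure Y}
    {μ₂ ν₂ : Measure Z} [IsProbabilityMeasure μ₁] [IsProbabilityMeasure μ₂] [SFinite ν₂]
    (h₁ : Indist ε₁ δ₁ μ₁ ν₁) (h₂ : Indist ε₂ δ₂ μ₂ ν₂) :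
    Indist (ε₁ + ε₂) (δ₁ + δ₂) (μ₁.prod μ₂) (ν₁.prod ν₂) := fun g hg hg1 => by
  rw [lintegral_prod _ hg.aemeasurable, lintegral_prod _ hg.aemeasurable]
  refine h₁.lintegral_le hδ₁ hδ₂ hg.lintegral_prod_right' (.of_forall fun y => ⟨?_, ?_⟩)
  · exact (lintegral_mono fun z => hg1 (y, z)).trans (by simp)
  · exact h₂ (fun z => g (y, z)) (hg.comp (measurable_const.prodMk measurable_id)) fun z => hg1 _

/-- Adaptive composition. The first output is `V`, the second is drawn from the law `P₂.map (F V)`.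
Given `V = v`, the second outputs need only be indistinguishable for those `v` that satisfy `p`,
a property that the first output always has. -/
theorem Indist.adaptive [DiscreteMeasurableSpace Y] {Ω₁ Ω₂ : Type*} [MeasurableSpace Ω₁]
    [MeasurableSpace Ω₂] {P₁ : Measure Ω₁} {P₂ : Measure Ω₂} [IsProbabilityMeasure P₁]
    [IsProbabilityMeasure P₂]
    {ε₁ ε₂ δ₁ δ₂ : ℝ} (hδ₁ : 0 ≤ δ₁) (hδ₂ : 0 ≤ δ₂)
    {V V' : Ω₁ → Y} (hV : Measurable V) (hV' : Measurable V')
    (h₁ : Indist ε₁ δ₁ (P₁.map V) (P₁.map V')) {p : Y → Prop} (hp : ∀ ω, p (V ω))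
    {F F' : Y → Ω₂ → Z} (hF : Measurable fun x : Y × Ω₂ => F x.1 x.2)
    (hF' : Measurable fun x : Y × Ω₂ => F' x.1 x.2)
    (h₂ : ∀ v, p v → Indist ε₂ δ₂ (P₂.map (F v)) (P₂.map (F' v))) :
    Indist (ε₁ + ε₂) (δ₁ + δ₂)
      ((P₁.prod P₂).map fun ω => (V ω.1, F (V ω.1) ω.2))
      ((P₁.prod P₂).map fun ω => (V' ω.1, F' (V' ω.1) ω.2)) := fun g hg hg1 => by
  have hint : ∀ {V : Ω₁ → Y} {F : Y → Ω₂ → Z}, Measurable V →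
      (Measurable fun x : Y × Ω₂ => F x.1 x.2) →
      (Measurable fun v => ∫⁻ z, g (v, F v z) ∂P₂) ∧
      ∫⁻ y, g y ∂((P₁.prod P₂).map fun ω => (V ω.1, F (V ω.1) ω.2)) =
        ∫⁻ v, ∫⁻ z, g (v, F v z) ∂P₂ ∂(P₁.map V) := by
    intro V F hV hF
    have h : Measurable fun x : Y × Ω₂ => g (x.1, F x.1 x.2) :=
      hg.comp (measurable_fst.prodMk hF)
    have hV2 : Measurable fun ω : Ω₁ × Ω₂ => (V ω.1, ω.2) :=
      (hV.comp measurable_fst).prodMk measurable_snd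
    have h3 : Measurable fun ω : Ω₁ × Ω₂ => g (V ω.1, F (V ω.1) ω.2) := h.comp hV2
    have h4 : Measurable fun v => ∫⁻ z, g (v, F v z) ∂P₂ := h.lintegral_prod_right'
    refine ⟨h4, ?_⟩
    have h5 : Measurable fun ω : Ω₁ × Ω₂ => (V ω.1, F (V ω.1) ω.2) :=
      (hV.comp measurable_fst).prodMk (hF.comp hV2)
    rw [lintegral_map hg h5,
      lintegral_prod _ h3.aemeasurable, lintegral_map h4 hV]
  have := Measure.isProbabilityMeasure_map (μ := P₁) hV.aemeasurable
  rw [(hint hV hF).2, (hint hV' hF').2]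
  refine h₁.lintegral_le hδ₁ hδ₂ (hint hV' hF').1 ?_
  rw [ae_map_iff hV.aemeasurable]
  · refine .of_forall fun ω => ⟨?_, ?_⟩
    · exact (lintegral_mono fun z => hg1 _).trans (by simp)
    · have hs : ∀ v, Measurable fun z : Z => g (v, z) := fun v =>
        hg.comp (measurable_const.prodMk measurable_id)
      have h3 := h₂ (V ω) (hp ω) (fun z => g (V ω, z)) (hs _) (fun z => hg1 _)
      have hF1 : Measurable (F (V ω)) := hF.comp (measurable_const.prodMk measurable_id)
      have hF1' : Measurable (F' (V ω)) := hF'.comp (measurable_const.prodMk measurable_id)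
      rwa [lintegral_map (hs _) hF1, lintegral_map (hs _) hF1'] at h3
  · exact .of_discrete

/-- Basic composition of `d` independent mechanisms. -/
theorem Indist.pi : ∀ {d : ℕ} {X : Type*} [MeasurableSpace X] {ε δ : ℝ}, 0 ≤ δ →
    ∀ {μ ν : Fin d → Measure X} [∀ i, IsProbabilityMeasure (μ i)] [∀ i, IsProbabilityMeasure (ν i)],
    (∀ i, Indist ε δ (μ i) (ν i)) →
    Indist (d * ε) (d * δ) (Measure.pi μ) (Measure.pi ν)
  | 0, X, _, ε, δ, hδ, μ, ν, _, _, h => fun g hg hg1 => by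
      have : μ = ν := funext fun i => i.elim0
      simp [this]
  | d + 1, X, _, ε, δ, hδ, μ, ν, _, _, h => by
      have ih := Indist.pi hδ (μ := fun j : Fin d => μ (Fin.succAbove 0 j))
        (ν := fun j : Fin d => ν (Fin.succAbove 0 j)) fun i => h _
      have h2 := ((h 0).prod hδ (by positivity) ih).map
        (MeasurableEquiv.piFinSuccAbove (fun _ : Fin (d + 1) => X) 0).symm.measurable
      rw [(measurePreserving_piFinSuccAbove μ 0).symm.map_eq,
        (measurePreserving_piFinSuccAbove ν 0).symm.map_eq] at h2
      convert h2 using 1 <;> push_cast <;> ring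

end Indist

/-! ### Shifts of the Laplace tape -/

theorem measurable_exp_neg_abs_div_two :
    Measurable fun x : ℝ => ENNReal.ofReal (Real.exp (-|x|) / 2) := by
  fun_prop

/-- A shift by `c` multiplies the Laplace density by `exp (|x| - |x - c|)`. -/
theorem stdLaplace_map_add (c : ℝ) :
    stdLaplace.map (fun x => x + c) =
      stdLaplace.withDensity fun x => ENNReal.ofReal (Real.exp (|x| - |x - c|)) := by
  ext s hs
  have hm : Measurable fun x : ℝ => x + c := by fun_prop
  rw [Measure.map_apply hm hs, stdLaplace, withDensity_apply _ (hm hs),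
    ← withDensity_mul _ measurable_exp_neg_abs_div_two (by fun_prop), withDensity_apply _ hs,
    ← lintegral_indicator (hm hs), ← lintegral_indicator hs,
    ← lintegral_add_right_eq_self (μ := volume)
      (s.indicator ((fun x : ℝ => ENNReal.ofReal (Real.exp (-|x|) / 2)) *
        fun x => ENNReal.ofReal (Real.exp (|x| - |x - c|)))) c]
  refine lintegral_congr fun x => ?_
  by_cases hx : x + c ∈ s
  · rw [Set.indicator_of_mem (show x ∈ (fun x => x + c) ⁻¹' s from hx), Set.indicator_of_mem hx,
      Pi.mul_apply, ← ENNReal.ofReal_mul (by positivity), div_mul_eq_mul_div, ← Real.exp_add]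
    congr 3
    rw [add_sub_cancel_right]; ring_nf
  · rw [Set.indicator_of_notMem (show x ∉ (fun x => x + c) ⁻¹' s from hx),
      Set.indicator_of_notMem hx]

theorem stdLaplace_Ici {t : ℝ} (ht : 0 ≤ t) :
    stdLaplace (Set.Ici t) = ENNReal.ofReal (Real.exp (-t) / 2) := by
  have hi : IntegrableOn (fun x : ℝ => Real.exp (-x) / 2) (Set.Ioi t) :=
    (integrableOn_exp_neg_Ioi t).div_const 2
  rw [stdLaplace, withDensity_apply _ measurableSet_Ici,
    setLIntegral_congr (Ioi_ae_eq_Ici (a := t)).symm,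
    setLIntegral_congr_fun (g := fun x => ENNReal.ofReal (Real.exp (-x) / 2)) measurableSet_Ioi
      (fun x (hx : t < x) => by simp only; rw [abs_of_pos (ht.trans_lt hx)]),
    ← ofReal_integral_eq_lintegral_ofReal hi (Filter.Eventually.of_forall fun x => by positivity),
    integral_div, integral_exp_neg_Ioi]

theorem stdLaplace_map_neg : stdLaplace.map (fun x => -x) = stdLaplace := by
  ext s hs
  have hm : Measurable fun x : ℝ => -x := by fun_prop
  rw [Measure.map_apply hm hs, stdLaplace, withDensity_apply _ (hm hs), withDensity_apply _ hs,
    ← lintegral_indicator (hm hs), ← lintegral_indicator hs,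
    ← lintegral_neg_eq_self (μ := volume) (s.indicator _)]
  refine lintegral_congr fun x => ?_
  simp only [Set.indicator, Set.mem_preimage, abs_neg]
  rfl

theorem stdLaplace_Iic {t : ℝ} (ht : 0 ≤ t) :
    stdLaplace (Set.Iic (-t)) = ENNReal.ofReal (Real.exp (-t) / 2) := by
  rw [← stdLaplace_Ici ht, ← stdLaplace_map_neg, Measure.map_apply measurable_neg measurableSet_Iic,
    stdLaplace_map_neg]
  congr 1
  ext x
  simp

theorem stdLaplace_le_abs {t : ℝ} (ht : 0 ≤ t) :
    stdLaplace {x | t ≤ |x|} ≤ ENNReal.ofReal (Real.exp (-t)) := by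
  have : {x : ℝ | t ≤ |x|} ⊆ Set.Ici t ∪ Set.Iic (-t) := by
    intro x (hx : t ≤ |x|)
    rcases le_abs.1 hx with h | h
    · exact Or.inl h
    · exact Or.inr (show x ≤ -t by linarith)
  refine (measure_mono this).trans ((measure_union_le _ _).trans ?_)
  rw [stdLaplace_Ici ht, stdLaplace_Iic ht, ← ENNReal.ofReal_add (by positivity) (by positivity)]
  apply le_of_eq; congr 1; ring

section Tape

variable {ι : Type*}

/-- A tape of independent standard Laplace variables. -/
noncomputable abbrev laplaceTape (ι : Type*) : Measure (ι → ℝ) :=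
  Measure.infinitePi fun _ => stdLaplace

theorem laplaceTape_eval (i : ι) {s : Set ℝ} (hs : MeasurableSet s) :
    laplaceTape ι {ω | ω i ∈ s} = stdLaplace s := by
  rw [← Measure.infinitePi_map_eval (fun _ : ι => stdLaplace) i,
    Measure.map_apply (measurable_pi_apply i) hs]
  rfl

theorem laplaceTape_iIndepFun : iIndepFun (fun (i : ι) (ω : ι → ℝ) => ω i) (laplaceTape ι) :=
  iIndepFun_infinitePi (X := fun _ ω => ω) (by fun_prop)

/-- A shift of finitely many coordinates of the tape has an explicit density. -/
theorem laplaceTape_map_add (c : ι → ℝ) (J : Finset ι) (hc : ∀ i ∉ J, c i = 0) :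
    (laplaceTape ι).map (fun ω => ω + c) = (laplaceTape ι).withDensity fun ω =>
      ENNReal.ofReal (Real.exp (∑ i ∈ J, (|ω i| - |ω i - c i|))) := by
  classical
  have h1 : (laplaceTape ι).map (fun ω => ω + c) =
      Measure.infinitePi fun i => stdLaplace.map fun x => x + c i :=
    Measure.infinitePi_map_pi (fun _ : ι => stdLaplace) (f := fun i x => x + c i)
      (fun i => by fun_prop)
  have hpr : ∀ i, IsProbabilityMeasure (stdLaplace.map fun x => x + c i) := fun i =>
    Measure.isProbabilityMeasure_map (by fun_prop)
  rw [h1]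
  refine (Measure.eq_infinitePi _ fun s t ht => ?_).symm
  have hmeas : MeasurableSet ((s : Set ι).pi t) := .pi s.countable_toSet fun i _ => ht i
  rw [withDensity_apply _ hmeas, ← lintegral_indicator hmeas]
  set X : ι → ℝ → ℝ≥0∞ := fun i x =>
    (if i ∈ s then (t i).indicator 1 x else 1) *
      ENNReal.ofReal (Real.exp (|x| - |x - c i|)) with hX
  have hXm : ∀ i, Measurable (X i) := by
    intro i
    refine Measurable.mul ?_ (by fun_prop)
    by_cases hi : i ∈ s
    · simpa [hi] using measurable_one.indicator (ht i)
    · simp [hi]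
  have hpt : ∀ ω : ι → ℝ, ((s : Set ι).pi t).indicator (fun ω =>
      ENNReal.ofReal (Real.exp (∑ i ∈ J, (|ω i| - |ω i - c i|)))) ω
      = ∏ i ∈ s ∪ J, X i (ω i) := by
    intro ω
    have h2 : ∑ i ∈ J, (|ω i| - |ω i - c i|) = ∑ i ∈ s ∪ J, (|ω i| - |ω i - c i|) :=
      Finset.sum_subset Finset.subset_union_right fun i _ hi => by simp [hc i hi]
    have h3 : ∏ i ∈ s ∪ J, (if i ∈ s then (t i).indicator (1 : ℝ → ℝ≥0∞) (ω i) else 1)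
        = ((s : Set ι).pi t).indicator 1 ω := by
      rw [Finset.prod_ite_mem, Finset.union_inter_cancel_left]
      by_cases h : ω ∈ (s : Set ι).pi t
      · rw [Set.indicator_of_mem h]
        exact Finset.prod_eq_one fun i hi => by simp [Set.indicator_of_mem (h i hi)]
      · rw [Set.indicator_of_notMem h]
        simp only [Set.mem_pi, not_forall] at h
        obtain ⟨i, hi, hit⟩ := h
        exact Finset.prod_eq_zero hi (Set.indicator_of_notMem hit _)
    rw [hX, Finset.prod_mul_distrib, h3, ← ENNReal.ofReal_prod_of_nonneg
      (fun i _ => (Real.exp_pos _).le), ← Real.exp_sum, ← h2]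
    by_cases h : ω ∈ (s : Set ι).pi t <;> simp [Set.indicator, h]
  simp_rw [hpt]
  rw [lintegral_prod_eq_prod_lintegral_of_indepFun (μ := laplaceTape ι) (s ∪ J)
    (fun i ω => X i (ω i))
    (laplaceTape_iIndepFun.comp X hXm) fun i => (hXm i).comp (measurable_pi_apply i)]
  have h4 : ∀ i, ∫⁻ ω, X i (ω i) ∂(laplaceTape ι) =
      if i ∈ s then (stdLaplace.map fun x => x + c i) (t i) else 1 := by
    intro i
    rw [← lintegral_map (μ := laplaceTape ι) (hXm i) (measurable_pi_apply i),
      Measure.infinitePi_map_eval]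
    by_cases hi : i ∈ s
    · simp only [hX, hi, if_true]
      rw [stdLaplace_map_add, withDensity_apply _ (ht i), ← lintegral_indicator (ht i)]
      refine lintegral_congr fun x => ?_
      by_cases h : x ∈ t i <;> simp [h]
    · simp only [hX, hi, if_false, one_mul]
      have h5 := (hpr i).measure_univ
      rwa [stdLaplace_map_add, withDensity_apply _ .univ, Measure.restrict_univ] at h5
  simp_rw [h4]
  rw [Finset.prod_ite_mem, Finset.union_inter_cancel_left]

/-- Two mechanisms `T` and `T'` that agree up to a shift of the tape, outside a bad event, are
indistinguishable, as soon as the privacy loss `∑ (|ω i + c i| - |ω i|)` rarely exceeds `ε`. -/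
theorem Indist.of_shift {Y : Type*} [MeasurableSpace Y] {T T' : (ι → ℝ) → Y} (hT : Measurable T)
    (hT' : Measurable T') {c : ι → ℝ} {J : Finset ι} (hc : ∀ i ∉ J, c i = 0) {bad : Set (ι → ℝ)}
    (hbad : ∀ ω ∉ bad, T ω = T' (ω + c)) {ε δ₁ δ₂ : ℝ} (hδ₁ : 0 ≤ δ₁) (hδ₂ : 0 ≤ δ₂)
    (h₁ : laplaceTape ι bad ≤ ENNReal.ofReal δ₁)
    (h₂ : laplaceTape ι {ω | ε < ∑ i ∈ J, (|ω i + c i| - |ω i|)} ≤ ENNReal.ofReal δ₂) :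
    Indist ε (δ₁ + δ₂) ((laplaceTape ι).map T) ((laplaceTape ι).map T') := fun g hg hg1 => by
  set P := laplaceTape ι
  set ρ : (ι → ℝ) → ℝ := fun ω => ∑ i ∈ J, (|ω i| - |ω i - c i|) with hρ
  have hρm : Measurable ρ := by fun_prop
  have hadd : Measurable fun ω : ι → ℝ => ω + c := by fun_prop
  have hmap : P.map (fun ω => ω + c) = P.withDensity fun ω => ENNReal.ofReal (Real.exp (ρ ω)) :=
    laplaceTape_map_add c J hc
  have hgT : Measurable fun ω => g (T' ω) := hg.comp hT'
  rw [lintegral_map hg hT, lintegral_map hg hT']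
  set E : Set (ι → ℝ) := {ω | ε < ρ ω} with hE
  have hEm : MeasurableSet E := measurableSet_lt measurable_const hρm
  set b := toMeasurable P bad
  have hbm : MeasurableSet b := measurableSet_toMeasurable _ _
  calc ∫⁻ ω, g (T ω) ∂P
      ≤ ∫⁻ ω, (g (T' (ω + c)) + b.indicator 1 ω) ∂P := by
        refine lintegral_mono fun ω => ?_
        by_cases h : ω ∈ b
        · rw [Set.indicator_of_mem h]
          exact (hg1 _).trans le_add_self
        · rw [hbad ω fun h' => h (subset_toMeasurable _ _ h')]
          exact le_self_add
    _ = ∫⁻ ω, g (T' (ω + c)) ∂P + P bad := by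
        rw [lintegral_add_right _ (measurable_one.indicator hbm), lintegral_indicator_one hbm,
          measure_toMeasurable]
    _ = ∫⁻ ω, g (T' ω) ∂(P.map fun ω => ω + c) + P bad := by
        rw [lintegral_map hgT hadd]
    _ ≤ (∫⁻ ω, (ENNReal.ofReal (Real.exp ε) * g (T' ω)) ∂P + (P.map fun ω => ω + c) E) + P bad := by
        gcongr
        calc ∫⁻ ω, g (T' ω) ∂(P.map fun ω => ω + c)
            = ∫⁻ ω in Eᶜ, g (T' ω) ∂(P.map fun ω => ω + c) +
              ∫⁻ ω in E, g (T' ω) ∂(P.map fun ω => ω + c) := by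
              rw [add_comm, lintegral_add_compl _ hEm]
          _ ≤ _ := by
              refine add_le_add ?_ ?_
              · rw [hmap, ← lintegral_indicator hEm.compl, lintegral_withDensity_eq_lintegral_mul _
                  (by fun_prop) (hgT.indicator hEm.compl)]
                refine lintegral_mono fun ω => ?_
                rw [Pi.mul_apply]
                by_cases h : ω ∈ E
                · rw [Set.indicator_of_notMem (by simpa using h)]; simp
                · rw [Set.indicator_of_mem (by simpa using h)]
                  have : ρ ω ≤ ε := not_lt.1 h
                  gcongr
              · exact (lintegral_mono fun ω => hg1 _).trans (by simp)
    _ ≤ (ENNReal.ofReal (Real.exp ε) * ∫⁻ ω, g (T' ω) ∂P + ENNReal.ofReal δ₂)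
          + ENNReal.ofReal δ₁ := by
        rw [lintegral_const_mul _ hgT, Measure.map_apply hadd hEm]
        gcongr
        refine le_trans (le_of_eq ?_) h₂
        congr 1
        ext ω
        simp [hE, hρ]
    _ = _ := by rw [add_assoc, ← ENNReal.ofReal_add hδ₂ hδ₁, add_comm δ₂]

/-- The mean privacy loss of a shift by `c` is at most `c ^ 2`. -/
theorem integral_abs_add_sub_abs_le {a c : ℝ} (ha : a ≤ 1) (hc : |c| ≤ a) :
    ∫ x, (|x + c| - |x|) ∂stdLaplace ≤ a ^ 2 := by
  have hX : ∀ x : ℝ, |(|x + c| - |x|)| ≤ a := fun x =>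
    (abs_abs_sub_abs_le_abs_sub _ _).trans (by rwa [add_sub_cancel_left])
  have hint : Integrable (fun x : ℝ => |x + c| - |x|) stdLaplace :=
    Integrable.of_bound (by fun_prop) a (.of_forall fun x => hX x)
  have hb : ∀ x : ℝ, |Real.exp (|x| - |x + c|)| ≤ Real.exp 1 := fun x => by
    rw [abs_of_pos (Real.exp_pos _)]
    exact Real.exp_le_exp.2 (by have := abs_le.1 (hX x); linarith)
  have hint2 : Integrable (fun x : ℝ => Real.exp (|x| - |x + c|)) stdLaplace :=
    Integrable.of_bound (by fun_prop) _ (.of_forall hb)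
  have h1 : ∫ x, Real.exp (|x| - |x + c|) ∂stdLaplace = 1 := by
    have h := (Measure.isProbabilityMeasure_map (μ := stdLaplace)
      (f := fun x => x + -c) (by fun_prop)).measure_univ
    rw [stdLaplace_map_add, withDensity_apply _ .univ, Measure.restrict_univ] at h
    rw [integral_eq_lintegral_of_nonneg_ae (.of_forall fun x => (Real.exp_pos _).le)
      hint2.aestronglyMeasurable]
    simp only [sub_neg_eq_add] at h
    rw [h, ENNReal.toReal_one]
  -- `x ≤ 1 - exp (-x) + x ^ 2`, and `exp` of minus the loss has mean `1`
  have h2 : ∀ x : ℝ, |x + c| - |x| ≤ 1 - Real.exp (|x| - |x + c|) + a ^ 2 := fun x => by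
    have h3 := Real.abs_exp_sub_one_sub_id_le (x := |x| - |x + c|)
      (by rw [abs_sub_comm]; exact (hX x).trans ha)
    have h4 := (abs_le.1 h3).2
    have h5 : (|x| - |x + c|) ^ 2 ≤ a ^ 2 := by
      rw [← sq_abs (|x| - |x + c|), abs_sub_comm]
      exact pow_le_pow_left₀ (abs_nonneg _) (hX x) 2
    linarith
  have hint3 : Integrable (fun x : ℝ => 1 - Real.exp (|x| - |x + c|)) stdLaplace :=
    (integrable_const 1).sub hint2
  have hint4 : Integrable (fun x : ℝ => 1 - Real.exp (|x| - |x + c|) + a ^ 2) stdLaplace :=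
    hint3.add (integrable_const (a ^ 2))
  calc ∫ x, (|x + c| - |x|) ∂stdLaplace
      ≤ ∫ x, (1 - Real.exp (|x| - |x + c|) + a ^ 2) ∂stdLaplace := integral_mono hint hint4 h2
    _ = a ^ 2 := by
        rw [integral_add hint3 (integrable_const (a ^ 2)), integral_sub (integrable_const 1) hint2,
          h1, integral_const, integral_const, probReal_univ]
        simp

/-- Tail of the total privacy loss of shifts of at most `K` coordinates, by Hoeffding's inequality.
This is the source of the gain `√K`, instead of `K`, in advanced composition. -/
theorem laplaceTape_loss_tail {J : Finset ι} {c : ι → ℝ} {a K t : ℝ} (ha : 0 < a) (ha1 : a ≤ 1)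
    (hc : ∀ i, |c i| ≤ a) (hK : (J.card : ℝ) ≤ K) (ht : 0 ≤ t) :
    laplaceTape ι {ω | K * a ^ 2 + t < ∑ i ∈ J, (|ω i + c i| - |ω i|)} ≤
      ENNReal.ofReal (Real.exp (-t ^ 2 / (2 * (K * a ^ 2)))) := by
  rcases J.eq_empty_or_nonempty with rfl | hJ
  · have hK0 : 0 ≤ K := by simpa using hK
    have : {ω : ι → ℝ | K * a ^ 2 + t < ∑ i ∈ (∅ : Finset ι), (|ω i + c i| - |ω i|)} = ∅ := by
      ext ω
      simp only [Finset.sum_empty, Set.mem_ofPred_eq, Set.mem_empty_iff_false, iff_false, not_lt]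
      positivity
    rw [this]; simp
  have hcard : (0 : ℝ) < J.card := by exact_mod_cast hJ.card_pos
  set P := laplaceTape ι
  set m : ι → ℝ := fun i => ∫ x, (|x + c i| - |x|) ∂stdLaplace with hm
  have hind : iIndepFun (fun i (ω : ι → ℝ) => |ω i + c i| - |ω i| - m i) P :=
    laplaceTape_iIndepFun.comp (fun i x => |x + c i| - |x| - m i) fun i => by fun_prop
  have hsub : ∀ i ∈ J, HasSubgaussianMGF (fun ω : ι → ℝ => |ω i + c i| - |ω i| - m i)
      (Real.toNNReal (a ^ 2)) P := by
    intro i _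
    have h := hasSubgaussianMGF_of_mem_Icc (μ := P) (X := fun ω : ι → ℝ => |ω i + c i| - |ω i|)
      (a := -a) (b := a) (by fun_prop) (.of_forall fun ω => abs_le.1
        ((abs_abs_sub_abs_le_abs_sub _ _).trans (by rw [add_sub_cancel_left]; exact hc i)))
    have h2 : ∫ ω : ι → ℝ, (|ω i + c i| - |ω i|) ∂P = m i := by
      have hmap : P.map (fun ω => ω i) = stdLaplace := Measure.infinitePi_map_eval _ i
      have hf : Measurable fun x : ℝ => |x + c i| - |x| := by fun_prop
      simp only [hm]
      rw [← hmap, integral_map (measurable_pi_apply i).aemeasurable hf.aestronglyMeasurable]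
    have h3 : (‖a - -a‖₊ / 2) ^ 2 = Real.toNNReal (a ^ 2) := by
      ext
      rw [Real.coe_toNNReal _ (sq_nonneg a)]
      simp only [NNReal.coe_pow, NNReal.coe_div, coe_nnnorm, Real.norm_eq_abs, NNReal.coe_ofNat]
      rw [sub_neg_eq_add, abs_of_pos (by linarith)]
      ring
    rw [h2, h3] at h
    exact h
  have hH := HasSubgaussianMGF.measure_sum_ge_le_of_iIndepFun hind hsub ht
  have hsum : ∑ i ∈ J, m i ≤ K * a ^ 2 := by
    calc ∑ i ∈ J, m i ≤ ∑ i ∈ J, a ^ 2 :=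
          Finset.sum_le_sum fun i _ => integral_abs_add_sub_abs_le ha1 (hc i)
      _ = J.card * a ^ 2 := by simp
      _ ≤ K * a ^ 2 := by gcongr
  rw [← ofReal_measureReal (measure_ne_top _ _)]
  apply ENNReal.ofReal_le_ofReal
  refine (measureReal_mono ?_).trans (hH.trans ?_)
  · intro ω hω
    simp only [Set.mem_ofPred_eq] at hω ⊢
    rw [Finset.sum_sub_distrib]
    linarith
  · have hs : ((∑ _i ∈ J, Real.toNNReal (a ^ 2) : NNReal) : ℝ) = J.card * a ^ 2 := by
      rw [NNReal.coe_sum]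
      simp [Real.coe_toNNReal _ (sq_nonneg a)]
    apply Real.exp_le_exp.2
    simp only [NNReal.coe_sum] at hs
    simp only [NNReal.coe_sum, hs]
    rw [neg_div, neg_div, neg_le_neg_iff]
    gcongr

theorem comap_tape_le {κ : Type*} (e : κ → ι) :
    MeasurableSpace.comap (fun (ω : ι → ℝ) i => ω (e i)) inferInstance ≤
      ⨆ i ∈ Set.range e, MeasurableSpace.comap (fun ω : ι → ℝ => ω i) inferInstance := by
  rw [MeasurableSpace.pi, MeasurableSpace.comap_iSup]
  refine iSup_le fun i => ?_
  rw [MeasurableSpace.comap_comp]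
  exact le_iSup₂_of_le (e i) ⟨i, rfl⟩ le_rfl

/-- The parts of a tape that are read at disjoint sets of indices are independent tapes. -/
theorem laplaceTape_map_prod {κ₁ κ₂ : Type*} {e₁ : κ₁ → ι} {e₂ : κ₂ → ι}
    (h₁ : Function.Injective e₁) (h₂ : Function.Injective e₂)
    (hd : Disjoint (Set.range e₁) (Set.range e₂)) :
    (laplaceTape ι).map (fun ω => (fun i => ω (e₁ i), fun i => ω (e₂ i))) =
      (laplaceTape κ₁).prod (laplaceTape κ₂) := by
  have hind : IndepFun (fun (ω : ι → ℝ) i => ω (e₁ i)) (fun (ω : ι → ℝ) i => ω (e₂ i))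
      (laplaceTape ι) :=
    indep_of_indep_of_le_left (indep_of_indep_of_le_right
      (indep_iSup_of_disjoint (fun i => (measurable_pi_apply i).comap_le)
        laplaceTape_iIndepFun hd) (comap_tape_le e₂))
      (comap_tape_le e₁)
  rw [hind.map_prod_eq_prod_map_map
    (measurable_pi_lambda _ fun i => measurable_pi_apply _).aemeasurable
    (measurable_pi_lambda _ fun i => measurable_pi_apply _).aemeasurable,
    Measure.map_infinitePi_infinitePi_of_inj h₁, Measure.map_infinitePi_infinitePi_of_inj h₂]

end Tape

/-! ### Privacy of the stable histogram -/

section Histogram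

variable {X : Type*} {n : ℕ}

theorem ncard_mem_le_succ {D D' : Fin n → X} (h : {t | D t ≠ D' t}.Subsingleton) (B : Set X) :
    {t | D t ∈ B}.ncard ≤ {t | D' t ∈ B}.ncard + 1 := by
  have hsub : {t | D t ∈ B} ⊆ {t | D' t ∈ B} ∪ {t | D t ≠ D' t} := by
    intro t (ht : D t ∈ B)
    by_cases h' : D t = D' t
    · exact Or.inl (show D' t ∈ B from h' ▸ ht)
    · exact Or.inr h'
  refine (Set.ncard_le_ncard hsub (Set.toFinite _)).trans ((Set.ncard_union_le _ _).trans ?_)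
  gcongr
  exact (Set.ncard_le_one (Set.toFinite _)).2 fun a ha b hb => h ha hb

/-- Changing one data point changes the counts of at most two bins. -/
theorem exists_finset_ncard_mem_eq {D D' : Fin n → X} (h : {t | D t ≠ D' t}.Subsingleton)
    {B : ℤ → Set X} (hB : Pairwise (Function.onFun Disjoint B)) :
    ∃ J : Finset ℤ, J.card ≤ 2 ∧
      ∀ i ∉ J, {t | D t ∈ B i}.ncard = {t | D' t ∈ B i}.ncard := by
  classical
  have hsub : ∀ x : X, {i | x ∈ B i}.Subsingleton := fun x i hi j hj => by
    by_contra hij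
    exact Set.disjoint_left.1 (hB hij) hi hj
  by_cases hD : ∃ t, D t ≠ D' t
  · obtain ⟨t₀, ht₀⟩ := hD
    refine ⟨(hsub (D t₀)).finite.toFinset ∪ (hsub (D' t₀)).finite.toFinset, ?_, fun i hi => ?_⟩
    · refine (Finset.card_union_le _ _).trans ?_
      have h1 : ∀ x, (hsub x).finite.toFinset.card ≤ 1 := fun x =>
        Finset.card_le_one.2 fun a ha b hb => hsub x (by simpa using ha) (by simpa using hb)
      have := h1 (D t₀)
      have := h1 (D' t₀)
      omega
    · simp only [Finset.mem_union, Set.Finite.mem_toFinset, Set.mem_ofPred_eq, not_or] at hi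
      congr 1
      ext t
      by_cases ht : D t = D' t
      · simp [ht]
      · rw [h ht ht₀]
        simp [hi.1, hi.2]
  · push Not at hD
    exact ⟨∅, by simp, fun i _ => by simp [hD]⟩

/-- Changing one data point of the stable histogram amounts to a shift of at most two noise
variables by at most `ε / 2`, unless one of them is so large that a bin with a single point
passes the threshold. -/
theorem exists_shift_stableHistogram {ε δ : ℝ} (hε : 0 < ε) {D D' : Fin n → X}
    (h : {t | D t ≠ D' t}.Subsingleton) {B : ℤ → Set X}
    (hB : Pairwise (Function.onFun Disjoint B)) :
    ∃ J : Finset ℤ, J.card ≤ 2 ∧ ∃ c : ℤ → ℝ, (∀ i ∉ J, c i = 0) ∧ (∀ i, |c i| ≤ ε / 2) ∧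
      ∀ ξ : ℤ → ℝ, (∀ i ∈ J, ξ i < Real.log (2 / δ)) →
        stableHistogram ε δ D B ξ = stableHistogram ε δ D' B (ξ + c) := by
  obtain ⟨J, hJ, hJ'⟩ := exists_finset_ncard_mem_eq h hB
  have h' : {t | D' t ≠ D t}.Subsingleton := by simpa only [ne_comm] using h
  set N : ℤ → ℕ := fun i => {t | D t ∈ B i}.ncard with hN
  set N' : ℤ → ℕ := fun i => {t | D' t ∈ B i}.ncard with hN'
  have hle : ∀ i, N i ≤ N' i + 1 := fun i => ncard_mem_le_succ h _
  have hle' : ∀ i, N' i ≤ N i + 1 := fun i => ncard_mem_le_succ h' _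
  have hp : ∀ i, binFreq D (B i) = (N i : ℝ) / n := fun i => rfl
  have hp' : ∀ i, binFreq D' (B i) = (N' i : ℝ) / n := fun i => rfl
  refine ⟨J, hJ, fun i => if N i = 0 ∨ N' i = 0 then 0 else ((N i : ℝ) - N' i) * (ε / 2),
    fun i hi => ?_, fun i => ?_, fun ξ hξ => funext fun i => ?_⟩
  · have : N i = N' i := hJ' i hi
    simp [this]
  · simp only
    split_ifs
    · rw [abs_zero]; positivity
    · rw [abs_mul, abs_of_pos (half_pos hε)]
      have h1 : (N i : ℝ) ≤ N' i + 1 := by exact_mod_cast hle i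
      have h2 : (N' i : ℝ) ≤ N i + 1 := by exact_mod_cast hle' i
      have : |(N i : ℝ) - N' i| ≤ 1 := abs_le.2 ⟨by linarith, by linarith⟩
      nlinarith
  rcases Nat.eq_zero_or_pos n with rfl | hn
  · simp [stableHistogram, hp, hp']
  have hn0 : (0 : ℝ) < n := by exact_mod_cast hn
  have hlow : i ∈ J → ∀ M : ℝ, M = 1 →
      M / n + 2 / (ε * n) * ξ i < 2 * Real.log (2 / δ) / (ε * n) + 1 / n := by
    rintro hi M rfl
    have := hξ i hi
    have : 2 / (ε * n) * ξ i < 2 / (ε * n) * Real.log (2 / δ) := by gcongr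
    rw [mul_div_right_comm 2 (Real.log _)]
    linarith
  unfold stableHistogram
  simp only [hp, hp', Pi.add_apply]
  by_cases h0 : N i = N' i
  · simp [h0]
  have hiJ : i ∈ J := by
    by_contra hi
    exact h0 (hJ' i hi)
  have hle_i := hle i
  have hle_i' := hle' i
  by_cases hz : N i = 0
  · have h1 : N' i = 1 := by omega
    have := hlow hiJ (1 : ℝ) rfl
    simp only [hz, h1, true_or, if_true, add_zero, Nat.cast_zero, zero_div, Nat.cast_one,
      if_pos this, ite_self]
  by_cases hz' : N' i = 0
  · have h1 : N i = 1 := by omega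
    have := hlow hiJ (1 : ℝ) rfl
    simp only [hz', h1, or_true, if_true, add_zero, Nat.cast_zero, zero_div, Nat.cast_one,
      if_pos this, ite_self]
  have hne : (N i : ℝ) / n ≠ 0 := by positivity
  have hne' : (N' i : ℝ) / n ≠ 0 := by positivity
  have heq : (N i : ℝ) / n + 2 / (ε * n) * ξ i
      = N' i / n + 2 / (ε * n) * (ξ i + ((N i : ℝ) - N' i) * (ε / 2)) := by
    field_simp
    ring
  simp only [hne, hne', hz, hz', or_self, if_false, heq]

end Histogram

/-! ### The lists found by the decoders -/

section HeavyBins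

theorem heavyBins_finite (τ T : ℝ) (p : ℤ → ℝ) : (heavyBins τ T p).Finite := by
  unfold heavyBins
  split_ifs with h
  · exact Set.finite_of_encard_le_coe h
  · exact Set.finite_empty

theorem heavyBins_ncard_le {τ T : ℝ} (hT : 0 ≤ T) (p : ℤ → ℝ) :
    ((heavyBins τ T p).ncard : ℝ) ≤ T := by
  refine le_trans ?_ (Nat.floor_le hT)
  rw [Nat.cast_le]
  unfold heavyBins
  split_ifs with h
  · have hf := Set.finite_of_encard_le_coe h
    rwa [← hf.cast_ncard_eq, Nat.cast_le] at h
  · simp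

theorem measurableSet_mem_heavyBins {Ω : Type*} [MeasurableSpace Ω] {p : Ω → ℤ → ℝ}
    (hp : ∀ i, Measurable fun ω => p ω i) (τ T : ℝ) (i : ℤ) :
    MeasurableSet {ω | i ∈ heavyBins τ T (p ω)} := by
  have hcard : ∀ ω, {i | τ ≤ p ω i}.encard ≤ (⌊T⌋₊ : ℕ∞) ↔
      ∃ G : Finset ℤ, G.card ≤ ⌊T⌋₊ ∧ ∀ j ∉ G, p ω j < τ := by
    intro ω
    constructor
    · intro h
      have hf := Set.finite_of_encard_le_coe h
      refine ⟨hf.toFinset, ?_, fun j hj => by simpa using hj⟩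
      rw [hf.encard_eq_coe_toFinset_card] at h
      exact_mod_cast h
    · rintro ⟨G, hG, hG'⟩
      have hs : {i | τ ≤ p ω i} ⊆ (G : Set ℤ) := fun j (hj : τ ≤ p ω j) => by
        by_contra h
        exact absurd (hG' j h) (not_lt.2 hj)
      refine (Set.encard_le_encard hs).trans ?_
      rw [Set.encard_coe_eq_coe_finsetCard]
      exact_mod_cast hG
  have : {ω | i ∈ heavyBins τ T (p ω)} = {ω | τ ≤ p ω i} ∩
      ⋃ G : Finset ℤ, ⋃ _ : G.card ≤ ⌊T⌋₊, ⋂ j : ℤ, ⋂ _ : j ∉ G, {ω | p ω j < τ} := by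
    ext ω
    have h := hcard ω
    simp only [Set.mem_inter_iff, Set.mem_iUnion, Set.mem_iInter, Set.mem_ofPred_eq, exists_prop]
    rw [← h]
    unfold heavyBins
    split_ifs with h1 <;> simp [h1]
  rw [this]
  refine (measurableSet_le measurable_const (hp i)).inter ?_
  refine .iUnion fun G => .iUnion fun _ => .iInter fun j => .iInter fun _ => ?_
  exact measurableSet_lt (hp j) measurable_const

theorem measurable_stableHistogram {X : Type*} {n : ℕ} (ε δ : ℝ) (D : Fin n → X) (B : ℤ → Set X)
    (i : ℤ) : Measurable fun ξ => stableHistogram ε δ D B ξ i := by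
  unfold stableHistogram
  have hm : Measurable fun ξ : ℤ → ℝ => binFreq D (B i) + 2 / (ε * n) * ξ i := by fun_prop
  split_ifs
  · exact measurable_const
  · exact Measurable.ite (measurableSet_lt hm measurable_const) measurable_const hm

end HeavyBins

/-! ### Privacy of the decoders -/

/-- A union bound for the event that one of at most `K` noise variables is large. -/
theorem laplaceTape_exists_ge_le {ι : Type*} {J : Finset ι} {K r : ℝ} (hK : (J.card : ℝ) ≤ K)
    (hr : 0 ≤ r) :
    laplaceTape ι {ω | ∃ i ∈ J, r ≤ ω i} ≤ ENNReal.ofReal (K * (Real.exp (-r) / 2)) := by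
  have h : {ω : ι → ℝ | ∃ i ∈ J, r ≤ ω i} = ⋃ i ∈ J, {ω | ω i ∈ Set.Ici r} := by
    ext ω; simp
  rw [h]
  refine (measure_biUnion_finset_le _ _).trans ?_
  simp_rw [laplaceTape_eval _ measurableSet_Ici, stdLaplace_Ici hr]
  rw [Finset.sum_const, nsmul_eq_mul, ← ENNReal.ofReal_natCast,
    ← ENNReal.ofReal_mul (by positivity)]
  gcongr

theorem pairwise_disjoint_dyadic :
    Pairwise (Function.onFun Disjoint fun k : ℤ => Set.Ioc ((2 : ℝ) ^ k) ((2 : ℝ) ^ (k + 1))) :=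
  Monotone.pairwise_disjoint_on_Ioc_succ (f := fun k : ℤ => (2 : ℝ) ^ k) fun _ _ h =>
    zpow_le_zpow_right₀ one_le_two h

theorem pairwise_disjoint_centred {s : ℝ} (hs : 0 ≤ s) :
    Pairwise (Function.onFun Disjoint fun i : ℤ =>
      Set.Ioc (((i : ℝ) - 1 / 2) * s) (((i : ℝ) + 1 / 2) * s)) := by
  have h := Monotone.pairwise_disjoint_on_Ioc_succ (f := fun i : ℤ => ((i : ℝ) - 1 / 2) * s)
    fun i j h => by
      have : (i : ℝ) ≤ j := by exact_mod_cast h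
      simp only
      gcongr
  convert h using 4 with i
  rw [Order.succ_eq_add_one]
  push_cast
  ring

section Codes

variable {n : ℕ}

/-- The output of the variance decoder as a finite set, so that it lives in a countable space. -/
noncomputable def varianceCode (γ ε δ : ℝ) (x : Fin n → ℝ) (ξ : ℤ → ℝ) : Finset ℤ :=
  (heavyBins_finite _ _ _ : (varianceDecoder γ ε δ x ξ).Finite).toFinset

/-- The bins of the histogram for the mean that is run with the candidate `2^(k+1)`. -/
def centredBins (k i : ℤ) : Set ℝ :=
  Set.Ioc (((i : ℝ) - 1 / 2) * (2 : ℝ) ^ (k + 1)) (((i : ℝ) + 1 / 2) * (2 : ℝ) ^ (k + 1))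

/-- The heavy bins of the histogram for the mean that is run with the candidate `2^(k+1)`. -/
noncomputable def meanBins (γ ε δ : ℝ) (x : Fin n → ℝ) (k : ℤ) (ξ : ℤ → ℝ) : Set ℤ :=
  heavyBins ((1 - γ) / 8) (12 / (1 - γ)) (stableHistogram ε δ x (centredBins k) ξ)

/-- The outputs of the mean decoders that are run with the candidates in `V`, as a finite set of
pairs of a candidate and a heavy bin. The tape `η (k, i)` is the noise of bin `i` in run `k`. -/
noncomputable def meanCode (γ ε δ : ℝ) (x : Fin n → ℝ) (V : Finset ℤ) (η : ℤ × ℤ → ℝ) :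
    Finset ((_ : ℤ) × ℤ) :=
  V.sigma fun k => (heavyBins_finite _ _ _ : (meanBins γ ε δ x k fun i => η (k, i)).Finite).toFinset

theorem mem_varianceCode {γ ε δ : ℝ} {x : Fin n → ℝ} {ξ : ℤ → ℝ} {k : ℤ} :
    k ∈ varianceCode γ ε δ x ξ ↔ k ∈ varianceDecoder γ ε δ x ξ := by
  rw [varianceCode, Set.Finite.mem_toFinset]
  rfl

theorem mem_meanCode {γ ε δ : ℝ} {x : Fin n → ℝ} {V : Finset ℤ} {η : ℤ × ℤ → ℝ}
    {p : (_ : ℤ) × ℤ} :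
    p ∈ meanCode γ ε δ x V η ↔ p.1 ∈ V ∧ p.2 ∈ meanBins γ ε δ x p.1 fun i => η (p.1, i) := by
  rw [meanCode, Finset.mem_sigma, Set.Finite.mem_toFinset]
  rfl

theorem measurable_varianceCode (γ ε δ : ℝ) (x : Fin n → ℝ) :
    Measurable (varianceCode γ ε δ x) := by
  refine measurable_finset_iff.2 fun k => measurableSet_setOfPred.1 ?_
  simp only [mem_varianceCode]
  exact measurableSet_mem_heavyBins (measurable_stableHistogram _ _ _ _) _ _ _

theorem measurable_meanCode (γ ε δ : ℝ) (x : Fin n → ℝ) (V : Finset ℤ) :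
    Measurable (meanCode γ ε δ x V) := by
  refine measurable_finset_iff.2 fun p => measurableSet_setOfPred.1 ?_
  have h1 : Measurable fun (η : ℤ × ℤ → ℝ) i => η (p.1, i) :=
    measurable_pi_lambda _ fun i => measurable_pi_apply _
  have h2 : MeasurableSet {η : ℤ × ℤ → ℝ | p.2 ∈ meanBins γ ε δ x p.1 fun i => η (p.1, i)} :=
    measurableSet_mem_heavyBins
      (p := fun (η : ℤ × ℤ → ℝ) => stableHistogram ε δ x (centredBins p.1) fun i => η (p.1, i))
      (fun i => (measurable_stableHistogram ε δ x (centredBins p.1) i).comp h1) _ _ _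
  by_cases hp : p.1 ∈ V
  · simpa only [mem_meanCode, hp, true_and] using h2
  · simp only [mem_meanCode, hp, false_and, MeasurableSet.const]

theorem measurable_uncurry_meanCode (γ ε δ : ℝ) (x : Fin n → ℝ) :
    Measurable fun p : Finset ℤ × (ℤ × ℤ → ℝ) => meanCode γ ε δ x p.1 p.2 :=
  measurable_from_prod_countable_right fun V => measurable_meanCode γ ε δ x V

theorem card_varianceCode_le {γ ε δ : ℝ} (x : Fin n → ℝ) (ξ : ℤ → ℝ) :
    ((varianceCode γ ε δ x ξ).card : ℝ) ≤ 12 / (1 - γ) ^ 2 := by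
  rw [varianceCode, ← Set.ncard_eq_toFinset_card _ (heavyBins_finite _ _ _)]
  exact heavyBins_ncard_le (by positivity) _

theorem subsingleton_pairDiff_ne {x x' : Fin n → ℝ} (h : {t | x t ≠ x' t}.Subsingleton) :
    {t | pairDiff x t ≠ pairDiff x' t}.Subsingleton := by
  have key : ∀ t, pairDiff x t ≠ pairDiff x' t →
      ∃ s : Fin n, x s ≠ x' s ∧ (s : ℕ) / 2 = t := by
    intro t ht
    by_contra! hne
    refine ht ?_
    have h1 : x ⟨2 * t.1, by omega⟩ = x' ⟨2 * t.1, by omega⟩ := by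
      by_contra h1
      exact hne _ h1 (by simp)
    have h2 : x ⟨2 * t.1 + 1, by omega⟩ = x' ⟨2 * t.1 + 1, by omega⟩ := by
      by_contra h2
      exact hne _ h2 (by simp only; omega)
    rw [pairDiff, pairDiff, h1, h2]
  intro a ha b hb
  obtain ⟨s, hs, hsa⟩ := key a ha
  obtain ⟨s', hs', hsb⟩ := key b hb
  have := h hs hs'
  subst this
  exact Fin.ext (hsa.symm.trans hsb)

/-- The loss of a shift of two variables by `ε / 2` never exceeds `ε`, so only the threshold costs
`δ`. -/
theorem indist_varianceCode {γ ε δ : ℝ} (hε : 0 < ε) (hδ : δ ∈ Set.Ioo (0 : ℝ) 1)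
    {x x' : Fin n → ℝ} (h : {t | x t ≠ x' t}.Subsingleton) :
    Indist ε δ ((laplaceTape ℤ).map (varianceCode γ ε δ x))
      ((laplaceTape ℤ).map (varianceCode γ ε δ x')) := by
  obtain ⟨J, hJ, c, hc0, hc, hs⟩ := exists_shift_stableHistogram (δ := δ) hε
    (subsingleton_pairDiff_ne h) pairwise_disjoint_dyadic
  have hJ' : (J.card : ℝ) ≤ 2 := by exact_mod_cast hJ
  have hlog : 0 ≤ Real.log (2 / δ) :=
    Real.log_nonneg (by rw [le_div_iff₀ hδ.1]; linarith [hδ.2])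
  have hδ0 := hδ.1
  have hmain := Indist.of_shift (ε := ε) (δ₁ := 2 * (Real.exp (-Real.log (2 / δ)) / 2)) (δ₂ := 0)
    (measurable_varianceCode γ ε δ x) (measurable_varianceCode γ ε δ x') hc0
    (bad := {ξ | ∃ i ∈ J, Real.log (2 / δ) ≤ ξ i}) ?_ (by positivity) le_rfl
    (laplaceTape_exists_ge_le hJ' hlog) ?_
  · refine hmain.mono le_rfl ?_
    rw [Real.exp_neg, Real.exp_log (by positivity)]
    have : 2 * ((2 / δ)⁻¹ / 2) + 0 = δ / 2 := by field_simp; ring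
    linarith
  · intro ξ hξ
    simp only [Set.mem_ofPred_eq, not_exists, not_and, not_le] at hξ
    ext k
    rw [mem_varianceCode, mem_varianceCode, varianceDecoder, varianceDecoder, hs ξ hξ]
  · have : {ω : ℤ → ℝ | ε < ∑ i ∈ J, (|ω i + c i| - |ω i|)} = ∅ := by
      refine Set.eq_empty_of_forall_notMem fun ω hω => not_le.2 (show ε < _ from hω) ?_
      calc ∑ i ∈ J, (|ω i + c i| - |ω i|) ≤ ∑ i ∈ J, ε / 2 := by
            refine Finset.sum_le_sum fun i _ => ?_
            have := abs_add_le (ω i) (c i)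
            linarith [hc i]
        _ = J.card * (ε / 2) := by simp
        _ ≤ 2 * (ε / 2) := by gcongr
        _ = ε := by ring
    rw [this]; simp

/-- Advanced composition of at most `T` mean decoders: the number of runs only enters the privacy
loss through `T ε ^ 2` and the deviation `t`, instead of `T ε`. -/
theorem indist_meanCode {γ ε δ T t : ℝ} (hε : ε ∈ Set.Ioc (0 : ℝ) 1) (hδ : δ ∈ Set.Ioo (0 : ℝ) 1)
    (ht : 0 ≤ t) {x x' : Fin n → ℝ} (h : {t | x t ≠ x' t}.Subsingleton) {V : Finset ℤ}
    (hV : (V.card : ℝ) ≤ T) :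
    Indist (T * ε ^ 2 / 2 + t) (T * δ / 2 + Real.exp (-t ^ 2 / (T * ε ^ 2)))
      ((laplaceTape (ℤ × ℤ)).map (meanCode γ ε δ x V))
      ((laplaceTape (ℤ × ℤ)).map (meanCode γ ε δ x' V)) := by
  classical
  have hex := fun k : ℤ => exists_shift_stableHistogram (δ := δ) hε.1 h (B := centredBins k)
    (pairwise_disjoint_centred (s := (2 : ℝ) ^ (k + 1)) (by positivity))
  choose J hJ c hc0 hc hs using hex
  set J' : Finset (ℤ × ℤ) := (V.sigma J).map (Equiv.sigmaEquivProd ℤ ℤ).toEmbedding with hJ'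
  set c' : ℤ × ℤ → ℝ := fun p => if p.1 ∈ V then c p.1 p.2 else 0 with hc'
  have hmem : ∀ p : ℤ × ℤ, p ∈ J' ↔ p.1 ∈ V ∧ p.2 ∈ J p.1 := by
    rintro ⟨k, i⟩
    simp [hJ', Finset.mem_map_equiv]
  have hcard : (J'.card : ℝ) ≤ 2 * T := by
    have : J'.card ≤ V.card * 2 := by
      rw [hJ', Finset.card_map, Finset.card_sigma]
      exact (Finset.sum_le_card_nsmul _ _ 2 fun k _ => hJ k).trans (by simp)
    have h2 : (J'.card : ℝ) ≤ V.card * 2 := by exact_mod_cast this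
    linarith
  have hT : 0 ≤ T := (Nat.cast_nonneg _).trans hV
  have hlog : 0 ≤ Real.log (2 / δ) :=
    Real.log_nonneg (by rw [le_div_iff₀ hδ.1]; linarith [hδ.2])
  have hδ0 := hδ.1
  have hc'0 : ∀ p ∉ J', c' p = 0 := by
    intro p hp
    rw [hmem, not_and] at hp
    simp only [hc']
    split_ifs with hpV
    · exact hc0 _ _ (hp hpV)
    · rfl
  have hc'le : ∀ p, |c' p| ≤ ε / 2 := by
    intro p
    simp only [hc']
    split_ifs
    · exact hc _ _
    · rw [abs_zero]; linarith [hε.1]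
  have hshift : ∀ η ∉ {η : ℤ × ℤ → ℝ | ∃ p ∈ J', Real.log (2 / δ) ≤ η p},
      meanCode γ ε δ x V η = meanCode γ ε δ x' V (η + c') := by
    intro η hη
    simp only [Set.mem_ofPred_eq, not_exists, not_and, not_le] at hη
    ext ⟨k, i⟩
    rw [mem_meanCode, mem_meanCode]
    refine and_congr_right fun hk => ?_
    simp only at hk ⊢
    have h1 := hs k (fun i => η (k, i)) fun i hi => hη _ ((hmem _).2 ⟨hk, hi⟩)
    have h2 : (fun i => (η + c') (k, i)) = (fun i => η (k, i)) + c k := by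
      ext i; simp [hc', hk]
    rw [meanBins, meanBins, h1, h2]
  have hbad := laplaceTape_exists_ge_le hcard hlog
  have hloss := laplaceTape_loss_tail (a := ε / 2) (by linarith [hε.1]) (by linarith [hε.2]) hc'le
    hcard ht
  have hmain := Indist.of_shift (measurable_meanCode γ ε δ x V) (measurable_meanCode γ ε δ x' V)
    hc'0 hshift (by positivity) (by positivity) hbad hloss
  refine hmain.mono (le_of_eq (by ring)) (le_of_eq ?_)
  rw [Real.exp_neg, Real.exp_log (by positivity)]
  congr 1
  · field_simp
  · congr 2; ring

/-- The part of the tape that the variance decoder reads, and the part that the mean decoders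
read. -/
def splitTape (ω : UniIndex → ℝ) : (ℤ → ℝ) × (ℤ × ℤ → ℝ) :=
  (fun k => ω (none, k), fun p => ω (some p.1, p.2))

theorem measurable_splitTape : Measurable splitTape :=
  (measurable_pi_lambda _ fun _ => measurable_pi_apply _).prodMk
    (measurable_pi_lambda _ fun _ => measurable_pi_apply _)

theorem laplaceTape_map_splitTape :
    (laplaceTape UniIndex).map splitTape = (laplaceTape ℤ).prod (laplaceTape (ℤ × ℤ)) := by
  refine laplaceTape_map_prod (ι := UniIndex) (e₁ := fun k : ℤ => (none, k))
    (e₂ := fun p : ℤ × ℤ => (some p.1, p.2)) ?_ ?_ ?_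
  · exact fun a b hab => by simpa using hab
  · rintro ⟨a, b⟩ ⟨a', b'⟩ hab
    simpa using hab
  · rw [Set.disjoint_left]
    rintro _ ⟨k, rfl⟩ ⟨p, hp⟩
    simp at hp

theorem measurable_adaptive {Ω₁ Ω₂ Y Z : Type*} [MeasurableSpace Ω₁] [MeasurableSpace Ω₂]
    [MeasurableSpace Y] [MeasurableSpace Z] {V : Ω₁ → Y} (hV : Measurable V) {F : Y → Ω₂ → Z}
    (hF : Measurable fun p : Y × Ω₂ => F p.1 p.2) :
    Measurable fun ω : Ω₁ × Ω₂ => (V ω.1, F (V ω.1) ω.2) := by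
  have h1 : Measurable fun ω : Ω₁ × Ω₂ => V ω.1 := hV.comp measurable_fst
  have h2 : Measurable fun ω : Ω₁ × Ω₂ => (V ω.1, ω.2) := h1.prodMk measurable_snd
  exact h1.prodMk (hF.comp h2)

/-- The outputs of the variance decoder with privacy parameters `ε₁, δ₁`, and of the mean decoders
with privacy parameters `ε₂, δ₂`, when they read the tapes `ω.1` and `ω.2`. -/
noncomputable def pairCode (γ ε₁ δ₁ ε₂ δ₂ : ℝ) (x : Fin n → ℝ) (ω : (ℤ → ℝ) × (ℤ × ℤ → ℝ)) :
    Finset ℤ × Finset ((_ : ℤ) × ℤ) :=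
  (varianceCode γ ε₁ δ₁ x ω.1, meanCode γ ε₂ δ₂ x (varianceCode γ ε₁ δ₁ x ω.1) ω.2)

theorem measurable_pairCode (γ ε₁ δ₁ ε₂ δ₂ : ℝ) (x : Fin n → ℝ) :
    Measurable (pairCode γ ε₁ δ₁ ε₂ δ₂ x) :=
  measurable_adaptive (measurable_varianceCode γ ε₁ δ₁ x) (measurable_uncurry_meanCode γ ε₂ δ₂ x)

/-- The output of the univariate decoder is determined by this element of a countable space. -/
noncomputable def univariateCode (γ ε δ : ℝ) (x : Fin n → ℝ) (ω : UniIndex → ℝ) :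
    Finset ℤ × Finset ((_ : ℤ) × ℤ) :=
  pairCode γ (ε / 2) (δ / 2) ((ε / 2) / Real.sqrt (6 * (12 / (1 - γ) ^ 2) * Real.log (4 / δ)))
    (δ / (4 * (12 / (1 - γ) ^ 2))) x (splitTape ω)

theorem measurable_univariateCode (γ ε δ : ℝ) (x : Fin n → ℝ) :
    Measurable (univariateCode γ ε δ x) :=
  (measurable_pairCode _ _ _ _ _ x).comp measurable_splitTape

/-- The variance decoder and the mean decoders get half of the privacy budget each. The `ε` of the
mean decoders is chosen such that the mean of the total privacy loss is at most `ε / 24`, and the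
loss exceeds its mean by `ε / 4` with probability at most `δ / 4`. -/
theorem indist_univariateCode {γ ε δ : ℝ} (hγ : γ ∈ Set.Ioo (0 : ℝ) 1)
    (hε : ε ∈ Set.Ioc (0 : ℝ) 1) (hδ : δ ∈ Set.Ioo (0 : ℝ) 1)
    {x x' : Fin n → ℝ} (h : {t | x t ≠ x' t}.Subsingleton) :
    Indist ε δ ((laplaceTape UniIndex).map (univariateCode γ ε δ x))
      ((laplaceTape UniIndex).map (univariateCode γ ε δ x')) := by
  obtain ⟨hε0, hε1⟩ := hε
  obtain ⟨hδ0, hδ1⟩ := hδ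
  set T : ℝ := 12 / (1 - γ) ^ 2 with hT
  set ℓ : ℝ := Real.log (4 / δ) with hℓ
  have hγ1 : 0 < 1 - γ := by linarith [hγ.2]
  have hT12 : 12 ≤ T := by
    rw [hT, le_div_iff₀ (by positivity)]
    nlinarith [hγ.1]
  have hℓ1 : 1 ≤ ℓ := by
    rw [hℓ, Real.le_log_iff_exp_le (by positivity)]
    have h4 : (4 : ℝ) ≤ 4 / δ := by rw [le_div_iff₀ hδ0]; linarith
    linarith [Real.exp_one_lt_d9]
  set S : ℝ := Real.sqrt (6 * T * ℓ) with hS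
  have hS2 : S ^ 2 = 6 * T * ℓ := Real.sq_sqrt (by positivity)
  have hS0 : 0 < S := Real.sqrt_pos.2 (by positivity)
  have hS1 : 1 ≤ S := by
    rw [hS, Real.one_le_sqrt]
    nlinarith
  have hTε : T * (ε / 2 / S) ^ 2 = ε ^ 2 / (24 * ℓ) := by
    rw [div_pow, hS2]
    field_simp
    ring
  have h1 : Indist (ε / 2) (δ / 2) ((laplaceTape ℤ).map (varianceCode γ (ε / 2) (δ / 2) x))
      ((laplaceTape ℤ).map (varianceCode γ (ε / 2) (δ / 2) x')) :=
    indist_varianceCode (by linarith) ⟨by linarith, by linarith⟩ h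
  have h2 : ∀ V : Finset ℤ, (V.card : ℝ) ≤ T → Indist (ε / 2) (δ / 2)
      ((laplaceTape (ℤ × ℤ)).map (meanCode γ (ε / 2 / S) (δ / (4 * T)) x V))
      ((laplaceTape (ℤ × ℤ)).map (meanCode γ (ε / 2 / S) (δ / (4 * T)) x' V)) := by
    intro V hV
    refine (indist_meanCode (t := ε / 4) ⟨by positivity, ?_⟩ ⟨by positivity, ?_⟩ (by positivity)
      h hV).mono ?_ ?_
    · rw [div_le_one hS0]; linarith
    · rw [div_lt_one (by positivity)]; linarith
    · rw [hTε]
      have : ε ^ 2 / (24 * ℓ) ≤ ε / 24 := by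
        rw [div_le_div_iff₀ (by positivity) (by positivity)]
        nlinarith [mul_pos hε0 (by linarith : 0 < ℓ)]
      linarith
    · rw [hTε]
      have h3 : -(ε / 4) ^ 2 / (ε ^ 2 / (24 * ℓ)) = -(3 / 2 * ℓ) := by
        field_simp
        ring
      have h4 : Real.exp (-(3 / 2 * ℓ)) ≤ δ / 4 := by
        calc Real.exp (-(3 / 2 * ℓ)) ≤ Real.exp (-ℓ) := Real.exp_le_exp.2 (by linarith)
          _ = δ / 4 := by rw [Real.exp_neg, hℓ, Real.exp_log (by positivity), inv_div]
      have h5 : T * (δ / (4 * T)) / 2 = δ / 8 := by field_simp; ring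
      rw [h3, h5]
      linarith
  have hcomp := Indist.adaptive (by linarith) (by linarith) (measurable_varianceCode _ _ _ x)
    (measurable_varianceCode _ _ _ x') h1 (p := fun V : Finset ℤ => (V.card : ℝ) ≤ T)
    (fun ξ => card_varianceCode_le x ξ) (measurable_uncurry_meanCode γ (ε / 2 / S) (δ / (4 * T)) x)
    (measurable_uncurry_meanCode γ (ε / 2 / S) (δ / (4 * T)) x') h2
  rw [add_halves, add_halves] at hcomp
  have hlaw : ∀ x : Fin n → ℝ, (laplaceTape UniIndex).map (univariateCode γ ε δ x) =
      ((laplaceTape ℤ).prod (laplaceTape (ℤ × ℤ))).map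
        (pairCode γ (ε / 2) (δ / 2) (ε / 2 / S) (δ / (4 * T)) x) := fun x => by
    rw [← laplaceTape_map_splitTape, Measure.map_map (measurable_pairCode _ _ _ _ _ x)
      measurable_splitTape]
    rfl
  rw [hlaw x, hlaw x']
  exact hcomp

/-- The lists returned by the univariate decoder, as a function of the code of its output. -/
def outputOfCode (α : ℝ) (c : Finset ℤ × Finset ((_ : ℤ) × ℤ)) : Set ℝ × Set ℝ :=
  ({u | ∃ k ∈ c.1, ∃ v, (∃ i : ℤ, ⟨k, i⟩ ∈ c.2 ∧ (i : ℝ) * (2 : ℝ) ^ (k + 1) = v) ∧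
      ∃ j : ℤ, |j| ≤ ⌈1 / α⌉ ∧ u = v + j * α * (2 : ℝ) ^ (k + 1)},
   {s | ∃ k ∈ c.1, ∃ j : ℕ, j < ⌈Real.logb (1 + α) 2⌉₊ ∧ s = (2 : ℝ) ^ (k + 1) / (1 + α) ^ j})

theorem univariateDecoder_eq (α β γ ε δ : ℝ) (x : Fin n → ℝ) (ω : UniIndex → ℝ) :
    univariateDecoder α β γ ε δ x ω = outputOfCode α (univariateCode γ ε δ x ω) := by
  unfold univariateDecoder outputOfCode univariateCode pairCode splitTape
  refine Prod.ext (Set.ext fun u => ?_) (Set.ext fun u => ?_)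
  · simp only [Set.mem_ofPred_eq, mem_varianceCode, mem_meanCode]
    refine exists_congr fun k => and_congr_right fun hk => exists_congr fun v =>
      and_congr_left fun _ => ?_
    exact exists_congr fun i => and_congr_left fun _ => ⟨fun h => ⟨hk, h⟩, fun h => h.2⟩
  · simp only [Set.mem_ofPred_eq, mem_varianceCode]
    rfl

/-- The codes of the outputs of the `d` univariate decoders. -/
noncomputable def multivariateCode (d : ℕ) (ε δ γ : ℝ) (D : Fin n → EuclideanSpace ℝ (Fin d))
    (ω : Fin d × UniIndex → ℝ) (i : Fin d) : Finset ℤ × Finset ((_ : ℤ) × ℤ) :=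
  univariateCode γ (ε / d) (δ / d) (fun t => D t i) fun a => ω (i, a)

theorem noiseLaw_map_curry (d : ℕ) :
    (noiseLaw d).map (fun ω i a => ω (i, a)) =
      Measure.pi fun _ : Fin d => laplaceTape UniIndex := by
  rw [← Measure.infinitePi_eq_pi]
  exact Measure.infinitePi_map_curry (fun (_ : Fin d) (_ : UniIndex) => stdLaplace)

theorem noiseLaw_map_multivariateCode (d : ℕ) (ε δ γ : ℝ) (D : Fin n → EuclideanSpace ℝ (Fin d)) :
    (noiseLaw d).map (multivariateCode d ε δ γ D) = Measure.pi fun i : Fin d =>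
      (laplaceTape UniIndex).map (univariateCode γ (ε / d) (δ / d) fun t => D t i) := by
  have hm := fun i : Fin d => measurable_univariateCode γ (ε / d) (δ / d) fun t => D t i
  have hpr : ∀ i : Fin d, IsProbabilityMeasure ((laplaceTape UniIndex).map
      (univariateCode γ (ε / d) (δ / d) fun t => D t i)) := fun i =>
    Measure.isProbabilityMeasure_map (hm i).aemeasurable
  rw [← Measure.pi_map_pi fun i => (hm i).aemeasurable, ← noiseLaw_map_curry, Measure.map_map]
  · rfl
  · exact measurable_pi_lambda _ fun i => (hm i).comp (measurable_pi_apply i)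
  · exact measurable_pi_lambda _ fun _ => measurable_pi_lambda _ fun _ => measurable_pi_apply _

/-- The coordinates use disjoint parts of the tape, so that basic composition applies to them. -/
theorem isDP_multivariateDecoder {d : ℕ} (hd : 1 ≤ d) {ε δ : ℝ} (hε : ε ∈ Set.Ioo (0 : ℝ) 1)
    (hδ : δ ∈ Set.Ioo (0 : ℝ) 1) (α β : ℝ) {γ : ℝ} (hγ : γ ∈ Set.Ioo (0 : ℝ) 1) (n : ℕ) :
    IsDP (noiseLaw d) (multivariateDecoder d ε δ α β γ n) ε δ := by
  intro D D' hDD' S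
  have hd1 : (1 : ℝ) ≤ d := by exact_mod_cast hd
  have hd0 : (0 : ℝ) < d := by linarith
  have hdiff : ∀ i : Fin d, {t | D t i ≠ D' t i}.Subsingleton := by
    obtain ⟨t, ht⟩ := hDD'
    have h : ∀ (i : Fin d) (s : Fin n), D s i ≠ D' s i → s = t := fun i s hs => by
      by_contra hst
      exact hs (by rw [ht s hst])
    exact fun i a ha b hb => (h i a ha).trans (h i b hb).symm
  have hind : Indist ε δ ((noiseLaw d).map (multivariateCode d ε δ γ D))
      ((noiseLaw d).map (multivariateCode d ε δ γ D')) := by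
    have hm := fun (D : Fin n → EuclideanSpace ℝ (Fin d)) (i : Fin d) =>
      measurable_univariateCode γ (ε / d) (δ / d) fun t => D t i
    have hpr : ∀ (D : Fin n → EuclideanSpace ℝ (Fin d)) (i : Fin d),
        IsProbabilityMeasure ((laplaceTape UniIndex).map
          (univariateCode γ (ε / d) (δ / d) fun t => D t i)) := fun D i =>
      Measure.isProbabilityMeasure_map (hm D i).aemeasurable
    have h := Indist.pi (ε := ε / d) (δ := δ / d) (by have := hδ.1; positivity) fun i : Fin d =>
      indist_univariateCode (γ := γ) hγ (ε := ε / d) (δ := δ / d)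
        ⟨by have := hε.1; positivity, (div_le_one hd0).2 (by linarith [hε.2])⟩
        ⟨by have := hδ.1; positivity, (div_lt_one hd0).2 (by linarith [hδ.2])⟩ (hdiff i)
    rw [mul_div_cancel₀ _ hd0.ne', mul_div_cancel₀ _ hd0.ne'] at h
    rwa [noiseLaw_map_multivariateCode, noiseLaw_map_multivariateCode]
  -- all sets of codes are measurable, since there are only countably many codes
  set Φ : (Fin d → Finset ℤ × Finset ((_ : ℤ) × ℤ)) → Set (Measure (EuclideanSpace ℝ (Fin d))) :=
    fun c => {q | ∃ (μ : EuclideanSpace ℝ (Fin d)) (σ : Fin d → ℝ),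
      (∀ i, μ i ∈ (outputOfCode (α / d) (c i)).1) ∧ (∀ i, σ i ∈ (outputOfCode (α / d) (c i)).2) ∧
      q = multivariateGaussian μ (Matrix.diagonal fun i => σ i ^ 2)} with hΦ
  have hdec : ∀ (D : Fin n → EuclideanSpace ℝ (Fin d)) ω,
      multivariateDecoder d ε δ α β γ n D ω = Φ (multivariateCode d ε δ γ D ω) := by
    intro D ω
    simp only [multivariateDecoder, coordinateDecoder, univariateDecoder_eq, hΦ, multivariateCode]
  have hmeas : ∀ D : Fin n → EuclideanSpace ℝ (Fin d), Measurable (multivariateCode d ε δ γ D) :=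
    fun D => measurable_pi_lambda _ fun i => (measurable_univariateCode _ _ _ _).comp
      (measurable_pi_lambda _ fun _ => measurable_pi_apply _)
  have hall : MeasurableSet (Φ ⁻¹' S) := .of_discrete
  have h := hind.measure_le hall
  rw [Measure.map_apply (hmeas D) hall, Measure.map_apply (hmeas D') hall] at h
  simp only [hdec]
  exact h

end Codes

/-! ### Accuracy of the stable histogram -/

section Accuracy

variable {X : Type*} {n : ℕ}

theorem finite_nonempty_bins (D : Fin n → X) {B : ℤ → Set X}
    (hB : Pairwise (Function.onFun Disjoint B)) : {i | ∃ t, D t ∈ B i}.Finite := by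
  have : {i | ∃ t, D t ∈ B i} = ⋃ t, {i | D t ∈ B i} := by ext; simp
  rw [this]
  refine Set.finite_iUnion fun t => Set.Subsingleton.finite fun i hi j hj => ?_
  by_contra hij
  exact Set.disjoint_left.1 (hB hij) hi hj

theorem sum_binFreq_le_one (D : Fin n → X) {B : ℤ → Set X}
    (hB : Pairwise (Function.onFun Disjoint B)) (G : Finset ℤ) :
    ∑ i ∈ G, binFreq D (B i) ≤ 1 := by
  classical
  have h : ∀ i, {t | D t ∈ B i}.ncard = (Finset.univ.filter fun t => D t ∈ B i).card := fun i => by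
    rw [← Set.ncard_coe_finset]; simp
  unfold binFreq
  rw [← Finset.sum_div]
  refine div_le_one_of_le₀ ?_ (Nat.cast_nonneg _)
  simp_rw [h]
  rw [← Nat.cast_sum, ← Finset.card_biUnion]
  · exact_mod_cast (Finset.card_le_univ _).trans (by simp)
  · intro i _ j _ hij
    rw [Function.onFun, Finset.disjoint_left]
    intro t ht ht'
    simp only [Finset.mem_filter, Finset.mem_univ, true_and] at ht ht'
    exact Set.disjoint_left.1 (hB hij) ht ht'

/-- A bin of frequency at least `6/5 τ` is listed if the noise of all non-empty bins is small: then
all bins of estimated frequency at least `τ` have frequency at least `4/5 τ`, so that there are at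
most `5 / (4 τ)` of them. -/
theorem mem_heavyBins_of_noise_le {D : Fin n → X} {B : ℤ → Set X}
    (hB : Pairwise (Function.onFun Disjoint B)) {ε δ τ r : ℝ} (hε : 0 < ε) (hτ : 0 < τ)
    {i₀ : ℤ} {ξ : ℤ → ℝ} (hcount : 6 / 5 * τ ≤ binFreq D (B i₀))
    (hnoise : ∀ i, (∃ t, D t ∈ B i) → |ξ i| ≤ r) (hr : 2 / (ε * n) * r ≤ τ / 5)
    (hthr : 2 * Real.log (2 / δ) / (ε * n) + 1 / n ≤ τ) :
    i₀ ∈ heavyBins τ (3 / (2 * τ)) (stableHistogram ε δ D B ξ) := by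
  have hex : ∀ i, binFreq D (B i) ≠ 0 → ∃ t, D t ∈ B i := by
    intro i hi
    by_contra! h
    exact hi (by simp [binFreq, h])
  have habs : ∀ i, binFreq D (B i) ≠ 0 → |2 / (ε * n) * ξ i| ≤ τ / 5 := by
    intro i hi
    rw [abs_mul, abs_of_nonneg (by positivity : 0 ≤ 2 / (ε * (n : ℝ)))]
    exact (mul_le_mul_of_nonneg_left (hnoise i (hex i hi)) (by positivity)).trans hr
  have hmem : i₀ ∈ {i | τ ≤ stableHistogram ε δ D B ξ i} := by
    have h0 : binFreq D (B i₀) ≠ 0 := by linarith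
    have h1 := (abs_le.1 (habs i₀ h0)).1
    have h2 : ¬ (binFreq D (B i₀) + 2 / (ε * n) * ξ i₀ <
        2 * Real.log (2 / δ) / (ε * n) + 1 / n) := by linarith
    simp only [Set.mem_ofPred_eq, stableHistogram, if_neg h0, if_neg h2]
    linarith
  have hlow : ∀ i ∈ {i | τ ≤ stableHistogram ε δ D B ξ i}, 4 / 5 * τ ≤ binFreq D (B i) := by
    intro i hi
    simp only [Set.mem_ofPred_eq, stableHistogram] at hi
    split_ifs at hi with h0 h1
    · linarith
    · linarith
    · have := (abs_le.1 (habs i h0)).2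
      linarith
  have hfin : {i | τ ≤ stableHistogram ε δ D B ξ i}.Finite :=
    (finite_nonempty_bins D hB).subset fun i hi => hex i (by linarith [hlow i hi])
  have hcard : {i | τ ≤ stableHistogram ε δ D B ξ i}.encard ≤ (⌊3 / (2 * τ)⌋₊ : ℕ∞) := by
    rw [hfin.encard_eq_coe_toFinset_card]
    refine Nat.cast_le.2 (Nat.le_floor ?_)
    have h1 : (hfin.toFinset.card : ℝ) * (4 / 5 * τ) ≤ 1 := by
      rw [← nsmul_eq_mul]
      refine (Finset.card_nsmul_le_sum _ _ _ fun i hi => ?_).trans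
        (sum_binFreq_le_one D hB hfin.toFinset)
      exact hlow i (by simpa using hi)
    rw [le_div_iff₀ (by positivity)]
    linarith
  rw [heavyBins, if_pos hcard]
  exact hmem

/-- With high probability the noise of all non-empty bins is small, as there are at most `n` of
them. -/
theorem laplaceTape_noise_gt_le (D : Fin n → X) {B : ℤ → Set X}
    (hB : Pairwise (Function.onFun Disjoint B)) {r : ℝ} (hr : 0 ≤ r) :
    laplaceTape ℤ {ξ | ∃ i, (∃ t, D t ∈ B i) ∧ r < |ξ i|} ≤
      ENNReal.ofReal (n * Real.exp (-r)) := by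
  have h : {ξ : ℤ → ℝ | ∃ i, (∃ t, D t ∈ B i) ∧ r < |ξ i|} =
      ⋃ t, {ξ | ∃ i, D t ∈ B i ∧ r < |ξ i|} := by
    ext ξ
    simp only [Set.mem_ofPred_eq, Set.mem_iUnion]
    exact ⟨fun ⟨i, ⟨t, ht⟩, h⟩ => ⟨t, i, ht, h⟩, fun ⟨t, i, ht, h⟩ => ⟨i, ⟨t, ht⟩, h⟩⟩
  have h1 : ∀ t, laplaceTape ℤ {ξ | ∃ i, D t ∈ B i ∧ r < |ξ i|} ≤
      ENNReal.ofReal (Real.exp (-r)) := by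
    intro t
    by_cases hi : ∃ i, D t ∈ B i
    · obtain ⟨i, hi⟩ := hi
      have hsub : {ξ : ℤ → ℝ | ∃ i, D t ∈ B i ∧ r < |ξ i|} ⊆ {ξ | ξ i ∈ {x | r ≤ |x|}} := by
        rintro ξ ⟨j, hj, hξ⟩
        have hij : j = i := by
          by_contra hij
          exact Set.disjoint_left.1 (hB hij) hj hi
        subst hij
        exact hξ.le
      refine (measure_mono hsub).trans ?_
      rw [laplaceTape_eval i (measurableSet_le measurable_const (by fun_prop))]
      exact stdLaplace_le_abs hr
    · have : {ξ : ℤ → ℝ | ∃ i, D t ∈ B i ∧ r < |ξ i|} = ∅ := by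
        push Not at hi
        ext ξ
        simp [hi]
      rw [this]; simp
  rw [h]
  refine (measure_iUnion_fintype_le _ _).trans ((Finset.sum_le_sum fun t _ => h1 t).trans ?_)
  rw [Finset.sum_const, Finset.card_univ, Fintype.card_fin, nsmul_eq_mul,
    ENNReal.ofReal_mul (Nat.cast_nonneg _), ENNReal.ofReal_natCast]

end Accuracy

/-- The lower multiplicative Chernoff bound, for the number of independent events that occur. -/
theorem measure_ncard_le_le_exp {Ω Y : Type*} [MeasurableSpace Ω] [MeasurableSpace Y]
    {Q : Measure Ω} [IsProbabilityMeasure Q] {n : ℕ} {Z : Fin n → Ω → Y}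
    (hZ : ∀ t, Measurable (Z t)) (hind : iIndepFun Z Q) {B : Set Y} (hB : MeasurableSet B)
    {q : ℝ} (hq : ∀ t, q ≤ Q.real {ω | Z t ω ∈ B}) :
    Q.real {ω | ({t | Z t ω ∈ B}.ncard : ℝ) ≤ 3 / 4 * (n * q)} ≤ Real.exp (-(n * q) / 32) := by
  classical
  set W : Fin n → Ω → ℝ := fun t ω => B.indicator 1 (Z t ω) with hW
  have hindm : Measurable (B.indicator (1 : Y → ℝ)) := measurable_one.indicator hB
  have hWm : ∀ t, Measurable (W t) := fun t => hindm.comp (hZ t)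
  have hWind : iIndepFun W Q := hind.comp (fun _ => B.indicator 1) fun _ => hindm
  have hcount : ∀ ω, ({t | Z t ω ∈ B}.ncard : ℝ) = (∑ t, W t) ω := by
    intro ω
    have h : {t | Z t ω ∈ B}.ncard = (Finset.univ.filter fun t => Z t ω ∈ B).card := by
      rw [← Set.ncard_coe_finset]; simp
    rw [h, Finset.sum_apply, Finset.card_filter]
    push_cast
    simp [hW, Set.indicator_apply]
  have hWsum0 : ∀ ω, 0 ≤ (∑ t, W t) ω := fun ω => by rw [← hcount]; positivity
  have hWsum : Measurable (∑ t, W t) := by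
    have h : (∑ t, W t) = fun ω => ∑ t, W t ω := by ext; simp
    rw [h]
    exact Finset.measurable_sum _ fun t _ => hWm t
  have hint : Integrable (fun ω => Real.exp (-(1 / 4) * (∑ t, W t) ω)) Q := by
    refine Integrable.of_bound (C := 1) ((hWsum.const_mul _).exp).aestronglyMeasurable
      (.of_forall fun ω => ?_)
    rw [Real.norm_eq_abs, abs_of_pos (Real.exp_pos _), Real.exp_le_one_iff]
    linarith [hWsum0 ω]
  have hexp : Real.exp (-(1 / 4)) ≤ 25 / 32 := by
    rw [Real.exp_neg]
    have := Real.quadratic_le_exp_of_nonneg (by norm_num : (0 : ℝ) ≤ 1 / 4)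
    exact (inv_anti₀ (by norm_num) this).trans (by norm_num)
  have hmgf : ∀ t, mgf (W t) Q (-(1 / 4)) ≤ Real.exp (-(7 / 32 * q)) := by
    intro t
    have hs : MeasurableSet {ω | Z t ω ∈ B} := hZ t hB
    have h1 : ∀ ω, Real.exp (-(1 / 4) * W t ω) =
        1 - (1 - Real.exp (-(1 / 4))) * {ω | Z t ω ∈ B}.indicator 1 ω := by
      intro ω
      by_cases h : Z t ω ∈ B <;> simp [hW, Set.indicator_apply, h]
    have hi : Integrable ({ω | Z t ω ∈ B}.indicator (1 : Ω → ℝ)) Q :=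
      (integrable_const (1 : ℝ)).indicator hs
    rw [mgf]
    simp_rw [h1]
    rw [integral_sub (integrable_const _) (hi.const_mul _), integral_const_mul,
      integral_indicator_one hs, integral_const, probReal_univ, smul_eq_mul, mul_one]
    have h2 := Real.add_one_le_exp (-(7 / 32 * q))
    have h3 : Q.real {ω | Z t ω ∈ B} ≥ 0 := measureReal_nonneg
    nlinarith [hq t]
  have hle := measure_le_le_exp_mul_mgf (μ := Q) (X := ∑ t, W t) (t := -(1 / 4))
    (3 / 4 * (n * q)) (by norm_num) hint
  simp_rw [hcount]
  refine hle.trans ?_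
  rw [hWind.mgf_sum hWm]
  calc Real.exp (-(-(1 / 4)) * (3 / 4 * (n * q))) * ∏ t, mgf (W t) Q (-(1 / 4))
      ≤ Real.exp (-(-(1 / 4)) * (3 / 4 * (n * q))) * ∏ _t : Fin n, Real.exp (-(7 / 32 * q)) := by
        gcongr with t
        · exact fun t _ => mgf_nonneg
        · exact hmgf t
    _ = Real.exp (-(n * q) / 32) := by
        rw [Finset.prod_const, Finset.card_univ, Fintype.card_fin, ← Real.exp_nat_mul,
          ← Real.exp_add]
        congr 1
        ring

/-- A bin of probability at least `8/5 τ` is missing in the list with probability at most `β / 2`.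
The data `Y` are drawn from `Q`, and the noise `N` from `P`. -/
theorem measure_notMem_heavyBins_le {Ω₀ Ω₁ X : Type*} [MeasurableSpace Ω₀] [MeasurableSpace Ω₁]
    [MeasurableSpace X] {Q : Measure Ω₀} [IsProbabilityMeasure Q] {P : Measure Ω₁}
    [IsProbabilityMeasure P] {n : ℕ} (hn : 1 ≤ n) {Y : Ω₀ → Fin n → X}
    (hY : ∀ t, Measurable fun ω => Y ω t) (hind : iIndepFun (fun t ω => Y ω t) Q)
    {N : Ω₁ → ℤ → ℝ} (hN : Measurable N) (hNP : P.map N = laplaceTape ℤ) {B : ℤ → Set X}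
    (hBm : ∀ i, MeasurableSet (B i)) (hB : Pairwise (Function.onFun Disjoint B))
    {ε δ τ β : ℝ} (hε : ε ∈ Set.Ioc (0 : ℝ) 1) (hτ : 0 < τ) (hβ : β ∈ Set.Ioo (0 : ℝ) 1)
    {i₀ : ℤ} (hq : ∀ t, 8 / 5 * τ ≤ Q.real {ω | Y ω t ∈ B i₀})
    (h₁ : 20 * Real.log (4 * n / β) ≤ n * ε * τ) (h₂ : 4 * Real.log (2 / δ) ≤ n * ε * τ) :
    Q.prod P {z | i₀ ∉ heavyBins τ (3 / (2 * τ)) (stableHistogram ε δ (Y z.1) B (N z.2))} ≤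
      ENNReal.ofReal (β / 2) := by
  obtain ⟨hε0, hε1⟩ := hε
  obtain ⟨hβ0, hβ1⟩ := hβ
  have hn1 : (1 : ℝ) ≤ n := by exact_mod_cast hn
  have hn0 : (0 : ℝ) < n := by linarith
  set r := Real.log (4 * n / β) with hr
  have h4 : 4 ≤ 4 * n / β := by
    rw [le_div_iff₀ hβ0]; nlinarith
  have hr1 : 1 ≤ r := by
    rw [hr, Real.le_log_iff_exp_le (by positivity)]
    linarith [Real.exp_one_lt_d9]
  have hexpr : Real.exp (-r) = β / (4 * n) := by
    rw [Real.exp_neg, hr, Real.exp_log (by positivity), inv_div]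
  have hnτ : n * ε * τ ≤ n * τ := by
    have : n * ε * τ ≤ n * 1 * τ := by gcongr
    linarith
  -- few data points in the bin
  set E₁ : Set Ω₀ := {ω | ({t | Y ω t ∈ B i₀}.ncard : ℝ) ≤ 3 / 4 * (n * (8 / 5 * τ))} with hE₁
  have hE₁le : Q E₁ ≤ ENNReal.ofReal (β / 4) := by
    rw [← ofReal_measureReal (measure_ne_top _ _)]
    refine ENNReal.ofReal_le_ofReal
      ((measure_ncard_le_le_exp hY hind (hBm i₀) hq).trans ?_)
    calc Real.exp (-(n * (8 / 5 * τ)) / 32) ≤ Real.exp (-r) := Real.exp_le_exp.2 (by linarith)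
      _ = β / (4 * n) := hexpr
      _ ≤ β / 4 := by
          apply div_le_div_of_nonneg_left <;> linarith
  -- large noise in a non-empty bin
  set E₂ : Set (Ω₀ × Ω₁) := {z | ∃ i, (∃ t, Y z.1 t ∈ B i) ∧ r < |N z.2 i|} with hE₂
  have hE₂m : MeasurableSet E₂ := by
    have : E₂ = ⋃ i, (⋃ t, {z : Ω₀ × Ω₁ | Y z.1 t ∈ B i}) ∩ {z | r < |N z.2 i|} := by
      ext z; simp [hE₂]
    rw [this]
    refine .iUnion fun i => (MeasurableSet.iUnion fun t => ?_).inter ?_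
    · exact ((hY t).comp measurable_fst) (hBm i)
    · have h : Measurable fun z : Ω₀ × Ω₁ => N z.2 i :=
        (measurable_pi_apply i).comp (hN.comp measurable_snd)
      exact measurableSet_lt measurable_const (by fun_prop)
  have hE₂le : Q.prod P E₂ ≤ ENNReal.ofReal (β / 4) := by
    rw [Measure.prod_apply hE₂m]
    have hslice : ∀ ω, P (Prod.mk ω ⁻¹' E₂) ≤ ENNReal.ofReal (β / 4) := by
      intro ω
      have h := (Measure.le_map_apply (μ := P) hN.aemeasurable
        {ξ | ∃ i, (∃ t, Y ω t ∈ B i) ∧ r < |ξ i|}).trans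
        (hNP ▸ laplaceTape_noise_gt_le (Y ω) hB (r := r) (by linarith))
      rw [hexpr] at h
      refine h.trans (le_of_eq ?_)
      congr 1
      field_simp
    calc ∫⁻ ω, P (Prod.mk ω ⁻¹' E₂) ∂Q ≤ ∫⁻ _, ENNReal.ofReal (β / 4) ∂Q := lintegral_mono hslice
      _ = _ := by simp
  have hsub : {z : Ω₀ × Ω₁ | i₀ ∉ heavyBins τ (3 / (2 * τ))
      (stableHistogram ε δ (Y z.1) B (N z.2))} ⊆ E₁ ×ˢ Set.univ ∪ E₂ := by
    intro z hz
    by_contra hz'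
    simp only [Set.mem_union, Set.mem_prod, Set.mem_univ, and_true, not_or, hE₁, hE₂,
      Set.mem_ofPred_eq, not_le, not_exists, not_and, not_lt] at hz'
    obtain ⟨hz1, hz2⟩ := hz'
    refine hz (mem_heavyBins_of_noise_le hB hε0 hτ (r := r) ?_ (fun i hi => ?_) ?_ ?_)
    · rw [binFreq, le_div_iff₀ hn0]
      linarith
    · exact hz2 i hi
    · rw [div_mul_eq_mul_div, div_le_iff₀ (by positivity)]
      nlinarith
    · have h5 : 2 * Real.log (2 / δ) / (ε * n) ≤ τ / 2 := by
        rw [div_le_iff₀ (by positivity)]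
        nlinarith
      have h6 : 1 / (n : ℝ) ≤ τ / 2 := by
        rw [div_le_iff₀ hn0]
        nlinarith
      linarith
  calc Q.prod P _ ≤ Q.prod P (E₁ ×ˢ Set.univ ∪ E₂) := measure_mono hsub
    _ ≤ Q.prod P (E₁ ×ˢ Set.univ) + Q.prod P E₂ := measure_union_le _ _
    _ ≤ ENNReal.ofReal (β / 4) + ENNReal.ofReal (β / 4) := by
        rw [Measure.prod_prod, measure_univ, mul_one]
        gcongr
    _ = ENNReal.ofReal (β / 2) := by
        rw [← ENNReal.ofReal_add (by positivity) (by positivity)]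
        congr 1; ring

/-! ### Gaussian estimates -/

section Gaussian

theorem gaussianPDFReal_eq {σ : ℝ} (hσ : 0 < σ) {v : ℝ≥0} (hv : (v : ℝ) = σ ^ 2) (μ x : ℝ) :
    gaussianPDFReal μ v x =
      (Real.sqrt (2 * Real.pi))⁻¹ * σ⁻¹ * Real.exp (-(x - μ) ^ 2 / (2 * σ ^ 2)) := by
  rw [gaussianPDFReal, hv, Real.sqrt_mul (by positivity), Real.sqrt_sq hσ.le, mul_inv]

theorem sqrt_two_pi_le : Real.sqrt (2 * Real.pi) ≤ 3 := by
  rw [Real.sqrt_le_left (by norm_num)]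
  linarith [Real.pi_lt_d2]

theorem le_sqrt_two_pi : 7 / 3 ≤ Real.sqrt (2 * Real.pi) := by
  apply Real.le_sqrt_of_sq_le
  linarith [Real.pi_gt_three]

theorem ne_zero_of_coe_eq_sq {σ : ℝ} (hσ : 0 < σ) {v : ℝ≥0} (hv : (v : ℝ) = σ ^ 2) : v ≠ 0 := by
  rintro rfl
  have : 0 < σ ^ 2 := by positivity
  simp at hv
  linarith

theorem gaussianReal_real_eq_integral {σ : ℝ} (hσ : 0 < σ) {v : ℝ≥0} (hv : (v : ℝ) = σ ^ 2)
    (μ : ℝ) (s : Set ℝ) : (gaussianReal μ v).real s = ∫ x in s, gaussianPDFReal μ v x := by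
  rw [measureReal_def, gaussianReal_apply_eq_integral _ (ne_zero_of_coe_eq_sq hσ hv),
    ENNReal.toReal_ofReal (integral_nonneg fun x => gaussianPDFReal_nonneg _ _ _)]

theorem gaussianReal_Ioc_le {σ : ℝ} (hσ : 0 < σ) {v : ℝ≥0} (hv : (v : ℝ) = σ ^ 2) {μ a b M : ℝ}
    (hab : a ≤ b) (h : ∀ x ∈ Set.Ioc a b, gaussianPDFReal μ v x ≤ M) :
    (gaussianReal μ v).real (Set.Ioc a b) ≤ M * (b - a) := by
  rw [gaussianReal_real_eq_integral hσ hv]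
  calc ∫ x in Set.Ioc a b, gaussianPDFReal μ v x ≤ ∫ _ in Set.Ioc a b, M :=
        setIntegral_mono_on (integrable_gaussianPDFReal _ _).integrableOn
          (integrableOn_const (by simp)) measurableSet_Ioc h
    _ = M * (b - a) := by
        rw [setIntegral_const, smul_eq_mul, measureReal_def, Real.volume_Ioc,
          ENNReal.toReal_ofReal (by linarith), mul_comm]

/-- An interval that contains the mean, and is at least as long as the standard deviation. -/
theorem gaussianReal_Ioc_ge {σ : ℝ} (hσ : 0 < σ) {v : ℝ≥0} (hv : (v : ℝ) = σ ^ 2) {μ a b : ℝ}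
    (hab : σ ≤ b - a) (hμ : μ ∈ Set.Ioc a b) : 1 / 5 ≤ (gaussianReal μ v).real (Set.Ioc a b) := by
  obtain ⟨h1, h2⟩ := hμ
  -- a subinterval of length `σ` on which `|x - μ| ≤ σ`
  set c := max a (μ - σ) with hc
  have hca : a ≤ c := le_max_left _ _
  have hcμ : μ - σ ≤ c := le_max_right _ _
  have hcb : c + σ ≤ b := by
    rcases max_choice a (μ - σ) with h | h <;> rw [hc, h] <;> linarith
  have hcμ' : c ≤ μ := max_le h1.le (by linarith)
  have hsub : Set.Ioc c (c + σ) ⊆ Set.Ioc a b := Set.Ioc_subset_Ioc hca hcb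
  refine le_trans ?_ (measureReal_mono hsub)
  rw [gaussianReal_real_eq_integral hσ hv]
  have hexp : 3 / 5 ≤ Real.exp (-(1 / 2)) := by
    rw [Real.exp_neg, le_inv_comm₀ (by norm_num) (Real.exp_pos _)]
    have h3 : Real.exp (1 / 2) ^ 2 ≤ (5 / 3) ^ 2 := by
      rw [← Real.exp_nat_mul]
      norm_num
      linarith [Real.exp_one_lt_d9]
    have := abs_le_of_sq_le_sq h3 (by norm_num)
    rw [abs_of_pos (Real.exp_pos _)] at this
    norm_num
    linarith
  have hpdf : ∀ x ∈ Set.Ioc c (c + σ), 1 / 5 * σ⁻¹ ≤ gaussianPDFReal μ v x := by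
    intro x hx
    rw [gaussianPDFReal_eq hσ hv]
    have hx2 : (x - μ) ^ 2 ≤ σ ^ 2 := by
      apply sq_le_sq'
      · linarith [hx.1]
      · linarith [hx.2]
    have h4 : Real.exp (-(1 / 2)) ≤ Real.exp (-(x - μ) ^ 2 / (2 * σ ^ 2)) := by
      apply Real.exp_le_exp.2
      rw [neg_div, neg_le_neg_iff, div_le_div_iff₀ (by positivity) (by positivity)]
      linarith
    have h5 : (3 : ℝ)⁻¹ ≤ (Real.sqrt (2 * Real.pi))⁻¹ :=
      inv_anti₀ (by positivity) sqrt_two_pi_le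
    calc 1 / 5 * σ⁻¹ = 3⁻¹ * σ⁻¹ * (3 / 5) := by ring
      _ ≤ _ := by gcongr; exact hexp.trans h4
  calc (1 / 5 : ℝ) = ∫ _ in Set.Ioc c (c + σ), 1 / 5 * σ⁻¹ := by
        rw [setIntegral_const, smul_eq_mul, measureReal_def, Real.volume_Ioc, add_sub_cancel_left,
          ENNReal.toReal_ofReal hσ.le]
        field_simp
    _ ≤ _ := setIntegral_mono_on (integrableOn_const (by simp))
        (integrable_gaussianPDFReal _ _).integrableOn measurableSet_Ioc hpdf

/-- The positive half of the dyadic shell of the standard deviation. -/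
theorem gaussianReal_dyadic_ge {σ a : ℝ} {v : ℝ≥0} (hv : (v : ℝ) = σ ^ 2) (ha : 0 < a)
    (haσ : a ≤ σ) (hσa : σ ≤ 2 * a) : 1 / 10 ≤ (gaussianReal 0 v).real (Set.Ioc a (2 * a)) := by
  have hσ : 0 < σ := ha.trans_le haσ
  rw [gaussianReal_real_eq_integral hσ hv]
  set r := a / σ with hr
  have har : a = r * σ := by rw [hr]; field_simp
  have hr1 : r ≤ 1 := by rw [hr, div_le_one hσ]; exact haσ
  have hr2 : 1 / 2 ≤ r := by rw [hr, le_div_iff₀ hσ]; linarith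
  have hexp : 1 / 2.7182818286 ≤ Real.exp (-1) := by
    rw [Real.exp_neg, one_div]
    exact inv_anti₀ (Real.exp_pos _) Real.exp_one_lt_d9.le
  have h5 : (3 : ℝ)⁻¹ ≤ (Real.sqrt (2 * Real.pi))⁻¹ :=
    inv_anti₀ (by positivity) sqrt_two_pi_le
  -- the tangent of `exp (-u)` at `u = 1`
  have hpdf : ∀ x ∈ Set.Ioc a (2 * a), 3⁻¹ * σ⁻¹ * (1 / 2.7182818286 * (2 - x ^ 2 / (2 * σ ^ 2)))
      ≤ gaussianPDFReal 0 v x := by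
    intro x hx
    rw [gaussianPDFReal_eq hσ hv, sub_zero]
    have h6 := Real.add_one_le_exp (1 - x ^ 2 / (2 * σ ^ 2))
    have h7 : Real.exp (-x ^ 2 / (2 * σ ^ 2)) =
        Real.exp (-1) * Real.exp (1 - x ^ 2 / (2 * σ ^ 2)) := by
      rw [← Real.exp_add]; congr 1; ring
    have h8 : x ^ 2 / (2 * σ ^ 2) ≤ 2 := by
      rw [div_le_iff₀ (by positivity)]
      have h9 : x ≤ 2 * σ := by linarith [hx.2]
      have h10 : 0 ≤ x := by linarith [hx.1]
      nlinarith
    rw [h7]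
    have h11 : 0 ≤ 2 - x ^ 2 / (2 * σ ^ 2) := by linarith
    gcongr
    linarith
  have hint : ∫ x in Set.Ioc a (2 * a), 3⁻¹ * σ⁻¹ * (1 / 2.7182818286 * (2 - x ^ 2 / (2 * σ ^ 2)))
      = 3⁻¹ * (1 / 2.7182818286) * (2 * r - 7 / 6 * r ^ 3) := by
    rw [← intervalIntegral.integral_of_le (by linarith)]
    rw [intervalIntegral.integral_const_mul, intervalIntegral.integral_const_mul,
      intervalIntegral.integral_sub (by simp) (Continuous.intervalIntegrable (by fun_prop) _ _),
      intervalIntegral.integral_div, integral_pow, intervalIntegral.integral_const, har]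
    simp only [smul_eq_mul]
    field_simp
    norm_num
    ring
  calc (1 / 10 : ℝ) ≤ 3⁻¹ * (1 / 2.7182818286) * (2 * r - 7 / 6 * r ^ 3) := by
        have : 5 / 6 ≤ 2 * r - 7 / 6 * r ^ 3 := by
          have h12 := mul_nonneg (sub_nonneg.2 hr1) (sub_nonneg.2 hr2)
          nlinarith [mul_nonneg h12 (by linarith : 0 ≤ r)]
        norm_num
        linarith
    _ ≤ _ := by
        rw [← hint]
        exact setIntegral_mono_on (Continuous.integrableOn_Ioc (by fun_prop))
          (integrable_gaussianPDFReal _ _).integrableOn measurableSet_Ioc hpdf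

theorem gaussianReal_abs_mem_Ioc {v : ℝ≥0} {a b : ℝ} (ha : 0 ≤ a) :
    (gaussianReal 0 v).real {x | |x| ∈ Set.Ioc a b} =
      2 * (gaussianReal 0 v).real (Set.Ioc a b) := by
  have h : {x : ℝ | |x| ∈ Set.Ioc a b} = Set.Ioc a b ∪ (fun x => -x) ⁻¹' Set.Ioc a b := by
    ext x
    simp only [Set.mem_ofPred_eq, Set.mem_union, Set.mem_preimage, Set.mem_Ioc]
    rcases abs_cases x with ⟨h1, h2⟩ | ⟨h1, h2⟩ <;> rw [h1]
    · exact ⟨Or.inl, fun h => h.elim id fun h => by constructor <;> linarith [h.1, h.2]⟩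
    · exact ⟨Or.inr, fun h => h.elim (fun h => by constructor <;> linarith [h.1, h.2]) id⟩
  have hd : Disjoint (Set.Ioc a b) ((fun x => -x) ⁻¹' Set.Ioc a b) := by
    rw [Set.disjoint_left]
    intro x h1 h2
    simp only [Set.mem_preimage, Set.mem_Ioc] at h1 h2
    linarith [h1.1, h2.1]
  have hneg : (gaussianReal 0 v).real ((fun x => -x) ⁻¹' Set.Ioc a b) =
      (gaussianReal 0 v).real (Set.Ioc a b) := by
    rw [measureReal_def, ← Measure.map_apply measurable_neg measurableSet_Ioc, gaussianReal_map_neg,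
      neg_zero, measureReal_def]
  rw [h, measureReal_union hd (measurable_neg measurableSet_Ioc), hneg]
  ring

theorem gaussianReal_prod_map_sub_div (μ : ℝ) (v : ℝ≥0) :
    ((gaussianReal μ v).prod (gaussianReal μ v)).map (fun p => (p.1 - p.2) / Real.sqrt 2) =
      gaussianReal 0 v := by
  have h1 : ((gaussianReal μ v).prod (gaussianReal μ v)).map (fun p => p.1 - p.2) =
      gaussianReal 0 (v + v) := by
    have h2 : gaussianReal μ v ∗ gaussianReal (-μ) v = gaussianReal 0 (v + v) := by
      rw [gaussianReal_conv_gaussianReal, add_neg_cancel]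
    rw [← h2, Measure.conv, ← gaussianReal_map_neg]
    have h3 : (gaussianReal μ v).prod ((gaussianReal μ v).map fun x => -x) =
        ((gaussianReal μ v).prod (gaussianReal μ v)).map (Prod.map id fun x => -x) := by
      rw [← Measure.map_prod_map _ _ measurable_id measurable_neg, Measure.map_id]
    rw [h3, Measure.map_map (by fun_prop) (by fun_prop)]
    congr 1
  have h4 : (fun p : ℝ × ℝ => (p.1 - p.2) / Real.sqrt 2) =
      (fun x => x / Real.sqrt 2) ∘ fun p => p.1 - p.2 := rfl
  rw [h4, ← Measure.map_map (by fun_prop) (by fun_prop), h1, gaussianReal_map_div_const, zero_div]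
  congr 1
  ext
  simp only [NNReal.coe_div, NNReal.coe_add, NNReal.coe_mk]
  rw [Real.sq_sqrt (by norm_num)]
  ring

/-- The normalized difference of two independent samples lies in the dyadic shell of the standard
deviation with constant probability. -/
theorem gaussianReal_prod_dyadic_ge {σ a : ℝ} {v : ℝ≥0} (hv : (v : ℝ) = σ ^ 2) (ha : 0 < a)
    (haσ : a ≤ σ) (hσa : σ ≤ 2 * a) (μ : ℝ) :
    1 / 5 ≤ ((gaussianReal μ v).prod (gaussianReal μ v)).real
      {p | |p.1 - p.2| / Real.sqrt 2 ∈ Set.Ioc a (2 * a)} := by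
  have hs : MeasurableSet {x : ℝ | |x| ∈ Set.Ioc a (2 * a)} :=
    measurableSet_Ioc.preimage (by fun_prop : Measurable fun x : ℝ => |x|)
  have h : ((gaussianReal μ v).prod (gaussianReal μ v)).real
      {p | |p.1 - p.2| / Real.sqrt 2 ∈ Set.Ioc a (2 * a)} =
      (gaussianReal 0 v).real {x | |x| ∈ Set.Ioc a (2 * a)} := by
    rw [← gaussianReal_prod_map_sub_div μ v, measureReal_def, measureReal_def,
      Measure.map_apply (by fun_prop) hs]
    congr 2
    ext p
    simp [abs_div, abs_of_nonneg (Real.sqrt_nonneg 2)]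
  rw [h, gaussianReal_abs_mem_Ioc ha.le]
  linarith [gaussianReal_dyadic_ge hv ha haσ hσa]

end Gaussian

/-! ### Total variation distance of Gaussians -/

section TotalVariation

/-- The set on which the first density is larger is the optimal test. -/
theorem Indist.of_withDensity {Y : Type*} [MeasurableSpace Y] {ρ : Measure Y} {p q : Y → ℝ≥0∞}
    (hp : Measurable p) (hq : Measurable q) [IsFiniteMeasure (ρ.withDensity q)] {A : Set Y}
    (hA : MeasurableSet A) (hA₁ : ∀ y ∈ A, q y ≤ p y) (hA₂ : ∀ y ∉ A, p y ≤ q y) {δ : ℝ}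
    (h : ρ.withDensity p A ≤ ρ.withDensity q A + ENNReal.ofReal δ) :
    Indist 0 δ (ρ.withDensity p) (ρ.withDensity q) := by
  intro g hg hg1
  have hfin : ∫⁻ y in A, q y ∂ρ ≠ ∞ := by
    rw [← withDensity_apply _ hA]
    exact measure_ne_top _ _
  have hexcess : ∫⁻ y in A, (p y - q y) ∂ρ ≤ ENNReal.ofReal δ := by
    rw [lintegral_sub hq hfin ((ae_restrict_iff' hA).2 (Filter.Eventually.of_forall hA₁)),
      tsub_le_iff_left, ← withDensity_apply _ hA, ← withDensity_apply _ hA]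
    exact h
  rw [lintegral_withDensity_eq_lintegral_mul _ hp hg,
    lintegral_withDensity_eq_lintegral_mul _ hq hg, Real.exp_zero, ENNReal.ofReal_one, one_mul,
    ← lintegral_add_compl _ hA, ← lintegral_add_compl (fun y => (q * g) y) hA]
  have h1 : ∫⁻ y in A, (p * g) y ∂ρ ≤ ∫⁻ y in A, (q * g) y ∂ρ + ENNReal.ofReal δ := by
    calc ∫⁻ y in A, (p * g) y ∂ρ ≤ ∫⁻ y in A, ((q * g) y + (p y - q y)) ∂ρ := by
          refine setLIntegral_mono' hA fun y hy => ?_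
          calc p y * g y = q y * g y + (p y - q y) * g y := by
                rw [← add_mul, add_tsub_cancel_of_le (hA₁ y hy)]
            _ ≤ q y * g y + (p y - q y) := by
                gcongr
                exact mul_le_of_le_one_right' (hg1 y)
      _ ≤ _ := by
          rw [lintegral_add_left (hq.mul hg)]
          gcongr
  have h2 : ∫⁻ y in Aᶜ, (p * g) y ∂ρ ≤ ∫⁻ y in Aᶜ, (q * g) y ∂ρ := by
    refine setLIntegral_mono' hA.compl fun y hy => ?_
    simp only [Pi.mul_apply]
    gcongr
    exact hA₂ y hy
  calc _ ≤ (∫⁻ y in A, (q * g) y ∂ρ + ENNReal.ofReal δ) + ∫⁻ y in Aᶜ, (q * g) y ∂ρ := by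
        gcongr
    _ = _ := by ring

theorem Indist.tvDist_le {Y : Type*} [MeasurableSpace Y] {P Q : Measure Y}
    [IsProbabilityMeasure P] [IsProbabilityMeasure Q] {δ : ℝ} (hδ : 0 ≤ δ) (h : Indist 0 δ P Q) :
    tvDist P Q ≤ ENNReal.ofReal δ := by
  have key : ∀ S : Set Y, MeasurableSet S → P.real S ≤ Q.real S + δ := by
    intro S hS
    have h1 := h.measure_le hS
    rw [Real.exp_zero, ENNReal.ofReal_one, one_mul] at h1
    have h2 := ENNReal.toReal_mono (by finiteness) h1
    rwa [ENNReal.toReal_add (by finiteness) (by finiteness), ENNReal.toReal_ofReal hδ] at h2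
  refine iSup₂_le fun S hS => ENNReal.ofReal_le_ofReal ?_
  have h1 := key S hS
  have h2 := key Sᶜ hS.compl
  rw [probReal_compl_eq_one_sub hS, probReal_compl_eq_one_sub hS] at h2
  rw [abs_le]
  constructor <;> linarith

theorem indist_gaussianReal {μ μ' : ℝ} {v v' : ℝ≥0} (hv : v ≠ 0) (hv' : v' ≠ 0) {A : Set ℝ}
    (hA : MeasurableSet A) (hA₁ : ∀ x ∈ A, gaussianPDFReal μ' v' x ≤ gaussianPDFReal μ v x)
    (hA₂ : ∀ x ∉ A, gaussianPDFReal μ v x ≤ gaussianPDFReal μ' v' x) {δ : ℝ} (hδ : 0 ≤ δ)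
    (h : (gaussianReal μ v).real A ≤ (gaussianReal μ' v').real A + δ) :
    Indist 0 δ (gaussianReal μ v) (gaussianReal μ' v') := by
  have h' : gaussianReal μ v A ≤ gaussianReal μ' v' A + ENNReal.ofReal δ := by
    rw [← ofReal_measureReal, ← ofReal_measureReal (μ := gaussianReal μ' v'),
      ← ENNReal.ofReal_add measureReal_nonneg hδ]
    exact ENNReal.ofReal_le_ofReal h
  have : IsFiniteMeasure (volume.withDensity (gaussianPDF μ' v')) := by
    rw [← gaussianReal_of_var_ne_zero _ hv']
    infer_instance
  rw [gaussianReal_of_var_ne_zero _ hv, gaussianReal_of_var_ne_zero _ hv'] at h' ⊢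
  exact Indist.of_withDensity (measurable_gaussianPDF _ _) (measurable_gaussianPDF _ _) hA
    (fun x hx => ENNReal.ofReal_le_ofReal (hA₁ x hx))
    (fun x hx => ENNReal.ofReal_le_ofReal (hA₂ x hx)) h'

theorem inv_sqrt_two_pi_le : (Real.sqrt (2 * Real.pi))⁻¹ ≤ 3 / 7 := by
  have := inv_anti₀ (by norm_num) le_sqrt_two_pi
  norm_num at this ⊢
  exact this

/-- The densities cross at the midpoint of the means, and the excess mass is that of an interval of
length `μ' - μ`. -/
theorem indist_gaussianReal_shift_of_le {σ : ℝ} (hσ : 0 < σ) {v : ℝ≥0} (hv : (v : ℝ) = σ ^ 2)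
    {μ μ' : ℝ} (h : μ ≤ μ') :
    Indist 0 (3 / 7 * ((μ' - μ) / σ)) (gaussianReal μ v) (gaussianReal μ' v) := by
  have hv0 := ne_zero_of_coe_eq_sq hσ hv
  have hd : 0 ≤ μ' - μ := by linarith
  refine indist_gaussianReal hv0 hv0 (A := Set.Iic ((μ + μ') / 2)) measurableSet_Iic ?_ ?_
    (by positivity) ?_
  · intro x hx
    rw [gaussianPDFReal_eq hσ hv, gaussianPDFReal_eq hσ hv]
    refine mul_le_mul_of_nonneg_left (Real.exp_le_exp.2
      (div_le_div_of_nonneg_right ?_ (by positivity))) (by positivity)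
    have : 0 ≤ (μ' - μ) * (μ + μ' - 2 * x) := by
      apply mul_nonneg hd
      have := Set.mem_Iic.1 hx
      linarith
    nlinarith
  · intro x hx
    rw [gaussianPDFReal_eq hσ hv, gaussianPDFReal_eq hσ hv]
    refine mul_le_mul_of_nonneg_left (Real.exp_le_exp.2
      (div_le_div_of_nonneg_right ?_ (by positivity))) (by positivity)
    have : 0 ≤ (μ' - μ) * (2 * x - (μ + μ')) := by
      apply mul_nonneg hd
      rw [Set.mem_Iic, not_le] at hx
      linarith
    nlinarith
  · have h1 : (gaussianReal μ v).real (Set.Iic ((μ + μ') / 2)) =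
        (gaussianReal μ' v).real (Set.Iic ((μ + μ') / 2 + (μ' - μ))) := by
      have h2 : gaussianReal μ' v = (gaussianReal μ v).map (fun x => x + (μ' - μ)) := by
        rw [gaussianReal_map_add_const, add_sub_cancel]
      rw [h2, measureReal_def, measureReal_def,
        Measure.map_apply (measurable_add_const _) measurableSet_Iic]
      congr 2
      ext x
      simp
    rw [h1, ← Set.Iic_union_Ioc_eq_Iic (le_add_of_nonneg_right hd)]
    refine (measureReal_union_le _ _).trans ?_
    gcongr
    refine (gaussianReal_Ioc_le hσ hv (le_add_of_nonneg_right hd) (M := 3 / 7 * σ⁻¹) ?_).trans_eq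
      (by field_simp; ring)
    intro x _
    rw [gaussianPDFReal_eq hσ hv]
    have h3 : Real.exp (-(x - μ') ^ 2 / (2 * σ ^ 2)) ≤ 1 := by
      rw [Real.exp_le_one_iff, neg_div, neg_nonpos]
      positivity
    calc _ ≤ 3 / 7 * σ⁻¹ * 1 := by
          gcongr
          exact inv_sqrt_two_pi_le
      _ = _ := mul_one _

theorem indist_gaussianReal_shift {σ : ℝ} (hσ : 0 < σ) {v : ℝ≥0} (hv : (v : ℝ) = σ ^ 2)
    (μ μ' : ℝ) :
    Indist 0 (3 / 7 * (|μ - μ'| / σ)) (gaussianReal μ v) (gaussianReal μ' v) := by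
  rcases le_total μ μ' with h | h
  · rw [abs_sub_comm, abs_of_nonneg (sub_nonneg.2 h)]
    exact indist_gaussianReal_shift_of_le hσ hv h
  · have h1 := (indist_gaussianReal_shift_of_le hσ hv (neg_le_neg h)).map measurable_neg
    rw [gaussianReal_map_neg, gaussianReal_map_neg, neg_neg, neg_neg] at h1
    rw [abs_of_nonneg (sub_nonneg.2 h)]
    exact h1.mono le_rfl (by rw [neg_sub_neg])

/-- The maximum is `exp (-1 / 2)`; this bound follows from `y ^ 2 ≤ exp (y ^ 2 - 1)`. -/
theorem mul_exp_neg_sq_div_two_le (y : ℝ) : y * Real.exp (-y ^ 2 / 2) ≤ 2 / 3 := by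
  refine (abs_le_of_sq_le_sq' ?_ (by norm_num)).2
  have h1 := Real.add_one_le_exp (y ^ 2 - 1)
  have h2 : Real.exp (-y ^ 2 / 2) ^ 2 = (Real.exp (y ^ 2))⁻¹ := by
    rw [← Real.exp_nat_mul, ← Real.exp_neg]
    congr 1
    push_cast
    ring
  have h3 : Real.exp (y ^ 2) = Real.exp 1 * Real.exp (y ^ 2 - 1) := by
    rw [← Real.exp_add]
    congr 1
    ring
  have h4 : 9 / 4 * y ^ 2 ≤ Real.exp (y ^ 2) := by
    rw [h3]
    have := Real.exp_one_gt_d9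
    have h5 : (9 / 4 : ℝ) ≤ Real.exp 1 := by linarith
    exact mul_le_mul h5 (by linarith) (by positivity) (by positivity)
  rw [mul_pow, h2, ← div_eq_mul_inv, div_le_iff₀ (Real.exp_pos _)]
  linarith

/-- The densities of two centred Gaussians cross at `± w`, and the wider Gaussian is a dilation of
the narrower one, so the excess mass is that of two short intervals next to `± w`. -/
theorem indist_gaussianReal_scale_zero {σ σ' : ℝ} (hσ : 0 < σ) (hσσ' : σ < σ') {v v' : ℝ≥0}
    (hv : (v : ℝ) = σ ^ 2) (hv' : (v' : ℝ) = σ' ^ 2) :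
    Indist 0 (4 / 7 * (σ' / σ - 1)) (gaussianReal 0 v) (gaussianReal 0 v') := by
  have hσ' : 0 < σ' := hσ.trans hσσ'
  have hv0 := ne_zero_of_coe_eq_sq hσ hv
  have hv0' := ne_zero_of_coe_eq_sq hσ' hv'
  set r := σ' / σ with hr
  have hr1 : 1 < r := by rw [hr, one_lt_div hσ]; exact hσσ'
  have hrσ : σ' = r * σ := by rw [hr]; field_simp
  -- the quotient of the densities is `exp (κ x ^ 2) / r`, which equals `1` at `x = ± w`
  set κ := (1 / σ ^ 2 - 1 / σ' ^ 2) / 2 with hκ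
  have hκ0 : 0 < κ := by
    have : 1 / σ' ^ 2 < 1 / σ ^ 2 := by gcongr
    rw [hκ]; linarith
  have hlog : 0 < Real.log r := Real.log_pos hr1
  set w := Real.sqrt (Real.log r / κ) with hw
  have hw0 : 0 ≤ w := Real.sqrt_nonneg _
  have hw2 : κ * w ^ 2 = Real.log r := by
    rw [hw, Real.sq_sqrt (by positivity)]
    field_simp
  have hpdf' : ∀ x, gaussianPDFReal 0 v' x = (Real.sqrt (2 * Real.pi))⁻¹ * σ⁻¹ *
      Real.exp (κ * x ^ 2 - κ * w ^ 2 + -x ^ 2 / (2 * σ ^ 2)) := by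
    intro x
    rw [gaussianPDFReal_eq hσ' hv', sub_zero, hw2]
    have h1 : Real.exp (κ * x ^ 2 - Real.log r + -x ^ 2 / (2 * σ ^ 2)) =
        r⁻¹ * Real.exp (-x ^ 2 / (2 * σ' ^ 2)) := by
      rw [← Real.exp_log (inv_pos.2 (one_pos.trans hr1)), ← Real.exp_add, Real.log_inv]
      congr 1
      rw [hκ]
      field_simp
      ring
    rw [h1, hrσ, mul_inv]
    ring
  have hpdf : ∀ x, gaussianPDFReal 0 v x = (Real.sqrt (2 * Real.pi))⁻¹ * σ⁻¹ *
      Real.exp (-x ^ 2 / (2 * σ ^ 2)) := fun x => by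
    rw [gaussianPDFReal_eq hσ hv, sub_zero]
  have hA : MeasurableSet {x : ℝ | |x| ≤ w} := measurableSet_le (by fun_prop) measurable_const
  have hdil : ∀ x : ℝ, |x| ≤ w ↔ x ^ 2 ≤ w ^ 2 := fun x => by
    rw [← sq_abs x]
    exact (pow_le_pow_iff_left₀ (abs_nonneg x) hw0 two_ne_zero).symm
  refine indist_gaussianReal hv0 hv0' (A := {x : ℝ | |x| ≤ w}) hA ?_ ?_
    (mul_nonneg (by norm_num) (by linarith)) ?_
  · intro x hx
    rw [hpdf, hpdf']
    have := (hdil x).1 hx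
    gcongr
    nlinarith
  · intro x hx
    rw [hpdf, hpdf']
    have : w ^ 2 < x ^ 2 := not_le.1 fun h => hx ((hdil x).2 h)
    gcongr
    nlinarith
  · have h1 : (gaussianReal 0 v).real {x : ℝ | |x| ≤ w} =
        (gaussianReal 0 v').real {x : ℝ | |x| ≤ r * w} := by
      have h2 : gaussianReal 0 v' = (gaussianReal 0 v).map (fun x => r * x) := by
        rw [gaussianReal_map_const_mul, mul_zero]
        congr 1
        ext
        simp [hv, hv', hrσ, mul_pow]
      have hm : MeasurableSet {x : ℝ | |x| ≤ r * w} :=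
        measurableSet_le (by fun_prop) measurable_const
      rw [h2, measureReal_def, measureReal_def, Measure.map_apply (measurable_const_mul _) hm]
      congr 2
      ext x
      simp only [Set.mem_ofPred_eq, Set.mem_preimage, abs_mul, abs_of_pos (one_pos.trans hr1)]
      exact (mul_le_mul_iff_right₀ (one_pos.trans hr1)).symm
    have hwr : w ≤ r * w := le_mul_of_one_le_left hw0 hr1.le
    have h3 : {x : ℝ | |x| ≤ r * w} = {x | |x| ≤ w} ∪ {x | |x| ∈ Set.Ioc w (r * w)} := by
      ext x
      simp only [Set.mem_ofPred_eq, Set.mem_union, Set.mem_Ioc]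
      constructor
      · intro h
        by_cases h' : |x| ≤ w
        · exact Or.inl h'
        · exact Or.inr ⟨not_le.1 h', h⟩
      · rintro (h | h)
        · exact h.trans hwr
        · exact h.2
    rw [h1, h3]
    refine (measureReal_union_le _ _).trans ?_
    rw [gaussianReal_abs_mem_Ioc hw0]
    refine add_le_add le_rfl ?_
    have h4 : (gaussianReal 0 v').real (Set.Ioc w (r * w)) ≤
        (3 / 7 * σ'⁻¹ * Real.exp (-(w / σ') ^ 2 / 2)) * (r * w - w) := by
      refine gaussianReal_Ioc_le hσ' hv' hwr fun x hx => ?_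
      rw [gaussianPDFReal_eq hσ' hv', sub_zero]
      gcongr ?_ * σ'⁻¹ * Real.exp ?_
      · exact inv_sqrt_two_pi_le
      · have h5 : w ^ 2 ≤ x ^ 2 := pow_le_pow_left₀ hw0 hx.1.le 2
        have h6 : -(w / σ') ^ 2 / 2 = -w ^ 2 / (2 * σ' ^ 2) := by field_simp
        rw [h6]
        exact div_le_div_of_nonneg_right (by linarith) (by positivity)
    have h6 := mul_exp_neg_sq_div_two_le (w / σ')
    calc _ ≤ 2 * ((3 / 7 * σ'⁻¹ * Real.exp (-(w / σ') ^ 2 / 2)) * (r * w - w)) := by gcongr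
      _ = 6 / 7 * (r - 1) * (w / σ' * Real.exp (-(w / σ') ^ 2 / 2)) := by ring
      _ ≤ 6 / 7 * (r - 1) * (2 / 3) := by
          have : 0 ≤ r - 1 := by linarith
          gcongr
      _ = _ := by ring

theorem indist_gaussianReal_scale {σ σ' : ℝ} (hσ : 0 < σ) (hσσ' : σ ≤ σ') {v v' : ℝ≥0}
    (hv : (v : ℝ) = σ ^ 2) (hv' : (v' : ℝ) = σ' ^ 2) (μ : ℝ) :
    Indist 0 (4 / 7 * (σ' / σ - 1)) (gaussianReal μ v) (gaussianReal μ v') := by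
  rcases hσσ'.eq_or_lt with rfl | h
  · have : v = v' := by ext; rw [hv, hv']
    subst this
    rw [div_self hσ.ne', sub_self, mul_zero]
    intro g _ _
    simp
  · have h1 := (indist_gaussianReal_scale_zero hσ h hv hv').map (measurable_add_const μ)
    rwa [gaussianReal_map_add_const, gaussianReal_map_add_const, zero_add] at h1

/-- Gaussians whose parameters agree up to a relative error `a` are `a`-close. -/
theorem indist_gaussianReal_of_close {σ σ' a μ μ' : ℝ} (hσ : 0 < σ) (ha : 0 ≤ a) (h₁ : σ ≤ σ')
    (h₂ : σ' ≤ (1 + a) * σ) (hμ : |μ - μ'| ≤ a * σ) {v v' : ℝ≥0} (hv : (v : ℝ) = σ ^ 2)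
    (hv' : (v' : ℝ) = σ' ^ 2) : Indist 0 a (gaussianReal μ v) (gaussianReal μ' v') := by
  have h3 := (indist_gaussianReal_shift hσ hv μ μ').mono le_rfl
    (show 3 / 7 * (|μ - μ'| / σ) ≤ 3 / 7 * a by
      gcongr
      rwa [div_le_iff₀ hσ])
  have h4 := (indist_gaussianReal_scale hσ h₁ hv hv' μ').mono le_rfl
    (show 4 / 7 * (σ' / σ - 1) ≤ 4 / 7 * a by
      have : σ' / σ ≤ 1 + a := by rwa [div_le_iff₀ hσ]
      linarith)
  exact (h3.trans_zero (by positivity) (by positivity) h4).mono le_rfl (by linarith)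

open Complex in
/-- A Gaussian with a diagonal covariance matrix is a product measure. -/
theorem multivariateGaussian_eq_map_pi {d : ℕ} (μ : EuclideanSpace ℝ (Fin d)) {w : Fin d → ℝ}
    (hw : ∀ i, 0 ≤ w i) :
    multivariateGaussian μ (Matrix.diagonal w) =
      (Measure.pi fun i => gaussianReal (μ i) (w i).toNNReal).map (WithLp.toLp 2) := by
  have hS : (Matrix.diagonal w).PosSemidef := Matrix.PosSemidef.diagonal hw
  apply Measure.ext_of_charFun (E := EuclideanSpace ℝ (Fin d))
  ext t
  rw [charFun_multivariateGaussian hS]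
  simp_rw [charFun_pi, charFun_gaussianReal, ← exp_sum]
  congr 1
  rw [Finset.sum_sub_distrib, ← Finset.sum_mul]
  simp [Matrix.mulVec_diagonal, dotProduct, PiLp.inner_apply, Finset.sum_div, hw]
  congr 1
  · congr 1
    exact Finset.sum_congr rfl fun i _ => mul_comm _ _
  · exact Finset.sum_congr rfl fun i _ => by ring

theorem tvDist_multivariateGaussian_le {d : ℕ} {a : ℝ} (ha : 0 ≤ a)
    {μ μ' : EuclideanSpace ℝ (Fin d)} {σ σ' : Fin d → ℝ} (hσ : ∀ i, 0 < σ i)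
    (h₁ : ∀ i, σ i ≤ σ' i) (h₂ : ∀ i, σ' i ≤ (1 + a) * σ i)
    (hμ : ∀ i, |μ i - μ' i| ≤ a * σ i) :
    tvDist (multivariateGaussian μ (Matrix.diagonal fun i => σ i ^ 2))
      (multivariateGaussian μ' (Matrix.diagonal fun i => σ' i ^ 2)) ≤ ENNReal.ofReal (d * a) := by
  refine Indist.tvDist_le (by positivity) ?_
  rw [multivariateGaussian_eq_map_pi _ fun i => sq_nonneg _,
    multivariateGaussian_eq_map_pi _ fun i => sq_nonneg _]
  have h := Indist.pi ha fun i => indist_gaussianReal_of_close (hσ i) ha (h₁ i) (h₂ i) (hμ i)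
    (Real.coe_toNNReal _ (sq_nonneg (σ i))) (Real.coe_toNNReal _ (sq_nonneg (σ' i)))
  rw [mul_zero] at h
  exact h.map (by fun_prop)

end TotalVariation

/-! ### Accuracy of the univariate decoder -/

section Pairs

variable {n : ℕ} (g : Measure ℝ) [IsProbabilityMeasure g]

/-- The dataset, arranged in consecutive disjoint pairs. -/
def consecutivePairs (x : Fin n → ℝ) (t : Fin (n / 2)) (b : Fin 2) : ℝ :=
  x ⟨2 * t.1 + b.1, by omega⟩

theorem measurable_consecutivePairs : Measurable (consecutivePairs (n := n)) :=
  measurable_pi_lambda _ fun _ => measurable_pi_lambda _ fun _ => measurable_pi_apply _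

theorem pi_map_consecutivePairs : (Measure.pi fun _ : Fin n => g).map consecutivePairs =
    Measure.infinitePi fun _ : Fin (n / 2) => Measure.infinitePi fun _ : Fin 2 => g := by
  have hinj : Function.Injective fun p : Fin (n / 2) × Fin 2 =>
      (⟨2 * p.1.1 + p.2.1, by omega⟩ : Fin n) := by
    rintro ⟨⟨t, ht⟩, ⟨b, hb⟩⟩ ⟨⟨t', ht'⟩, ⟨b', hb'⟩⟩ h
    simp only [Fin.mk.injEq] at h
    simp only [Prod.mk.injEq, Fin.mk.injEq]
    omega
  have h := Measure.map_infinitePi_infinitePi_of_inj (P := fun _ : Fin n => g) hinj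
  rw [← Measure.infinitePi_map_curry (fun (_ : Fin (n / 2)) (_ : Fin 2) => g), ← h,
    ← Measure.infinitePi_eq_pi, Measure.map_map (by fun_prop) (by fun_prop)]
  rfl

theorem measurable_absDiff : Measurable fun y : Fin 2 → ℝ => |y 0 - y 1| / Real.sqrt 2 := by
  fun_prop

theorem iIndepFun_pairDiff :
    iIndepFun (fun (t : Fin (n / 2)) (x : Fin n → ℝ) => pairDiff x t)
      (Measure.pi fun _ : Fin n => g) := by
  have hG := measurable_consecutivePairs (n := n)
  have h := iIndepFun_infinitePi (P := fun _ : Fin (n / 2) => Measure.infinitePi fun _ : Fin 2 => g)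
    (X := fun _ y => |y 0 - y 1| / Real.sqrt 2) fun _ => measurable_absDiff
  have hY : ∀ t : Fin (n / 2), Measurable fun y : Fin (n / 2) → Fin 2 → ℝ =>
      |y t 0 - y t 1| / Real.sqrt 2 := fun t => by fun_prop
  have hp : ∀ t : Fin (n / 2), Measurable fun x : Fin n → ℝ => pairDiff x t := fun t =>
    (hY t).comp hG
  rw [iIndepFun_iff_map_fun_eq_infinitePi_map hY, ← pi_map_consecutivePairs,
    Measure.map_map (measurable_pi_lambda _ hY) hG] at h
  simp_rw [fun t => Measure.map_map (μ := Measure.pi fun _ : Fin n => g) (hY t) hG] at h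
  exact (iIndepFun_iff_map_fun_eq_infinitePi_map hp).2 h

theorem pi_map_pairDiff (t : Fin (n / 2)) :
    (Measure.pi fun _ : Fin n => g).map (fun x => pairDiff x t) =
      (g.prod g).map fun p => |p.1 - p.2| / Real.sqrt 2 := by
  have hne : (⟨2 * t.1, by omega⟩ : Fin n) ≠ ⟨2 * t.1 + 1, by omega⟩ := by
    simp
  rw [← Measure.infinitePi_map_eval_prod (P := fun _ : Fin n => g) hne,
    Measure.map_map (by fun_prop) (by fun_prop), Measure.infinitePi_eq_pi]
  rfl

end Pairs

section Univariate

variable {n : ℕ} {g : Measure ℝ} [IsProbabilityMeasure g] {γ μ σ : ℝ} {v : ℝ≥0}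

theorem mul_measureReal_le {Y : Type*} [MeasurableSpace Y] {f g : Measure Y}
    [IsFiniteMeasure g] {c : ℝ} (hc : 0 ≤ c) (h : ENNReal.ofReal c • f ≤ g) (s : Set Y) :
    c * f.real s ≤ g.real s := by
  have h1 := ENNReal.toReal_mono (by finiteness) (h s)
  rwa [Measure.smul_apply, smul_eq_mul, ENNReal.toReal_mul, ENNReal.toReal_ofReal hc] at h1

/-- Both samples of a pair are uncorrupted with probability `(1 - γ) ^ 2`. -/
theorem prod_dyadic_ge (hγ : γ < 1) (hv : (v : ℝ) = σ ^ 2)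
    (hg : ENNReal.ofReal (1 - γ) • gaussianReal μ v ≤ g) {a : ℝ} (ha : 0 < a) (haσ : a ≤ σ)
    (hσa : σ ≤ 2 * a) : (1 - γ) ^ 2 / 5 ≤
      (g.prod g).real {p | |p.1 - p.2| / Real.sqrt 2 ∈ Set.Ioc a (2 * a)} := by
  have hγ' : 0 ≤ 1 - γ := by linarith
  have h : ENNReal.ofReal ((1 - γ) ^ 2) • (gaussianReal μ v).prod (gaussianReal μ v) ≤
      g.prod g := by
    refine le_trans (le_of_eq ?_) (Measure.prod_mono hg hg)
    rw [Measure.prod_smul_left, Measure.prod_smul_right, smul_smul, ← ENNReal.ofReal_mul hγ', sq]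
  have h1 := mul_measureReal_le (by positivity) h
    {p | |p.1 - p.2| / Real.sqrt 2 ∈ Set.Ioc a (2 * a)}
  have h2 := gaussianReal_prod_dyadic_ge hv ha haσ hσa μ
  have h3 : (0 : ℝ) ≤ (1 - γ) ^ 2 := by positivity
  nlinarith

theorem measure_notMem_varianceDecoder_le {Ω₁ : Type*} [MeasurableSpace Ω₁] {P : Measure Ω₁}
    [IsProbabilityMeasure P] {N : Ω₁ → ℤ → ℝ} (hN : Measurable N) (hNP : P.map N = laplaceTape ℤ)
    (hn : 2 ≤ n) (hγ : γ < 1) (hv : (v : ℝ) = σ ^ 2)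
    (hg : ENNReal.ofReal (1 - γ) • gaussianReal μ v ≤ g) {k : ℤ} (hk : (2 : ℝ) ^ k ≤ σ)
    (hk' : σ ≤ (2 : ℝ) ^ (k + 1)) {ε δ β : ℝ} (hε : ε ∈ Set.Ioc (0 : ℝ) 1)
    (hβ : β ∈ Set.Ioo (0 : ℝ) 1)
    (h₁ : 20 * Real.log (4 * (n / 2 : ℕ) / β) ≤ (n / 2 : ℕ) * ε * ((1 - γ) ^ 2 / 8))
    (h₂ : 4 * Real.log (2 / δ) ≤ (n / 2 : ℕ) * ε * ((1 - γ) ^ 2 / 8)) :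
    (Measure.pi fun _ : Fin n => g).prod P {z | k ∉ varianceDecoder γ ε δ z.1 (N z.2)} ≤
      ENNReal.ofReal (β / 2) := by
  have hγ' : 0 < 1 - γ := by linarith
  have hp : ∀ t : Fin (n / 2), Measurable fun x : Fin n → ℝ => pairDiff x t := fun t => by
    unfold pairDiff
    fun_prop
  have h2k : (2 : ℝ) ^ (k + 1) = 2 * 2 ^ k := by
    rw [zpow_add_one₀ two_ne_zero, mul_comm]
  have hq : ∀ t : Fin (n / 2), 8 / 5 * ((1 - γ) ^ 2 / 8) ≤ (Measure.pi fun _ : Fin n => g).real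
      {x | pairDiff x t ∈ Set.Ioc ((2 : ℝ) ^ k) ((2 : ℝ) ^ (k + 1))} := by
    intro t
    have h3 := prod_dyadic_ge hγ hv hg (zpow_pos two_pos k) hk (h2k ▸ hk')
    have h4 : Measurable fun p : ℝ × ℝ => |p.1 - p.2| / Real.sqrt 2 := by fun_prop
    have h5 : (Measure.pi fun _ : Fin n => g).real
        {x | pairDiff x t ∈ Set.Ioc ((2 : ℝ) ^ k) ((2 : ℝ) ^ (k + 1))} =
        ((Measure.pi fun _ : Fin n => g).map (fun x => pairDiff x t)).real
          (Set.Ioc ((2 : ℝ) ^ k) ((2 : ℝ) ^ (k + 1))) := by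
      rw [measureReal_def, measureReal_def, Measure.map_apply (hp t) measurableSet_Ioc]
      rfl
    rw [h5, pi_map_pairDiff, measureReal_def, Measure.map_apply h4 measurableSet_Ioc, h2k]
    refine le_trans (le_of_eq (by ring)) h3
  have hT : 12 / (1 - γ) ^ 2 = 3 / (2 * ((1 - γ) ^ 2 / 8)) := by
    field_simp
    norm_num
  unfold varianceDecoder
  rw [hT]
  exact measure_notMem_heavyBins_le (by omega) hp (iIndepFun_pairDiff g) hN hNP
    (fun _ => measurableSet_Ioc) pairwise_disjoint_dyadic hε (by positivity) hβ hq h₁ h₂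

theorem measure_notMem_meanDecoder_le {Ω₁ : Type*} [MeasurableSpace Ω₁] {P : Measure Ω₁}
    [IsProbabilityMeasure P] {N : Ω₁ → ℤ → ℝ} (hN : Measurable N) (hNP : P.map N = laplaceTape ℤ)
    (hn : 1 ≤ n) (hγ : γ < 1) (hσ : 0 < σ) (hv : (v : ℝ) = σ ^ 2)
    (hg : ENNReal.ofReal (1 - γ) • gaussianReal μ v ≤ g) {s : ℝ} (hs : σ ≤ s) {i : ℤ}
    (hi : μ ∈ Set.Ioc (((i : ℝ) - 1 / 2) * s) (((i : ℝ) + 1 / 2) * s)) {ε δ β : ℝ}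
    (hε : ε ∈ Set.Ioc (0 : ℝ) 1) (hβ : β ∈ Set.Ioo (0 : ℝ) 1)
    (h₁ : 20 * Real.log (4 * n / β) ≤ n * ε * ((1 - γ) / 8))
    (h₂ : 4 * Real.log (2 / δ) ≤ n * ε * ((1 - γ) / 8)) :
    (Measure.pi fun _ : Fin n => g).prod P {z | (i : ℝ) * s ∉ meanDecoder γ ε δ s z.1 (N z.2)} ≤
      ENNReal.ofReal (β / 2) := by
  have hγ' : 0 < 1 - γ := by linarith
  have hs0 : 0 < s := hσ.trans_le hs
  have hq : ∀ t : Fin n, 8 / 5 * ((1 - γ) / 8) ≤ (Measure.pi fun _ : Fin n => g).real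
      {x | x t ∈ Set.Ioc (((i : ℝ) - 1 / 2) * s) (((i : ℝ) + 1 / 2) * s)} := by
    intro t
    have h3 := gaussianReal_Ioc_ge hσ hv (by linarith) hi
    have h4 := mul_measureReal_le hγ'.le hg
      (Set.Ioc (((i : ℝ) - 1 / 2) * s) (((i : ℝ) + 1 / 2) * s))
    have h5 : (Measure.pi fun _ : Fin n => g).real
        {x | x t ∈ Set.Ioc (((i : ℝ) - 1 / 2) * s) (((i : ℝ) + 1 / 2) * s)} =
        g.real (Set.Ioc (((i : ℝ) - 1 / 2) * s) (((i : ℝ) + 1 / 2) * s)) := by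
      rw [measureReal_def, measureReal_def]
      congr 1
      exact (measurePreserving_eval (fun _ : Fin n => g) t).measure_preimage
        measurableSet_Ioc.nullMeasurableSet
    rw [h5]
    nlinarith
  have hT : 12 / (1 - γ) = 3 / (2 * ((1 - γ) / 8)) := by
    field_simp
    norm_num
  have hind : iIndepFun (fun (t : Fin n) (x : Fin n → ℝ) => x t) (Measure.pi fun _ : Fin n => g) :=
    iIndepFun_pi (X := fun _ y => y) fun _ => aemeasurable_id
  refine (measure_mono fun z hz => ?_).trans (measure_notMem_heavyBins_le hn
    (fun t => measurable_pi_apply t) hind hN hNP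
    (fun _ => measurableSet_Ioc) (pairwise_disjoint_centred hs0.le) hε
    (div_pos hγ' (by norm_num : (0 : ℝ) < 8)) hβ hq h₁ h₂)
  rw [← hT]
  exact fun h => hz ⟨i, h, rfl⟩

/-- The grids around the coarse candidates contain an `α`-approximation of the parameters. -/
theorem exists_mem_univariateDecoder {α β ε δ : ℝ} (hα : α ∈ Set.Ioo (0 : ℝ) 1) {x : Fin n → ℝ}
    {ω : UniIndex → ℝ} {k : ℤ} (hkσ : (2 : ℝ) ^ k < σ) (hσk : σ ≤ (2 : ℝ) ^ (k + 1))
    (hk : k ∈ coarseVariances γ ε δ x ω) {u : ℝ} (hu : u ∈ coarseMeans γ ε δ x ω k)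
    (huμ : |μ - u| ≤ (2 : ℝ) ^ (k + 1) / 2) :
    (∃ μ' ∈ (univariateDecoder α β γ ε δ x ω).1, |μ - μ'| ≤ α * σ) ∧
    ∃ σ' ∈ (univariateDecoder α β γ ε δ x ω).2, σ ≤ σ' ∧ σ' ≤ (1 + α) * σ := by
  obtain ⟨hα0, hα1⟩ := hα
  have hs : (2 : ℝ) ^ (k + 1) < 2 * σ := by
    rw [zpow_add_one₀ two_ne_zero]
    linarith
  have hσ : 0 < σ := (zpow_pos two_pos k).trans hkσ
  have hs0 : (0 : ℝ) < 2 ^ (k + 1) := by positivity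
  constructor
  · set s : ℝ := 2 ^ (k + 1) with hsdef
    have hαs : 0 < α * s := by positivity
    -- the grid point next to the mean, for a grid of width `α s ≤ 2 α σ`
    set j := round ((μ - u) / (α * s)) with hj
    have hround : |(μ - u) / (α * s) - j| ≤ 1 / 2 := abs_sub_round _
    refine ⟨u + j * α * s, ⟨k, hk, u, hu, j, ?_, rfl⟩, ?_⟩
    · have h1 : |(μ - u) / (α * s)| ≤ 1 / (2 * α) := by
        rw [abs_div, abs_of_pos hαs, div_le_div_iff₀ hαs (by positivity)]
        nlinarith
      have h2 : |(j : ℝ)| ≤ 1 / α := by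
        have h3 : 1 ≤ 1 / α := by rw [le_div_iff₀ hα0]; linarith
        have h4 : 1 / (2 * α) = 1 / α / 2 := by field_simp
        rw [h4] at h1
        have h5 := abs_le.1 h1
        have h6 := abs_le.1 hround
        rw [abs_le]
        constructor <;> linarith
      have h7 : ((|j| : ℤ) : ℝ) ≤ (⌈1 / α⌉ : ℤ) := by
        rw [Int.cast_abs]
        exact h2.trans (Int.le_ceil _)
      exact_mod_cast h7
    · have h1 : μ - (u + j * α * s) = ((μ - u) / (α * s) - j) * (α * s) := by
        field_simp
        ring
      rw [h1, abs_mul, abs_of_pos hαs]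
      nlinarith
  -- the last power of `1 + α` up to `2^(k+1) / σ`, which is less than `2`
  · obtain ⟨j, hj1, hj2⟩ := exists_nat_pow_near (x := (2 : ℝ) ^ (k + 1) / σ) (y := 1 + α)
      (by rw [le_div_iff₀ hσ]; linarith) (by linarith)
    have hpow : 0 < (1 + α) ^ j := by positivity
    rw [le_div_iff₀ hσ] at hj1
    rw [div_lt_iff₀ hσ, pow_succ] at hj2
    refine ⟨_, ⟨k, hk, j, ?_, rfl⟩, ?_, ?_⟩
    · rw [Nat.lt_ceil, Real.lt_logb_iff_rpow_lt (by linarith) two_pos, Real.rpow_natCast]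
      by_contra! h
      nlinarith
    · rw [le_div_iff₀ hpow]
      linarith
    · rw [div_le_iff₀ hpow]
      linarith

theorem laplaceTape_map_none : (laplaceTape UniIndex).map (fun ω k => ω (none, k)) =
    laplaceTape ℤ :=
  Measure.map_infinitePi_infinitePi_of_inj (P := fun _ : UniIndex => stdLaplace)
    (f := fun k : ℤ => (none, k)) fun _ _ h => (Prod.mk.inj h).2

theorem laplaceTape_map_some (k : ℤ) : (laplaceTape UniIndex).map (fun ω i => ω (some k, i)) =
    laplaceTape ℤ :=
  Measure.map_infinitePi_infinitePi_of_inj (P := fun _ : UniIndex => stdLaplace)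
    (f := fun i : ℤ => (some k, i)) fun _ _ h => (Prod.mk.inj h).2

/-- Half of the failure probability is spent on the bin of `σ`, and half on the bin of `μ` in the
histogram for the correct candidate for `σ`. -/
theorem measure_univariateDecoder_le (hn : 2 ≤ n) (hγ : γ < 1) (hσ : 0 < σ)
    (hv : (v : ℝ) = σ ^ 2) (hg : ENNReal.ofReal (1 - γ) • gaussianReal μ v ≤ g) {α β ε δ ε₀ δ₀ : ℝ}
    (hα : α ∈ Set.Ioo (0 : ℝ) 1) (hβ : β ∈ Set.Ioo (0 : ℝ) 1)
    (hε : ε / 2 ∈ Set.Ioc (0 : ℝ) 1) (hε₀ : ε₀ ∈ Set.Ioc (0 : ℝ) 1)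
    (hε₀_def : ε₀ = (ε / 2) / Real.sqrt (6 * (12 / (1 - γ) ^ 2) * Real.log (4 / δ)))
    (hδ₀_def : δ₀ = δ / (4 * (12 / (1 - γ) ^ 2)))
    (h₁ : 20 * Real.log (4 * (n / 2 : ℕ) / β) ≤ (n / 2 : ℕ) * (ε / 2) * ((1 - γ) ^ 2 / 8))
    (h₂ : 4 * Real.log (2 / (δ / 2)) ≤ (n / 2 : ℕ) * (ε / 2) * ((1 - γ) ^ 2 / 8))
    (h₃ : 20 * Real.log (4 * n / β) ≤ n * ε₀ * ((1 - γ) / 8))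
    (h₄ : 4 * Real.log (2 / δ₀) ≤ n * ε₀ * ((1 - γ) / 8)) :
    (Measure.pi fun _ : Fin n => g).prod (laplaceTape UniIndex) {z |
      ¬ ((∃ μ' ∈ (univariateDecoder α β γ ε δ z.1 z.2).1, |μ - μ'| ≤ α * σ) ∧
        ∃ σ' ∈ (univariateDecoder α β γ ε δ z.1 z.2).2, σ ≤ σ' ∧ σ' ≤ (1 + α) * σ)} ≤
      ENNReal.ofReal β := by
  obtain ⟨k, hkσ, hσk⟩ := exists_mem_Ioc_zpow hσ one_lt_two
  set s : ℝ := 2 ^ (k + 1) with hs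
  have hs0 : 0 < s := hσ.trans_le hσk
  set i := ⌈μ / s - 1 / 2⌉ with hi
  have hi1 : μ / s - 1 / 2 ≤ i := Int.le_ceil _
  have hi2 : (i : ℝ) < μ / s - 1 / 2 + 1 := Int.ceil_lt_add_one _
  have hμs : μ = μ / s * s := by field_simp
  have hiμ : μ ∈ Set.Ioc (((i : ℝ) - 1 / 2) * s) (((i : ℝ) + 1 / 2) * s) := by
    constructor
    · rw [hμs]
      gcongr
      linarith
    · rw [hμs]
      gcongr
      linarith
  have hV := measure_notMem_varianceDecoder_le (δ := δ / 2)
    (N := fun (ω : UniIndex → ℝ) (k : ℤ) => ω (none, k))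
    (measurable_pi_lambda _ fun _ => measurable_pi_apply _) laplaceTape_map_none hn hγ hv hg
    hkσ.le hσk hε hβ h₁ h₂
  have hM := measure_notMem_meanDecoder_le (δ := δ₀)
    (N := fun (ω : UniIndex → ℝ) (i : ℤ) => ω (some k, i))
    (measurable_pi_lambda _ fun _ => measurable_pi_apply _) (laplaceTape_map_some k) (by omega) hγ
    hσ hv hg hσk hiμ hε₀ hβ h₃ h₄
  have hsum : ENNReal.ofReal β = ENNReal.ofReal (β / 2) + ENNReal.ofReal (β / 2) := by
    rw [← ENNReal.ofReal_add (by linarith [hβ.1]) (by linarith [hβ.1]), add_halves]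
  rw [hsum]
  refine (measure_mono fun z hz => ?_).trans ((measure_union_le _ _).trans (add_le_add hV hM))
  by_contra hc
  simp only [Set.mem_union, Set.mem_ofPred_eq, not_or, not_not] at hc
  obtain ⟨hc1, hc2⟩ := hc
  rw [hε₀_def, hδ₀_def] at hc2
  refine hz (exists_mem_univariateDecoder hα hkσ hσk hc1 hc2 ?_)
  rw [abs_le]
  constructor <;> nlinarith [hiμ.1, hiμ.2]

end Univariate

/-! ### Size of the list -/

section ListSize

theorem ncard_biUnion_le {ι X : Type*} {s : Set ι} (hs : s.Finite) {t : ι → Set X} {a b : ℝ}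
    (ha : (s.ncard : ℝ) ≤ a) (hb : 0 ≤ b) (ht : ∀ i, (t i).Finite ∧ ((t i).ncard : ℝ) ≤ b) :
    (⋃ i ∈ s, t i).Finite ∧ ((⋃ i ∈ s, t i).ncard : ℝ) ≤ a * b := by
  classical
  refine ⟨hs.biUnion fun i _ => (ht i).1, ?_⟩
  have h : (⋃ i ∈ s, t i) =
      ((hs.toFinset.biUnion fun i => (ht i).1.toFinset : Finset X) : Set X) := by
    ext x
    simp
  rw [h, Set.ncard_coe_finset]
  calc (((hs.toFinset.biUnion fun i => (ht i).1.toFinset).card : ℕ) : ℝ)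
      ≤ ((∑ i ∈ hs.toFinset, ((ht i).1.toFinset).card : ℕ) : ℝ) := by
        exact_mod_cast Finset.card_biUnion_le
    _ ≤ ∑ i ∈ hs.toFinset, b := by
        push_cast
        refine Finset.sum_le_sum fun i _ => ?_
        rw [← Set.ncard_eq_toFinset_card _ (ht i).1]
        exact (ht i).2
    _ = s.ncard * b := by
        rw [Finset.sum_const, nsmul_eq_mul, Set.ncard_eq_toFinset_card _ hs]
    _ ≤ a * b := by gcongr

theorem ncard_image_real_le {ι X : Type*} {s : Set ι} (hs : s.Finite) {b : ℝ}
    (hb : (s.ncard : ℝ) ≤ b) (f : ι → X) : (f '' s).Finite ∧ ((f '' s).ncard : ℝ) ≤ b :=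
  ⟨hs.image f, le_trans (by exact_mod_cast Set.ncard_image_le hs) hb⟩

variable {n : ℕ} {α γ : ℝ} (β ε δ : ℝ) (x : Fin n → ℝ) (ω : UniIndex → ℝ)

theorem coarseVariances_finite : (coarseVariances γ ε δ x ω).Finite := heavyBins_finite _ _ _

theorem coarseVariances_ncard_le :
    ((coarseVariances γ ε δ x ω).ncard : ℝ) ≤ 12 / (1 - γ) ^ 2 :=
  heavyBins_ncard_le (by positivity) _

theorem coarseMeans_finite_ncard_le (hγ : γ < 1) (k : ℤ) :
    (coarseMeans γ ε δ x ω k).Finite ∧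
      ((coarseMeans γ ε δ x ω k).ncard : ℝ) ≤ 12 / (1 - γ) :=
  ncard_image_real_le (heavyBins_finite _ _ _)
    (heavyBins_ncard_le (div_nonneg (by norm_num) (by linarith)) _) _

/-- This is Bernoulli's inequality `2 ≤ (1 + α) ^ (1 / α)`. -/
theorem ceil_logb_two_le (hα : α ∈ Set.Ioo (0 : ℝ) 1) :
    (⌈Real.logb (1 + α) 2⌉₊ : ℝ) ≤ 2 / α := by
  obtain ⟨hα0, hα1⟩ := hα
  have h1 : 1 ≤ 1 / α := by rw [le_div_iff₀ hα0]; linarith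
  have h2 : Real.logb (1 + α) 2 ≤ 1 / α := by
    rw [Real.logb_le_iff_le_rpow (by linarith) two_pos]
    have h3 := one_add_mul_self_le_rpow_one_add (s := α) (by linarith) h1
    rw [one_div_mul_cancel hα0.ne'] at h3
    linarith
  have h4 := Nat.ceil_lt_add_one (Real.logb_nonneg (b := 1 + α) (by linarith) one_le_two)
  have h5 : 2 / α = 1 / α + 1 / α := by ring
  linarith

theorem univariateDecoder_finite_ncard_le (hα : α ∈ Set.Ioo (0 : ℝ) 1) (hγ : γ < 1) :
    ((univariateDecoder α β γ ε δ x ω).1.Finite ∧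
      ((univariateDecoder α β γ ε δ x ω).1.ncard : ℝ) ≤
        12 / (1 - γ) ^ 2 * (12 / (1 - γ) * (5 / α))) ∧
    (univariateDecoder α β γ ε δ x ω).2.Finite ∧
      ((univariateDecoder α β γ ε δ x ω).2.ncard : ℝ) ≤ 12 / (1 - γ) ^ 2 * (2 / α) := by
  have hα0 := hα.1
  have hα1 := hα.2
  have hγ' : 0 < 1 - γ := by linarith
  have hV := coarseVariances_finite (γ := γ) ε δ x ω
  have hV' := coarseVariances_ncard_le (γ := γ) ε δ x ω
  constructor
  · have hset : (univariateDecoder α β γ ε δ x ω).1 = ⋃ k ∈ coarseVariances γ ε δ x ω,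
        ⋃ v ∈ coarseMeans γ ε δ x ω k, (fun j : ℤ => v + j * α * (2 : ℝ) ^ (k + 1)) ''
          Set.Icc (-⌈1 / α⌉) ⌈1 / α⌉ := by
      ext u
      simp only [univariateDecoder, Set.mem_ofPred_eq, Set.mem_iUnion, Set.mem_image, Set.mem_Icc,
        abs_le, exists_prop, eq_comm (a := u)]
    have hj : ((Set.Icc (-⌈1 / α⌉) ⌈1 / α⌉ : Set ℤ).ncard : ℝ) ≤ 5 / α := by
      have h1 : 1 ≤ 1 / α := by rw [le_div_iff₀ hα0]; linarith
      have h2 : 0 ≤ ⌈1 / α⌉ := Int.ceil_nonneg (by positivity)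
      have h3 : ((Set.Icc (-⌈1 / α⌉) ⌈1 / α⌉ : Set ℤ).ncard : ℤ) = 2 * ⌈1 / α⌉ + 1 := by
        rw [← Finset.coe_Icc, Set.ncard_coe_finset, Int.card_Icc, Int.toNat_of_nonneg (by omega)]
        ring
      have h4 : ((Set.Icc (-⌈1 / α⌉) ⌈1 / α⌉ : Set ℤ).ncard : ℝ) = 2 * (⌈1 / α⌉ : ℤ) + 1 := by
        exact_mod_cast h3
      have h5 := Int.ceil_lt_add_one (1 / α)
      have h6 : 5 / α = 5 * (1 / α) := by ring
      rw [h4, h6]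
      linarith
    rw [hset]
    refine ncard_biUnion_le hV hV' (by positivity) fun k => ?_
    obtain ⟨h1, h2⟩ := coarseMeans_finite_ncard_le ε δ x ω hγ k
    exact ncard_biUnion_le h1 h2 (by positivity) fun v =>
      ncard_image_real_le (Set.finite_Icc _ _) hj _
  · have hset : (univariateDecoder α β γ ε δ x ω).2 = ⋃ k ∈ coarseVariances γ ε δ x ω,
        (fun j : ℕ => (2 : ℝ) ^ (k + 1) / (1 + α) ^ j) '' Set.Iio ⌈Real.logb (1 + α) 2⌉₊ := by
      ext u
      simp only [univariateDecoder, Set.mem_ofPred_eq, Set.mem_iUnion, Set.mem_image, Set.mem_Iio,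
        exists_prop, eq_comm (a := u)]
    rw [hset]
    refine ncard_biUnion_le hV hV' (by positivity) fun k =>
      ncard_image_real_le (Set.finite_Iio _) ?_ _
    rw [← Finset.coe_Iio, Set.ncard_coe_finset, Nat.card_Iio]
    exact ceil_logb_two_le hα

theorem multivariateDecoder_finite_ncard_le {d : ℕ} (hd : 1 ≤ d) (hα : α ∈ Set.Ioo (0 : ℝ) 1)
    (hγ : γ < 1) (D : Fin n → EuclideanSpace ℝ (Fin d)) (ω : Fin d × UniIndex → ℝ) :
    (multivariateDecoder d ε δ α β γ n D ω).Finite ∧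
      ((multivariateDecoder d ε δ α β γ n D ω).ncard : ℝ) ≤
        (17280 * ((d : ℝ) ^ 2 / ((1 - γ) ^ 5 * α ^ 2))) ^ d := by
  classical
  have hd1 : (1 : ℝ) ≤ d := by exact_mod_cast hd
  have hα0 := hα.1
  have hα1 := hα.2
  have hγ' : 0 < 1 - γ := by linarith
  have hαd : α / d ∈ Set.Ioo (0 : ℝ) 1 :=
    ⟨by positivity, (div_le_self hα0.le hd1).trans_lt hα1⟩
  have h := fun i => univariateDecoder_finite_ncard_le (β / d) (ε / d) (δ / d) (fun t => D t i)
    (fun a => ω (i, a)) hαd hγ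
  set U : Fin d → Set (ℝ × ℝ) := fun i =>
    (coordinateDecoder d α β γ ε δ D ω i).1 ×ˢ (coordinateDecoder d α β γ ε δ D ω i).2 with hU
  have hUfin : ∀ i, (U i).Finite := fun i => (h i).1.1.prod (h i).2.1
  have hUcard : ∀ i, ((U i).ncard : ℝ) ≤ 17280 * ((d : ℝ) ^ 2 / ((1 - γ) ^ 5 * α ^ 2)) := by
    intro i
    rw [hU, Set.ncard_prod, Nat.cast_mul]
    refine (mul_le_mul (h i).1.2 (h i).2.2 (by positivity) (by positivity)).trans_eq ?_
    field_simp
    norm_num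
  have hset : multivariateDecoder d ε δ α β γ n D ω =
      (fun p : Fin d → ℝ × ℝ => multivariateGaussian (WithLp.toLp 2 fun i => (p i).1)
        (Matrix.diagonal fun i => (p i).2 ^ 2)) '' Set.univ.pi U := by
    ext q
    constructor
    · rintro ⟨μ, σ, hμ, hσ, rfl⟩
      exact ⟨fun i => (μ i, σ i), fun i _ => ⟨hμ i, hσ i⟩, rfl⟩
    · rintro ⟨p, hp, rfl⟩
      exact ⟨_, _, fun i => (hp i trivial).1, fun i => (hp i trivial).2, rfl⟩
  rw [hset]
  refine ncard_image_real_le (Set.Finite.pi hUfin) ?_ _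
  have hpi : Set.univ.pi U = (Fintype.piFinset fun i => (hUfin i).toFinset : Finset _) := by
    ext p
    simp
  rw [hpi, Set.ncard_coe_finset, Fintype.card_piFinset, Nat.cast_prod]
  calc ∏ i, (((hUfin i).toFinset.card : ℕ) : ℝ)
      ≤ ∏ _i : Fin d, 17280 * ((d : ℝ) ^ 2 / ((1 - γ) ^ 5 * α ^ 2)) := by
        refine Finset.prod_le_prod (fun i _ => by positivity) fun i _ => ?_
        rw [← Set.ncard_eq_toFinset_card _ (hUfin i)]
        exact hUcard i
    _ = _ := by simp

end ListSize

/-! ### Accuracy of the multivariate decoder -/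

section Multivariate

theorem noiseLaw_map_coordinate {d : ℕ} (i : Fin d) :
    (noiseLaw d).map (fun ω a => ω (i, a)) = laplaceTape UniIndex :=
  Measure.map_infinitePi_infinitePi_of_inj (P := fun _ : Fin d × UniIndex => stdLaplace)
    (f := fun a : UniIndex => (i, a)) fun _ _ h => (Prod.mk.inj h).2

instance isProbabilityMeasure_noiseLaw (d : ℕ) : IsProbabilityMeasure (noiseLaw d) := by
  unfold noiseLaw
  infer_instance

theorem tvDistSet_le {Y : Type*} [MeasurableSpace Y] {p q : Measure Y} {F : Set (Measure Y)}
    (hq : q ∈ F) : tvDistSet p F ≤ tvDist p q :=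
  iInf₂_le q hq

/-- The failure probabilities of the coordinates add up, and so do their distances in total
variation. -/
theorem le_measure_tvDistSet_multivariateDecoder {d n : ℕ} (hd : 1 ≤ d) (hn : 2 ≤ n)
    {α β γ ε δ ε₀ δ₀ : ℝ} (hα : α ∈ Set.Ioo (0 : ℝ) 1) (hβ : β ∈ Set.Ioo (0 : ℝ) 1)
    (hγ : γ < 1) {μ : EuclideanSpace ℝ (Fin d)} {σ : Fin d → ℝ} (hσ : ∀ i, 0 < σ i)
    {g : Measure (EuclideanSpace ℝ (Fin d))} [IsProbabilityMeasure g]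
    (hg : ENNReal.ofReal (1 - γ) • multivariateGaussian μ (Matrix.diagonal fun i => σ i ^ 2) ≤ g)
    (hε : ε / d / 2 ∈ Set.Ioc (0 : ℝ) 1) (hε₀ : ε₀ ∈ Set.Ioc (0 : ℝ) 1)
    (hε₀_def : ε₀ = (ε / d / 2) / Real.sqrt (6 * (12 / (1 - γ) ^ 2) * Real.log (4 / (δ / d))))
    (hδ₀_def : δ₀ = δ / d / (4 * (12 / (1 - γ) ^ 2)))
    (h₁ : 20 * Real.log (4 * (n / 2 : ℕ) / (β / d)) ≤
      (n / 2 : ℕ) * (ε / d / 2) * ((1 - γ) ^ 2 / 8))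
    (h₂ : 4 * Real.log (2 / (δ / d / 2)) ≤ (n / 2 : ℕ) * (ε / d / 2) * ((1 - γ) ^ 2 / 8))
    (h₃ : 20 * Real.log (4 * n / (β / d)) ≤ n * ε₀ * ((1 - γ) / 8))
    (h₄ : 4 * Real.log (2 / δ₀) ≤ n * ε₀ * ((1 - γ) / 8)) :
    ENNReal.ofReal (1 - β) ≤ ((Measure.pi fun _ : Fin n => g).prod (noiseLaw d))
      {z | tvDistSet (multivariateGaussian μ (Matrix.diagonal fun i => σ i ^ 2))
        (multivariateDecoder d ε δ α β γ n z.1 z.2) ≤ ENNReal.ofReal α} := by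
  have hd1 : (1 : ℝ) ≤ d := by exact_mod_cast hd
  have hd0 : (0 : ℝ) < d := by linarith
  obtain ⟨hα0, hα1⟩ := hα
  obtain ⟨hβ0, hβ1⟩ := hβ
  have hαd : α / d ∈ Set.Ioo (0 : ℝ) 1 :=
    ⟨by positivity, (div_le_self hα0.le hd1).trans_lt hα1⟩
  have hβd : β / d ∈ Set.Ioo (0 : ℝ) 1 :=
    ⟨by positivity, (div_le_self hβ0.le hd1).trans_lt hβ1⟩
  set Q := Measure.pi fun _ : Fin n => g with hQ
  -- the parameters of coordinate `i` are approximated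
  set good : Fin d → Set ((Fin n → ℝ) × (UniIndex → ℝ)) := fun i => {z |
      (∃ μ' ∈ (univariateDecoder (α / d) (β / d) γ (ε / d) (δ / d) z.1 z.2).1,
        |μ i - μ'| ≤ α / d * σ i) ∧
      ∃ σ' ∈ (univariateDecoder (α / d) (β / d) γ (ε / d) (δ / d) z.1 z.2).2,
        σ i ≤ σ' ∧ σ' ≤ (1 + α / d) * σ i} with hgood
  set F : Fin d → (Fin n → EuclideanSpace ℝ (Fin d)) × (Fin d × UniIndex → ℝ) →
      (Fin n → ℝ) × (UniIndex → ℝ) := fun i =>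
    Prod.map (fun D t => D t i) (fun ω a => ω (i, a)) with hF
  have hfail : ∀ i, Q.prod (noiseLaw d) (F i ⁻¹' (good i)ᶜ) ≤ ENNReal.ofReal (β / d) := by
    intro i
    have hcoord : Measurable fun y : EuclideanSpace ℝ (Fin d) => y i := by fun_prop
    have hdata : Measurable fun (D : Fin n → EuclideanSpace ℝ (Fin d)) t => D t i :=
      measurable_pi_lambda _ fun t => hcoord.comp (measurable_pi_apply t)
    have hnoise : Measurable fun (ω : Fin d × UniIndex → ℝ) (a : UniIndex) => ω (i, a) :=
      measurable_pi_lambda _ fun _ => measurable_pi_apply _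
    have hprob : IsProbabilityMeasure (g.map fun y => y i) :=
      Measure.isProbabilityMeasure_map hcoord.aemeasurable
    have hlaw : (Q.prod (noiseLaw d)).map (F i) =
        (Measure.pi fun _ : Fin n => g.map fun y => y i).prod (laplaceTape UniIndex) := by
      rw [hF, ← Measure.map_prod_map _ _ hdata hnoise, noiseLaw_map_coordinate, hQ,
        Measure.pi_map_pi (fun _ => hcoord.aemeasurable)]
    have hgi : ENNReal.ofReal (1 - γ) • gaussianReal (μ i) (σ i ^ 2).toNNReal ≤
        g.map fun y => y i := by
      have hS : (Matrix.diagonal fun i => σ i ^ 2).PosSemidef :=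
        Matrix.PosSemidef.diagonal fun i => sq_nonneg _
      have h := Measure.map_mono hg hcoord
      rw [Measure.map_smul, (measurePreserving_eval_multivariateGaussian hS).map_eq,
        Matrix.diagonal_apply_eq] at h
      exact h
    refine (Measure.le_map_apply (hdata.prodMap hnoise).aemeasurable _).trans ?_
    rw [hlaw]
    exact measure_univariateDecoder_le hn hγ (hσ i) (Real.coe_toNNReal _ (sq_nonneg _)) hgi hαd hβd
      hε hε₀ hε₀_def hδ₀_def h₁ h₂ h₃ h₄
  have hbad : Q.prod (noiseLaw d) (⋃ i, F i ⁻¹' (good i)ᶜ) ≤ ENNReal.ofReal β := by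
    refine (measure_iUnion_fintype_le _ _).trans ((Finset.sum_le_sum fun i _ => hfail i).trans ?_)
    rw [Finset.sum_const, Finset.card_univ, Fintype.card_fin, nsmul_eq_mul,
      ← ENNReal.ofReal_natCast, ← ENNReal.ofReal_mul hd0.le, mul_div_cancel₀ _ hd0.ne']
  set G := {z : (Fin n → EuclideanSpace ℝ (Fin d)) × (Fin d × UniIndex → ℝ) |
    tvDistSet (multivariateGaussian μ (Matrix.diagonal fun i => σ i ^ 2))
        (multivariateDecoder d ε δ α β γ n z.1 z.2) ≤ ENNReal.ofReal α} with hG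
  have hcover : Set.univ ⊆ G ∪ ⋃ i, F i ⁻¹' (good i)ᶜ := by
    intro z _
    by_cases hz : ∀ i, F i z ∈ good i
    · refine Or.inl ?_
      choose μ' hμ' hμμ' using fun i => (hz i).1
      choose σ' hσ' hσσ' using fun i => (hz i).2
      have hmem : multivariateGaussian (WithLp.toLp 2 μ') (Matrix.diagonal fun i => σ' i ^ 2) ∈
          multivariateDecoder d ε δ α β γ n z.1 z.2 := ⟨_, _, hμ', hσ', rfl⟩
      refine (tvDistSet_le hmem).trans ?_
      refine (tvDist_multivariateGaussian_le hαd.1.le hσ (fun i => (hσσ' i).1)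
        (fun i => (hσσ' i).2) hμμ').trans_eq ?_
      rw [mul_div_cancel₀ _ hd0.ne']
    · push Not at hz
      obtain ⟨i, hi⟩ := hz
      exact Or.inr (Set.mem_iUnion.2 ⟨i, hi⟩)
  have h1 : 1 ≤ Q.prod (noiseLaw d) G + ENNReal.ofReal β := by
    rw [← measure_univ (μ := Q.prod (noiseLaw d))]
    exact (measure_mono hcover).trans ((measure_union_le _ _).trans (by gcongr))
  rw [ENNReal.ofReal_sub _ hβ0.le, ENNReal.ofReal_one]
  exact tsub_le_iff_right.2 h1

end Multivariate

/-! ### Sample size -/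

section SampleSize

theorem log_le_mul_log_of_le {X y : ℝ} (hX : 2 ≤ X) (hy : 0 < y) {m : ℕ} (h : y ≤ 2 ^ m * X) :
    Real.log y ≤ (m + 1) * Real.log X := by
  have hX0 : 0 < X := by linarith
  have h1 := Real.log_le_log hy h
  have h2 := Real.log_le_log two_pos hX
  rw [Real.log_mul (by positivity) hX0.ne', Real.log_pow] at h1
  have h3 : (m : ℝ) * Real.log 2 ≤ m * Real.log X := by gcongr
  linarith

theorem half_le_log {X : ℝ} (hX : 2 ≤ X) : 1 / 2 ≤ Real.log X := by
  have h1 := Real.log_le_log two_pos hX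
  linarith [Real.log_two_gt_d9]

variable {d ε δ β c : ℝ}

theorem two_le_div (hd : 1 ≤ d) (hδ : 0 < δ) (hδ2 : δ ≤ 1 / 2) {b : ℝ} (hb : 0 < b) (hb1 : b ≤ 1) :
    2 ≤ d / (b * δ) := by
  rw [le_div_iff₀ (by positivity)]
  nlinarith

/-- The sample size suffices for the histogram of the pairs. As `n < 1 / δ`, all logarithms in the
requirement are at most `3 log (d / (β δ))`. -/
theorem variance_sampleSize (hd : 1 ≤ d) (hε : 0 < ε) (hδ : 0 < δ) (hβ : β ∈ Set.Ioo (0 : ℝ) 1)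
    {n : ℕ} (hn : 2 ≤ n) (hδn : δ < 1 / (n : ℝ))
    (h : 20000 * Real.log (d / (β * δ)) ≤ n * ε * c ^ 2 / d) :
    20 * Real.log (4 * (n / 2 : ℕ) / (β / d)) ≤ (n / 2 : ℕ) * (ε / d / 2) * (c ^ 2 / 8) ∧
      4 * Real.log (2 / (δ / d / 2)) ≤ (n / 2 : ℕ) * (ε / d / 2) * (c ^ 2 / 8) := by
  obtain ⟨hβ0, hβ1⟩ := hβ
  have hd0 : 0 < d := by linarith
  have hn2 : (2 : ℝ) ≤ n := by exact_mod_cast hn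
  have hδn' : δ * n < 1 := by rwa [lt_div_iff₀ (by linarith)] at hδn
  have hX := two_le_div hd hδ (by nlinarith) hβ0 hβ1.le
  have hℓ := half_le_log hX
  have hhalf : (n : ℝ) / 3 ≤ (n / 2 : ℕ) := by
    have h1 : n ≤ 3 * (n / 2) := by omega
    have h2 : (n : ℝ) ≤ 3 * (n / 2 : ℕ) := by exact_mod_cast h1
    linarith
  have hhalf' : ((n / 2 : ℕ) : ℝ) ≤ n := by exact_mod_cast Nat.div_le_self n 2
  have hrhs : 400 * Real.log (d / (β * δ)) ≤ (n / 2 : ℕ) * (ε / d / 2) * (c ^ 2 / 8) := by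
    calc 400 * Real.log (d / (β * δ)) ≤ (n * ε * c ^ 2 / d) / 48 := by linarith
      _ = (n / 3) * (ε / d / 2) * (c ^ 2 / 8) := by ring
      _ ≤ _ := by gcongr
  have h1 : Real.log (4 * (n / 2 : ℕ) / (β / d)) ≤ (2 + 1) * Real.log (d / (β * δ)) := by
    have hpos : (0 : ℝ) < (n / 2 : ℕ) := by linarith
    refine log_le_mul_log_of_le (m := 2) hX (by positivity) ?_
    rw [show 4 * ((n / 2 : ℕ) : ℝ) / (β / d) = 4 * d * (n / 2 : ℕ) / β by field_simp,
      show 2 ^ 2 * (d / (β * δ)) = 4 * d * (1 / δ) / β by field_simp; norm_num]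
    gcongr
    rw [le_div_iff₀ hδ]
    nlinarith
  have h2 : Real.log (2 / (δ / d / 2)) ≤ (2 + 1) * Real.log (d / (β * δ)) := by
    refine log_le_mul_log_of_le (m := 2) hX (by positivity) ?_
    rw [show 2 / (δ / d / 2) = 4 * d / δ by field_simp; norm_num,
      show 2 ^ 2 * (d / (β * δ)) = 4 * d / δ / β by field_simp; norm_num]
    exact le_div_self (by positivity) hβ0 hβ1.le
  constructor <;> linarith

/-- The sample size suffices for the histogram of the data, even though it is only given the privacy
parameters that advanced composition leaves for each of its runs. -/
theorem mean_sampleSize (hd : 1 ≤ d) (hε : ε ∈ Set.Ioo (0 : ℝ) 1) (hδ : 0 < δ)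
    (hβ : β ∈ Set.Ioo (0 : ℝ) 1) (hc : c ∈ Set.Ioo (0 : ℝ) 1) {n : ℕ} (hn : 2 ≤ n)
    (hδn : δ < 1 / (n : ℝ)) {ε₀ : ℝ}
    (hε₀ : ε₀ = (ε / d / 2) / Real.sqrt (6 * (12 / c ^ 2) * Real.log (4 / (δ / d))))
    (h : 20000 * (Real.log (d / (c * β * δ)) * Real.sqrt (Real.log (d / (c * δ)))) ≤
      n * ε * c ^ 2 / d) :
    ε₀ ∈ Set.Ioc (0 : ℝ) 1 ∧ 20 * Real.log (4 * n / (β / d)) ≤ n * ε₀ * (c / 8) ∧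
      4 * Real.log (2 / (δ / d / (4 * (12 / c ^ 2)))) ≤ n * ε₀ * (c / 8) := by
  obtain ⟨hβ0, hβ1⟩ := hβ
  obtain ⟨hc0, hc1⟩ := hc
  obtain ⟨hε0, hε1⟩ := hε
  have hd0 : 0 < d := by linarith
  have hn2 : (2 : ℝ) ≤ n := by exact_mod_cast hn
  have hδn' : δ * n < 1 := by rwa [lt_div_iff₀ (by linarith)] at hδn
  have hδ2 : δ ≤ 1 / 2 := by nlinarith
  have hX₂ := two_le_div hd hδ hδ2 hc0 hc1.le
  have hX₃ : 2 ≤ d / (c * β * δ) :=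
    two_le_div hd hδ hδ2 (by positivity) (by nlinarith)
  have hℓ₂ := half_le_log hX₂
  have hℓ₃ := half_le_log hX₃
  set ℓ₂ := Real.log (d / (c * δ))
  set ℓ₃ := Real.log (d / (c * β * δ))
  -- the argument of the square root
  have h4d : 4 ≤ 4 / (δ / d) := by
    rw [le_div_iff₀ (by positivity)]
    have : δ / d ≤ 1 := by rw [div_le_one hd0]; linarith
    linarith
  have hlog4 : 1 / 2 ≤ Real.log (4 / (δ / d)) := half_le_log (by linarith)
  have hlog4' : Real.log (4 / (δ / d)) ≤ 3 * ℓ₂ := by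
    refine (log_le_mul_log_of_le (m := 2) hX₂ (by positivity) ?_).trans_eq (by norm_num [ℓ₂])
    rw [show 4 / (δ / d) = 4 * d / δ by field_simp,
      show 2 ^ 2 * (d / (c * δ)) = 4 * d / δ / c by field_simp; norm_num]
    exact le_div_self (by positivity) hc0 hc1.le
  set A := 6 * (12 / c ^ 2) * Real.log (4 / (δ / d)) with hA
  have hc2 : 1 ≤ 1 / c ^ 2 := by
    rw [le_div_iff₀ (by positivity), one_mul]
    exact pow_le_one₀ hc0.le hc1.le
  have hA' : A = 72 * (1 / c ^ 2 * Real.log (4 / (δ / d))) := by rw [hA]; ring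
  have hA1 : 1 ≤ A := by
    rw [hA']
    nlinarith
  have hsqrtA : Real.sqrt A ≤ 15 * Real.sqrt ℓ₂ / c := by
    refine (Real.sqrt_le_left (by positivity)).2 ?_
    rw [div_pow, mul_pow, Real.sq_sqrt (by linarith), hA']
    calc 72 * (1 / c ^ 2 * Real.log (4 / (δ / d))) ≤ 72 * (1 / c ^ 2 * (3 * ℓ₂)) := by gcongr
      _ = 216 * ℓ₂ / c ^ 2 := by ring
      _ ≤ 15 ^ 2 * ℓ₂ / c ^ 2 := by
          gcongr
          norm_num
  have hsqrtA1 : 1 ≤ Real.sqrt A := Real.one_le_sqrt.2 hA1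
  have hsqrtℓ : 0 < Real.sqrt ℓ₂ := Real.sqrt_pos.2 (by linarith)
  have hrhs : 80 * ℓ₃ ≤ n * ε₀ * (c / 8) := by
    have h1 : ε / d / 2 / (15 * Real.sqrt ℓ₂ / c) ≤ ε₀ := by
      rw [hε₀]
      gcongr
    have h2 : 20000 * ℓ₃ ≤ n * ε * c ^ 2 / d / Real.sqrt ℓ₂ := by
      rw [le_div_iff₀ hsqrtℓ]
      linarith
    calc 80 * ℓ₃ ≤ (n * ε * c ^ 2 / d / Real.sqrt ℓ₂) / 240 := by linarith
      _ = n * (ε / d / 2 / (15 * Real.sqrt ℓ₂ / c)) * (c / 8) := by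
          field_simp
          norm_num
      _ ≤ _ := by gcongr
  have h1 : Real.log (4 * n / (β / d)) ≤ 3 * ℓ₃ := by
    refine (log_le_mul_log_of_le (m := 2) hX₃ (by positivity) ?_).trans_eq (by norm_num [ℓ₃])
    rw [show 4 * (n : ℝ) / (β / d) = 4 * d * n / β by field_simp,
      show 2 ^ 2 * (d / (c * β * δ)) = 4 * d * (1 / δ) / β / c by field_simp; norm_num]
    refine le_trans ?_ (le_div_self (by positivity) hc0 hc1.le)
    gcongr
    rw [le_div_iff₀ hδ]
    linarith
  have h2 : Real.log (2 / (δ / d / (4 * (12 / c ^ 2)))) ≤ 16 * ℓ₃ := by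
    have h3 : Real.log ((d / (c * β * δ)) ^ 2) = 2 * ℓ₃ := by simp [ℓ₃]
    have h4 := log_le_mul_log_of_le (m := 7) (X := (d / (c * β * δ)) ^ 2)
      (y := 2 / (δ / d / (4 * (12 / c ^ 2)))) (by nlinarith) (by positivity) ?_
    · rw [h3] at h4
      push_cast at h4
      linarith
    · have h5 : 1 ≤ d / δ := by rw [le_div_iff₀ hδ]; linarith
      have h6 : 1 ≤ 1 / β ^ 2 := by
        rw [le_div_iff₀ (by positivity), one_mul]
        exact pow_le_one₀ hβ0.le hβ1.le
      rw [show 2 / (δ / d / (4 * (12 / c ^ 2))) = 96 * (1 / c ^ 2) * (d / δ) by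
          field_simp; norm_num,
        show 2 ^ 7 * (d / (c * β * δ)) ^ 2 = 128 * (1 / c ^ 2) * (d / δ * (d / δ * (1 / β ^ 2))) by
          field_simp; norm_num]
      have h7 : 1 ≤ d / δ * (1 / β ^ 2) := one_le_mul_of_one_le_of_one_le h5 h6
      gcongr
      · norm_num
      · exact le_mul_of_one_le_right (by positivity) h7
  refine ⟨⟨by rw [hε₀]; positivity, ?_⟩, by linarith, by linarith⟩
  rw [hε₀]
  refine (div_le_self (by positivity) hsqrtA1).trans ?_
  have : ε / d ≤ 1 := by rw [div_le_one hd0]; linarith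
  linarith

theorem rpow_three_halves {x : ℝ} (hx : 0 < x) : x ^ (3 / 2 : ℝ) = x * Real.sqrt x := by
  rw [show (3 / 2 : ℝ) = 1 + 1 / 2 by norm_num, Real.rpow_add hx, Real.rpow_one,
    Real.sqrt_eq_rpow]

/-- With `A = log (1 / (β δ))` and `B = log (d / (1 - γ))`, all logarithms in the sample rate are at
most `A + B`, and `A + B ≤ 2 A (1 + B)` because `δ < 1 / 2` keeps `A` away from `0`. -/
theorem max_two_sampleRate_le {d : ℕ} (hd : 1 ≤ d) {ε δ β γ : ℝ} (hε : ε ∈ Set.Ioo (0 : ℝ) 1)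
    (hδ : δ ∈ Set.Ioo (0 : ℝ) (1 / 2)) (hβ : β ∈ Set.Ioo (0 : ℝ) 1) (hγ : γ ∈ Set.Ioo (0 : ℝ) 1)
    {C : ℝ} (hC : 3 ≤ C) :
    max 2 (C * sampleRate d ε δ β γ) ≤
      9 * C * (1 + Real.log (d / (1 - γ))) ^ (3 / 2 : ℝ) *
        (d * Real.log (1 / (β * δ)) ^ (3 / 2 : ℝ) / ((1 - γ) ^ 2 * ε)) := by
  obtain ⟨hε0, hε1⟩ := hε
  obtain ⟨hδ0, hδ1⟩ := hδ
  obtain ⟨hβ0, hβ1⟩ := hβ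
  obtain ⟨hγ0, hγ1⟩ := hγ
  have hd1 : (1 : ℝ) ≤ d := by exact_mod_cast hd
  have hd0 : (0 : ℝ) < d := by linarith
  set c := 1 - γ with hc
  have hc0 : 0 < c := by rw [hc]; linarith
  have hc1 : c < 1 := by rw [hc]; linarith
  set A := Real.log (1 / (β * δ)) with hA
  set B := Real.log (d / c) with hB
  have hA0 : 1 / 2 ≤ A := half_le_log (two_le_div le_rfl hδ0 hδ1.le hβ0 hβ1.le)
  have hB0 : 0 ≤ B := Real.log_nonneg (by rw [le_div_iff₀ hc0]; linarith)
  have hsum : Real.log (d / (c * β * δ)) = A + B := by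
    rw [hA, hB, ← Real.log_mul (by positivity) (by positivity)]
    congr 1
    field_simp
  have h₁ : Real.log (d / (β * δ)) ≤ A + B := by
    rw [← hsum]
    refine Real.log_le_log (by positivity) ?_
    exact div_le_div_of_nonneg_left hd0.le (by positivity) (by nlinarith [mul_pos hβ0 hδ0])
  have h₂ : Real.log (d / (c * δ)) ≤ A + B := by
    rw [← hsum]
    refine Real.log_le_log (by positivity) ?_
    exact div_le_div_of_nonneg_left hd0.le (by positivity) (by nlinarith [mul_pos hc0 hδ0])
  have hW0 : 1 / 2 ≤ A + B := by linarith
  have hsqrtW : 1 / 2 ≤ Real.sqrt (A + B) := Real.le_sqrt_of_sq_le (by linarith)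
  -- the product dominates the sum, because `A` is bounded from below
  have hWP : A + B ≤ 2 * (A * (1 + B)) := by nlinarith
  have hsqrt2 : Real.sqrt 2 ≤ 3 / 2 := (Real.sqrt_le_left (by norm_num)).2 (by norm_num)
  have hsqrtWP : Real.sqrt (A + B) ≤ 3 / 2 * Real.sqrt (A * (1 + B)) := by
    refine (Real.sqrt_le_sqrt hWP).trans ?_
    rw [Real.sqrt_mul zero_le_two]
    gcongr
  set R := (d : ℝ) / (c ^ 2 * ε) with hR
  have hR1 : 1 ≤ R := by
    rw [hR, le_div_iff₀ (by positivity)]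
    have : c ^ 2 * ε ≤ 1 := mul_le_one₀ (pow_le_one₀ hc0.le hc1.le) hε0.le hε1.le
    linarith
  have hP : (1 + B) ^ (3 / 2 : ℝ) * (d * A ^ (3 / 2 : ℝ) / (c ^ 2 * ε)) =
      R * (A * (1 + B) * Real.sqrt (A * (1 + B))) := by
    rw [← rpow_three_halves (by positivity), Real.mul_rpow (by linarith) (by linarith), hR]
    ring
  rw [mul_assoc, hP]
  set q := A * (1 + B) * Real.sqrt (A * (1 + B)) with hq
  have hW : (A + B) * Real.sqrt (A + B) ≤ 3 * q := by
    calc (A + B) * Real.sqrt (A + B) ≤ (2 * (A * (1 + B))) * (3 / 2 * Real.sqrt (A * (1 + B))) := by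
          gcongr
      _ = 3 * q := by rw [hq]; ring
  have hrate : sampleRate d ε δ β γ ≤ R * (9 * q) := by
    have h3 : sampleRate d ε δ β γ = R * (Real.log (d / (β * δ)) +
        Real.log (d / (c * β * δ)) * Real.sqrt (Real.log (d / (c * δ)))) := by
      rw [sampleRate, ← hc, hR]
      ring
    rw [h3]
    gcongr
    have h4 : Real.log (d / (c * β * δ)) * Real.sqrt (Real.log (d / (c * δ))) ≤
        (A + B) * Real.sqrt (A + B) := by
      rw [hsum]
      gcongr
    nlinarith
  refine max_le ?_ ?_
  · have h5 : 1 / 4 ≤ (A + B) * Real.sqrt (A + B) := by nlinarith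
    have hq0 : 0 ≤ q := by positivity
    have h6 : 1 / 4 ≤ 3 * q := h5.trans hW
    have h7 : 1 / 12 ≤ R * q := by nlinarith
    nlinarith
  · calc C * sampleRate d ε δ β γ ≤ C * (R * (9 * q)) := by gcongr
      _ = _ := by ring

end SampleSize

/-! ### The decoder as a list-decodable learner -/

theorem isProbabilityMeasure_of_mem_corrupted {X : Type*} [MeasurableSpace X] {γ : ℝ}
    (hγ : γ ∈ Set.Ioo (0 : ℝ) 1) {f g : Measure X} [IsProbabilityMeasure f]
    (hg : g ∈ corrupted γ f) : IsProbabilityMeasure g := by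
  obtain ⟨h, hh, rfl⟩ := hg
  refine ⟨?_⟩
  have h1 : 0 ≤ 1 - γ := by linarith [hγ.2]
  simp only [Measure.add_apply, Measure.smul_apply, measure_univ, smul_eq_mul, mul_one]
  rw [← ENNReal.ofReal_add h1 hγ.1.le, sub_add_cancel, ENNReal.ofReal_one]

theorem le_of_mem_corrupted {X : Type*} [MeasurableSpace X] {γ : ℝ} {f g : Measure X}
    (hg : g ∈ corrupted γ f) : ENNReal.ofReal (1 - γ) • f ≤ g := by
  obtain ⟨h, hh, rfl⟩ := hg
  exact Measure.le_add_right le_rfl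

theorem isListDecodableLearner_multivariateDecoder {d : ℕ} (hd : 1 ≤ d) {ε δ : ℝ}
    (hε : ε ∈ Set.Ioo (0 : ℝ) 1) (hδ : 0 < δ) :
    IsListDecodableLearner (noiseLaw d) (multivariateDecoder d ε δ)
      {n : ℕ | 1 ≤ n ∧ δ < 1 / (n : ℝ)} (axisAlignedGaussians d)
      (fun α _ γ => (20000 * ((d : ℝ) ^ 2 / ((1 - γ) ^ 5 * α ^ 2))) ^ d)
      (fun _ β γ => max 2 (20000 * sampleRate d ε δ β γ)) := by
  intro α hα β hβ γ hγ n hnδ hmn f hf g hg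
  obtain ⟨hn1, hδn⟩ := hnδ
  obtain ⟨μ, S, hSoff, hSdiag, rfl⟩ := hf
  have hd1 : (1 : ℝ) ≤ d := by exact_mod_cast hd
  have hd0 : (0 : ℝ) < d := by linarith
  have hc : 1 - γ ∈ Set.Ioo (0 : ℝ) 1 := ⟨by linarith [hγ.2], by linarith [hγ.1]⟩
  constructor
  · intro D ω
    obtain ⟨h1, h2⟩ := multivariateDecoder_finite_ncard_le β ε δ hd hα hγ.2 D ω
    refine ⟨?_, h1, h2.trans ?_⟩
    · rintro q ⟨_, _, _, _, rfl⟩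
      infer_instance
    · have h3 : 0 ≤ (d : ℝ) ^ 2 / ((1 - γ) ^ 5 * α ^ 2) :=
        div_nonneg (by positivity) (mul_nonneg (pow_nonneg hc.1.le _) (by positivity))
      dsimp only
      gcongr
      norm_num
  · have hS : S = Matrix.diagonal fun i => Real.sqrt (S i i) ^ 2 := by
      ext i j
      by_cases hij : i = j
      · subst hij
        rw [Matrix.diagonal_apply_eq, Real.sq_sqrt (hSdiag i).le]
      · rw [Matrix.diagonal_apply_ne _ hij, hSoff i j hij]
    have hgp := isProbabilityMeasure_of_mem_corrupted hγ hg
    have hgf := le_of_mem_corrupted hg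
    rw [hS] at hgf ⊢
    have hn : 2 ≤ n := by
      have h1 := (le_max_left _ _).trans hmn
      exact_mod_cast h1
    have hrate := (le_max_right _ _).trans hmn
    -- each of the two terms of the sample rate accounts for one of the histograms
    have hlog₁ : 0 ≤ Real.log (d / (β * δ)) := by
      have hn2 : (2 : ℝ) ≤ n := by exact_mod_cast hn
      have h1 : δ * n < 1 := by rwa [lt_div_iff₀ (by linarith)] at hδn
      linarith [half_le_log (two_le_div hd1 hδ (by nlinarith) hβ.1 hβ.2.le)]
    have hlog₃ : 0 ≤ Real.log (d / ((1 - γ) * β * δ)) := by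
      have hn2 : (2 : ℝ) ≤ n := by exact_mod_cast hn
      have h1 : δ * n < 1 := by rwa [lt_div_iff₀ (by linarith)] at hδn
      linarith [half_le_log (two_le_div hd1 hδ (by nlinarith) (mul_pos hc.1 hβ.1)
        (mul_le_one₀ hc.2.le hβ.1.le hβ.2.le))]
    set t := (1 - γ) ^ 2 * ε / d with ht
    have ht0 : 0 < t := div_pos (mul_pos (pow_pos hc.1 2) hε.1) hd0
    have hrate' : 20000 * (Real.log (d / (β * δ)) + Real.log (d / ((1 - γ) * β * δ)) *
        Real.sqrt (Real.log (d / ((1 - γ) * δ)))) ≤ n * ε * (1 - γ) ^ 2 / d := by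
      have h1 : sampleRate d ε δ β γ = (Real.log (d / (β * δ)) +
          Real.log (d / ((1 - γ) * β * δ)) * Real.sqrt (Real.log (d / ((1 - γ) * δ)))) / t := by
        rw [sampleRate, ht, add_div, div_div_eq_mul_div, div_div_eq_mul_div]
        ring
      rw [h1, ← mul_div_assoc, div_le_iff₀ ht0] at hrate
      exact hrate.trans_eq (by rw [ht]; ring)
    have hprod := mul_nonneg hlog₃ (Real.sqrt_nonneg (Real.log (d / ((1 - γ) * δ))))
    obtain ⟨hv₁, hv₂⟩ := variance_sampleSize (c := 1 - γ) hd1 hε.1 hδ hβ hn hδn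
      (by linarith only [hrate', hprod])
    obtain ⟨hε₀, hm₁, hm₂⟩ := mean_sampleSize hd1 hε hδ hβ hc hn hδn rfl
      (by linarith only [hrate', hlog₁])
    have hεd : ε / d ≤ 1 := by rw [div_le_one hd0]; linarith [hε.2]
    exact le_measure_tvDistSet_multivariateDecoder hd hn hα hβ hγ.2
      (fun i => Real.sqrt_pos.2 (hSdiag i)) hgf
      ⟨half_pos (div_pos hε.1 hd0), by linarith⟩ hε₀ rfl rfl hv₁ hv₂ hm₁ hm₂

theorem mainTheorem4 :
    ∃ C : ℝ, 0 < C ∧ ∃ C' : ℝ, 0 < C' ∧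
    ∀ d : ℕ, 1 ≤ d → ∀ ε ∈ Set.Ioo (0 : ℝ) 1, ∀ δ ∈ Set.Ioo (0 : ℝ) 1,
      IsDPListDecodableLearner (noiseLaw d) (multivariateDecoder d ε δ)
        {n : ℕ | 1 ≤ n ∧ δ < 1 / (n : ℝ)} (axisAlignedGaussians d)
        (fun α _ γ => (C * ((d : ℝ) ^ 2 / ((1 - γ) ^ 5 * α ^ 2))) ^ d)
        (fun _ β γ => max 2 (C * sampleRate d ε δ β γ)) ε δ ∧
      (δ < 1 / 2 → ∀ β ∈ Set.Ioo (0 : ℝ) 1, ∀ γ ∈ Set.Ioo (0 : ℝ) 1,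
        max 2 (C * sampleRate d ε δ β γ) ≤
          C' * (1 + Real.log (d / (1 - γ))) ^ (3 / 2 : ℝ) *
            (d * Real.log (1 / (β * δ)) ^ (3 / 2 : ℝ) / ((1 - γ) ^ 2 * ε))) := by
  refine ⟨20000, by norm_num, 9 * 20000, by norm_num, fun d hd ε hε δ hδ => ⟨⟨?_, ?_⟩, ?_⟩⟩
  · exact isListDecodableLearner_multivariateDecoder hd hε hδ.1
  · intro α _ β _ γ hγ n _
    exact isDP_multivariateDecoder hd hε hδ α β hγ n
  · intro hδ2 β hβ γ hγ
    exact max_two_sampleRate_le hd hε ⟨hδ.1, hδ2⟩ hβ hγ (by norm_num)
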